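/- **Conventions.** Manifolds are finite-dimensional $C^\infty$-manifolds without boundary, not assumed Hausdorff or second countable, of locally constant dimension; $\mathfrak S$ is the category of manifolds and smooth maps. A *Lie groupoid* $X_1\rightrightarrows X_0$ is a groupoid in $\mathfrak S$ whose source $s$ and target $t$ are submersions; $x\cdot y$ is defined when $t(x)=s(y)$. A (right) *$X_\bullet$-torsor* over a manifold $S$ is a manifold $P$ with a surjective submersion $P\to S$, a smooth anchor map $a:P\to X_0$ and a smooth right action of $X_\bullet$ along $a$, preserving the fibres of $P\to S$, such that for $p,p'$ in the same fibre there is a unique $\gamma\in X_1$ with $p\cdot\gamma=p'$, and $\gamma$ depends smoothly on $(p,p')$. Torsors, with equivariant maps covering arbitrary smooth maps of the bases, form the stack $\mathfrak X=BX_\bullet$ over $\mathfrak S$. An *isomorphism of stacks* is an equivalence of categories over $\mathfrak S$. An *$X_\bullet$-$Y_\bullet$-bitorsor* is a manifold $Q$ with smooth maps $f:Q\to X_0$, $g:Q\to Y_0$ and commuting actions of $X_\bullet$ (on the left, along $f$) and $Y_\bullet$ (on the right, along $g$) such that $Q$ is an $X_\bullet$-torsor over $Y_0$ via $g$ and a $Y_\bullet$-torsor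 over $X_0$ via $f$. A *Morita morphism* $\phi:X_\bullet\to Y_\bullet$ is a morphism of Lie groupoids such that $\phi_0:X_0\to Y_0$ is a surjective submersion and $X_1\cong Y_1\times_{Y_0\times Y_0}(X_0\times X_0)$. An *$S^1$-central extension* $R_1\xrightarrow{\pi}X_1\rightrightarrows X_0$ consists of Lie groupoids $R_1\rightrightarrows X_0$ and $X_1\rightrightarrows X_0$, a morphism $\pi$ of Lie groupoids over $\mathrm{id}_{X_0}$ and a smooth left $S^1$-action on $R_1$ making $\pi$ a principal $S^1$-bundle, with $(\lambda x)(\mu y)=\lambda\mu\,(xy)$ for all $\lambda,\mu\in S^1$ and composable $x,y\in R_1$. Let $\mathfrak R=BR_\bullet$ and $\mathfrak X=BX_\bullet$. The morphism $\pi$ induces a morphism of stacks $\mathfrak R\to\mathfrak X$, $P\mapsto P/S^1$ (up to unique 2-isomorphism, the morphism over $\mathfrak S$ for which there are $\pi$-equivariant maps from $P$ to its image, over the base of $P$ and natural in $P$). It is an *$S^1$-gerbe*: $\mathfrak R\to\mathfrak X$ and $\mathfrak R\to\mathfrak R\times_{\mathfrak X}\mathfrak R$ are epimorphisms, and the band is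 trivialized, i.e. for each $P\in\mathfrak R$ over $U$ the group $C^\infty(U,S^1)$ is identified, naturally in $P$, with the group of automorphisms of $P$ over its image in $\mathfrak X$; here $\lambda:U\to S^1$ acts on $P$ over $U$ by $p\mapsto p\cdot(\lambda(u)\,1_{a(p)})$, for $p$ in the fibre over $u\in U$. **Proposition.** Let $R_1\to X_1\rightrightarrows X_0$ and $R'_1\to X'_1\rightrightarrows X'_0$ be $S^1$-central extensions of Lie groupoids, with associated stacks $\mathfrak R,\mathfrak X$ and $\mathfrak R',\mathfrak X'$. The following are equivalent: (i) The two central extensions are Morita equivalent: there is an $S^1$-equivariant $R_\bullet$-$R'_\bullet$-bitorsor $Z$, i.e. a bitorsor with a smooth $S^1$-action, preserving the maps to $X_0$ and $X'_0$, such that $(\lambda r)\cdot z\cdot r'=r\cdot(\lambda z)\cdot r'=r\cdot z\cdot(\lambda r')$ for all $\lambda\in S^1$ and all $r\in R_1$, $z\in Z$, $r'\in R_1'$ for which $r\cdot z\cdot r'$ is defined. (ii) There are an $S^1$-central extension $R''_1\to X''_1\rightrightarrows X''_0$ and Morita morphisms $R''_\bullet\to R'_\bullet$ and $R''_\bullet\to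 R_\bullet$ which are $S^1$-equivariant on arrows. (iii) There is an isomorphism of stacks $\mathfrak X\cong\mathfrak X'$ over which $\mathfrak R\cong\mathfrak R'$ as $S^1$-gerbes: there are isomorphisms of stacks $F:\mathfrak X\to\mathfrak X'$ and $G:\mathfrak R\to\mathfrak R'$ and a 2-isomorphism making the square with $\mathfrak R\to\mathfrak X$ and $\mathfrak R'\to\mathfrak X'$ commute, such that $G$ carries the automorphism of $P$ given by $\lambda:U\to S^1$ to the automorphism of $G(P)$ given by $\lambda$, for all $P\in\mathfrak R$ over $U$ and all smooth $\lambda:U\to S^1$. -/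

import Mathlib

open CategoryTheory
open scoped Manifold ContDiff

universe u v w

namespace DiffStack

/-! ### Smooth manifolds

Manifolds are finite dimensional, without boundary, not necessarily Hausdorff or second countable,
and their dimension is only locally constant. -/

/-- A chart: a homeomorphism from an open subset of `M` onto an open subset of some `ℝⁿ`. -/
abbrev Chart (M : Type u) [TopologicalSpace M] : Type u :=
  Σ n : ℕ, OpenPartialHomeomorph M (EuclideanSpace ℝ (Fin n))

/-- A `C^∞` manifold. -/
structure Mfd : Type (u + 1) where
  carrier : Type u
  [top : TopologicalSpace carrier]
  atlas : Set (Chart carrier)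
  cover : ∀ x : carrier, ∃ c ∈ atlas, x ∈ c.2.source
  compatible : ∀ c ∈ atlas, ∀ d ∈ atlas, ∀ x, x ∈ c.2.source → x ∈ d.2.source →
    ContDiffAt ℝ ∞ (d.2 ∘ c.2.symm) (c.2 x)

instance : CoeSort Mfd.{u} (Type u) := ⟨Mfd.carrier⟩

instance (M : Mfd.{u}) : TopologicalSpace M := M.top

/-- `f` is `C^∞`: it is continuous, and smooth in all charts. -/
def Smooth {M : Mfd.{u}} {N : Mfd.{v}} (f : M → N) : Prop :=
  Continuous f ∧ ∀ x, ∀ c ∈ M.atlas, ∀ d ∈ N.atlas, x ∈ c.2.source → f x ∈ d.2.source →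
    ContDiffAt ℝ ∞ (d.2 ∘ f ∘ c.2.symm) (c.2 x)

theorem Smooth.id (M : Mfd.{u}) : Smooth (fun x : M => x) :=
  ⟨continuous_id, fun x c hc d hd hx hx' => M.compatible c hc d hd x hx hx'⟩

theorem Smooth.comp {M : Mfd.{u}} {N : Mfd.{v}} {K : Mfd.{w}} {g : N → K} {f : M → N}
    (hg : Smooth g) (hf : Smooth f) : Smooth (fun x => g (f x)) := by
  refine ⟨hg.1.comp hf.1, fun x c hc d hd hx hx' => ?_⟩
  obtain ⟨e, he, hxe⟩ := N.cover (f x)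
  have h1 := hf.2 x c hc e he hx hxe
  have h2 := hg.2 (f x) e he d hd hxe hx'
  have h3 : (e.2 ∘ f ∘ c.2.symm) (c.2 x) = e.2 (f x) := by simp [c.2.left_inv hx]
  rw [← h3] at h2
  refine (h2.comp _ h1).congr_of_eventuallyEq ?_
  have hcont : ContinuousAt (f ∘ c.2.symm) (c.2 x) :=
    hf.1.continuousAt.comp (c.2.continuousAt_symm (c.2.map_source hx))
  have hmem : e.2.source ∈ nhds ((f ∘ c.2.symm) (c.2 x)) := by
    simpa [c.2.left_inv hx] using e.2.open_source.mem_nhds hxe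
  filter_upwards [hcont hmem] with y hy
  have hy' : f (c.2.symm y) ∈ e.2.source := hy
  simp [e.2.left_inv hy']

/-- `C^∞` maps. -/
@[ext]
structure SmoothMap (M : Mfd.{u}) (N : Mfd.{v}) where
  toFun : M → N
  smooth : Smooth toFun

instance (M : Mfd.{u}) (N : Mfd.{v}) : CoeFun (SmoothMap M N) (fun _ => M → N) :=
  ⟨SmoothMap.toFun⟩

def SmoothMap.comp {M : Mfd.{u}} {N : Mfd.{v}} {K : Mfd.{w}} (g : SmoothMap N K)
    (f : SmoothMap M N) : SmoothMap M K :=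
  ⟨fun x => g (f x), g.smooth.comp f.smooth⟩

/-- The category of manifolds and `C^∞` maps. -/
instance : Category Mfd.{u} where
  Hom M N := SmoothMap M N
  id M := ⟨fun x => x, Smooth.id M⟩
  comp f g := SmoothMap.comp g f

/-- The identity map between two equal manifolds. -/
def castMap {M N : Mfd.{u}} (h : M = N) : SmoothMap M N := eqToHom h

/-- Submersions: `C^∞` maps whose derivative is surjective at every point. -/
def IsSubmersion {M : Mfd.{u}} {N : Mfd.{v}} (f : SmoothMap M N) : Prop :=
  ∀ x, ∀ c ∈ M.atlas, ∀ d ∈ N.atlas, x ∈ c.2.source → f x ∈ d.2.source →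
    Function.Surjective (fderiv ℝ (d.2 ∘ f ∘ c.2.symm) (c.2 x))

def IsSurjectiveSubmersion {M : Mfd.{u}} {N : Mfd.{v}} (f : SmoothMap M N) : Prop :=
  Function.Surjective f ∧ IsSubmersion f

/-- A manifold of Mathlib modelled on `ℝⁿ`. -/
def Mfd.ofChartedSpace (n : ℕ) (M : Type u) [TopologicalSpace M]
    [ChartedSpace (EuclideanSpace ℝ (Fin n)) M] [IsManifold (𝓡 n) ∞ M] : Mfd.{u} where
  carrier := M
  atlas := {c | ∃ e ∈ _root_.atlas (EuclideanSpace ℝ (Fin n)) M, c = ⟨n, e⟩}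
  cover x := ⟨⟨n, chartAt _ x⟩, ⟨_, chart_mem_atlas _ x, rfl⟩, mem_chart_source _ x⟩
  compatible := by
    rintro _ ⟨e, he, rfl⟩ _ ⟨e', he', rfl⟩ x hx hx'
    have h := (contDiffGroupoid ∞ (𝓡 n)).compatible he he'
    rw [contDiffGroupoid, mem_groupoid_of_pregroupoid] at h
    have h1 : ContDiffOn ℝ ∞ (e' ∘ e.symm) (e.symm.trans e').source := by
      simpa [contDiffPregroupoid] using h.1
    refine h1.contDiffAt ((e.symm.trans e').open_source.mem_nhds ?_)
    simp only [OpenPartialHomeomorph.trans_source, OpenPartialHomeomorph.symm_source,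
      Set.mem_inter_iff, Set.mem_preimage]
    exact ⟨e.map_source hx, by simpa [e.left_inv hx] using hx'⟩

instance : IsManifold (𝓡 1) ∞ Circle := IsManifold.of_le (n := ω) le_top

/-- The circle `S¹`. -/
noncomputable def S1 : Mfd.{0} := Mfd.ofChartedSpace 1 Circle

/-- A point of the manifold `S¹` as an element of the group `Circle`. -/
abbrev S1.toCircle (z : S1) : Circle := z

/-! ### Lie groupoids

Fibred products are handled through their points with values in arbitrary manifolds: a map out of
`U ×_X V` is smooth if and only if it carries smooth families of composable pairs to smooth
families. -/

/-- A Lie groupoid with manifold of objects `M`. The product `mul g h` is defined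
if `t(g) = s(h)`. -/
structure LieGroupoid (M : Mfd.{u}) : Type (u + 1) where
  arr : Mfd.{u}
  src : SmoothMap arr M
  tgt : SmoothMap arr M
  src_submersion : IsSubmersion src
  tgt_submersion : IsSubmersion tgt
  mul : ∀ g h : arr, tgt g = src h → arr
  one : SmoothMap M arr
  inv : SmoothMap arr arr
  mul_smooth : ∀ (T : Mfd.{u}) (g h : SmoothMap T arr) (e : ∀ x, tgt (g x) = src (h x)),
    Smooth (fun x => mul (g x) (h x) (e x))
  src_mul : ∀ g h e, src (mul g h e) = src g
  tgt_mul : ∀ g h e, tgt (mul g h e) = tgt h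
  src_one : ∀ m, src (one m) = m
  tgt_one : ∀ m, tgt (one m) = m
  src_inv : ∀ g, src (inv g) = tgt g
  tgt_inv : ∀ g, tgt (inv g) = src g
  mul_assoc : ∀ g h k e e', mul (mul g h e) k ((tgt_mul g h e).trans e') =
    mul g (mul h k e') (e.trans (src_mul h k e').symm)
  one_mul : ∀ g, mul (one (src g)) g (tgt_one _) = g
  mul_one : ∀ g, mul g (one (tgt g)) (src_one _).symm = g
  mul_inv : ∀ g, mul g (inv g) (src_inv g).symm = one (src g)
  inv_mul : ∀ g, mul (inv g) g (tgt_inv g) = one (tgt g)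

/-- Morphisms of Lie groupoids. -/
structure LieGroupoidHom {M N : Mfd.{u}} (X : LieGroupoid M) (Y : LieGroupoid N) where
  onObj : SmoothMap M N
  onArr : SmoothMap X.arr Y.arr
  src_comm : ∀ g, Y.src (onArr g) = onObj (X.src g)
  tgt_comm : ∀ g, Y.tgt (onArr g) = onObj (X.tgt g)
  map_mul : ∀ g h e, onArr (X.mul g h e) = Y.mul (onArr g) (onArr h)
    ((tgt_comm g).trans ((congrArg onObj e).trans (src_comm h).symm))

/-- Morita morphisms: `φ₀` is a surjective submersion, and the square with corners `X₁`,
`X₀ × X₀`, `Y₁`, `Y₀ × Y₀` is cartesian in the category of manifolds. -/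
structure LieGroupoidHom.IsMorita {M N : Mfd.{u}} {X : LieGroupoid M} {Y : LieGroupoid N}
    (φ : LieGroupoidHom X Y) : Prop where
  surjectiveSubmersion : IsSurjectiveSubmersion φ.onObj
  cartesian : ∀ (T : Mfd.{u}) (a b : SmoothMap T M) (y : SmoothMap T Y.arr),
    (∀ x, Y.src (y x) = φ.onObj (a x)) → (∀ x, Y.tgt (y x) = φ.onObj (b x)) →
    ∃! z : SmoothMap T X.arr, (∀ x, X.src (z x) = a x) ∧ (∀ x, X.tgt (z x) = b x) ∧
      (∀ x, φ.onArr (z x) = y x)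

/-! ### Torsors and the associated stack -/

/-- The structure of a (right) `Γ`-torsor over `S` on the manifold `P`: a surjective submersion
`P → S`, an anchor map `P → M` and a right action of `Γ`, simply transitive on the fibres of
`P → S`; the unique `γ` with `p · γ = p'` depends smoothly on `(p, p')`. -/
structure TorsorStr {M : Mfd.{u}} (Γ : LieGroupoid M) (P S : Mfd.{u}) where
  proj : SmoothMap P S
  anchor : SmoothMap P M
  proj_submersion : IsSurjectiveSubmersion proj
  act : ∀ (p : P) (γ : Γ.arr), anchor p = Γ.src γ → P
  act_smooth : ∀ (T : Mfd.{u}) (p : SmoothMap T P) (γ : SmoothMap T Γ.arr)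
    (e : ∀ x, anchor (p x) = Γ.src (γ x)), Smooth (fun x => act (p x) (γ x) (e x))
  anchor_act : ∀ p γ e, anchor (act p γ e) = Γ.tgt γ
  act_one : ∀ p, act p (Γ.one (anchor p)) (Γ.src_one _).symm = p
  act_mul : ∀ p γ δ e e', act (act p γ e) δ ((anchor_act p γ e).trans e') =
    act p (Γ.mul γ δ e') (e.trans (Γ.src_mul γ δ e').symm)
  proj_act : ∀ p γ e, proj (act p γ e) = proj p
  simply_transitive : ∀ p p', proj p = proj p' →
    ∃! γ : Γ.arr, ∃ e : anchor p = Γ.src γ, act p γ e = p'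
  division_smooth : ∀ (T : Mfd.{u}) (p p' : SmoothMap T P) (γ : T → Γ.arr)
    (e : ∀ x, anchor (p x) = Γ.src (γ x)), (∀ x, act (p x) (γ x) (e x) = p' x) → Smooth γ

/-- A `Γ`-torsor over a manifold. -/
structure Torsor {M : Mfd.{u}} (Γ : LieGroupoid M) : Type (u + 1) where
  base : Mfd.{u}
  total : Mfd.{u}
  str : TorsorStr Γ total base

/-- Morphisms of `Γ`-torsors, over arbitrary maps of the base manifolds. -/
@[ext]
structure Torsor.Hom {M : Mfd.{u}} {Γ : LieGroupoid M} (P Q : Torsor Γ) where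
  base : SmoothMap P.base Q.base
  total : SmoothMap P.total Q.total
  proj_comm : ∀ p, Q.str.proj (total p) = base (P.str.proj p)
  anchor_comm : ∀ p, Q.str.anchor (total p) = P.str.anchor p
  equivariant : ∀ p γ e, total (P.str.act p γ e) =
    Q.str.act (total p) γ ((anchor_comm p).trans e)

instance {M : Mfd.{u}} (Γ : LieGroupoid M) : Category (Torsor Γ) where
  Hom P Q := Torsor.Hom P Q
  id P := ⟨⟨fun x => x, Smooth.id _⟩, ⟨fun x => x, Smooth.id _⟩, fun _ => rfl, fun _ => rfl,
    fun _ _ _ => rfl⟩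
  comp {P Q K} f g :=
    { base := g.base.comp f.base
      total := g.total.comp f.total
      proj_comm := fun p => (g.proj_comm _).trans (congrArg g.base (f.proj_comm p))
      anchor_comm := fun p => (g.anchor_comm _).trans (f.anchor_comm p)
      equivariant := fun p γ e =>
        (congrArg g.total (f.equivariant p γ e)).trans (g.equivariant _ γ _) }

/-- The stack `BΓ` of `Γ`-torsors, as a category over the category of manifolds. -/
def stack {M : Mfd.{u}} (Γ : LieGroupoid M) : BasedCategory.{u, u + 1} Mfd.{u} where
  obj := Torsor Γ
  p :=
    { obj := fun P => P.base
      map := fun f => Torsor.Hom.base f }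

/-- An isomorphism of stacks: an equivalence of categories over the category of manifolds. -/
structure StackIso (𝔛 𝔜 : BasedCategory.{u, u + 1} Mfd.{u}) where
  hom : BasedFunctor 𝔛 𝔜
  inv : BasedFunctor 𝔜 𝔛
  unit : BasedFunctor.comp hom inv ≅ BasedFunctor.id 𝔛
  counit : BasedFunctor.comp inv hom ≅ BasedFunctor.id 𝔜

/-! ### Gerbes -/

/-- A morphism of groupoid fibrations is an epimorphism if every object `x` of the target over `U`
becomes isomorphic to the image of an object after pullback along a surjective submersion
`V → U`. (An arrow `p(r) ⟶ x` lying over `V → U` is the same thing as an isomorphism of `p(r)` with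
the pullback of `x` to `V`.) -/
def IsEpimorphism {ℜ 𝔛 : BasedCategory.{u, u + 1} Mfd.{u}} (p : BasedFunctor ℜ 𝔛) : Prop :=
  ∀ x : 𝔛.obj, ∃ (r : ℜ.obj) (a : p.obj r ⟶ x),
    IsSurjectiveSubmersion (M := 𝔛.p.obj (p.obj r)) (N := 𝔛.p.obj x) (𝔛.p.map a)

/-- The diagonal `ℜ → ℜ ×_𝔛 ℜ` is an epimorphism: an object `(r₁, r₂, α : p(r₁) ≅ p(r₂))` of the
fibred product comes, after pullback along a surjective submersion, from an object `r`. -/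
def IsDiagonalEpimorphism {ℜ 𝔛 : BasedCategory.{u, u + 1} Mfd.{u}} (p : BasedFunctor ℜ 𝔛) :
    Prop :=
  ∀ (r₁ r₂ : ℜ.obj) (α : p.obj r₁ ≅ p.obj r₂), ∃ (r : ℜ.obj) (a₁ : r ⟶ r₁) (a₂ : r ⟶ r₂),
    IsSurjectiveSubmersion (M := ℜ.p.obj r) (N := ℜ.p.obj r₁) (ℜ.p.map a₁) ∧
      p.map a₁ ≫ α.hom = p.map a₂

/-- The structure of an `S¹`-gerbe on a morphism of stacks `p : ℜ → 𝔛`: it is a gerbe, and its band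
is trivialized, i.e. for every object `r` of `ℜ` over `U` the group of automorphisms of `r` over
its image in `𝔛` is identified with the group of smooth maps `U → S¹`, compatibly with all arrows
of `ℜ` (in particular with pullbacks). -/
structure S1GerbeStr {ℜ 𝔛 : BasedCategory.{u, u + 1} Mfd.{u}} (p : BasedFunctor ℜ 𝔛) where
  epi : IsEpimorphism p
  diag_epi : IsDiagonalEpimorphism p
  band : ∀ r : ℜ.obj, SmoothMap (ℜ.p.obj r) S1 → (r ⟶ r)
  band_mul : ∀ r (l m n : SmoothMap (ℜ.p.obj r) S1),
    (∀ x, S1.toCircle (n x) = S1.toCircle (l x) * S1.toCircle (m x)) →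
      band r n = band r l ≫ band r m
  band_natural : ∀ {r r' : ℜ.obj} (a : r ⟶ r') (l : SmoothMap (ℜ.p.obj r') S1),
    band r (SmoothMap.comp l (M := ℜ.p.obj r) (ℜ.p.map a)) ≫ a = a ≫ band r' l
  band_vertical : ∀ r l, p.map (band r l) = 𝟙 (p.obj r)
  band_bijective : ∀ r (b : r ⟶ r), p.map b = 𝟙 (p.obj r) → ∃! l, band r l = b

/-- An isomorphism of `S¹`-gerbes `ℜ → 𝔛` and `ℜ' → 𝔛'` over an isomorphism of stacks
`F : 𝔛 ≅ 𝔛'`: an isomorphism of stacks `ℜ ≅ ℜ'`, a 2-isomorphism making the square with the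
structure morphisms commute, such that the trivializations of the bands correspond. -/
structure S1GerbeIso {ℜ 𝔛 ℜ' 𝔛' : BasedCategory.{u, u + 1} Mfd.{u}} {p : BasedFunctor ℜ 𝔛}
    {p' : BasedFunctor ℜ' 𝔛'} (𝒢 : S1GerbeStr p) (𝒢' : S1GerbeStr p') (F : StackIso 𝔛 𝔛') where
  iso : StackIso ℜ ℜ'
  square : BasedFunctor.comp iso.hom p' ≅ BasedFunctor.comp p F.hom
  band_comm : ∀ (r : ℜ.obj) (l : SmoothMap (ℜ.p.obj r) S1),
    iso.hom.map (𝒢.band r l) =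
      𝒢'.band (iso.hom.obj r) (l.comp (castMap (iso.hom.w_obj r)))

/-! ### Central extensions -/

/-- An `S¹`-central extension `R₁ → X₁ ⇉ X₀` of a Lie groupoid `X` with objects `M = X₀`. -/
structure CentralExtension {M : Mfd.{u}} (X : LieGroupoid M) : Type (u + 1) where
  grpd : LieGroupoid M
  π : SmoothMap grpd.arr X.arr
  src_π : ∀ r, X.src (π r) = grpd.src r
  tgt_π : ∀ r, X.tgt (π r) = grpd.tgt r
  π_mul : ∀ r r' e, π (grpd.mul r r' e) =
    X.mul (π r) (π r') ((tgt_π r).trans (e.trans (src_π r').symm))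
  /-- the left action of `S¹` on `R₁`, -/
  smul : Circle → grpd.arr → grpd.arr
  one_smul : ∀ r, smul 1 r = r
  mul_smul : ∀ a b r, smul (a * b) r = smul a (smul b r)
  smul_smooth : ∀ (T : Mfd.{u}) (l : SmoothMap T S1) (r : SmoothMap T grpd.arr),
    Smooth (fun x => smul (S1.toCircle (l x)) (r x))
  /-- which makes `π : R₁ → X₁` a principal `S¹`-bundle -/
  π_submersion : IsSurjectiveSubmersion π
  π_smul : ∀ a r, π (smul a r) = π r
  simply_transitive : ∀ r r', π r = π r' → ∃! a, smul a r = r'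
  division_smooth : ∀ (T : Mfd.{u}) (r r' : SmoothMap T grpd.arr) (l : T → S1),
    (∀ x, smul (S1.toCircle (l x)) (r x) = r' x) → Smooth l
  /-- and is compatible with the groupoid structure. -/
  smul_mul_smul : ∀ a b r r' (e : grpd.tgt r = grpd.src r')
    (e' : grpd.tgt (smul a r) = grpd.src (smul b r')),
    grpd.mul (smul a r) (smul b r') e' = smul (a * b) (grpd.mul r r' e)

namespace CentralExtension

variable {M : Mfd.{u}} {X : LieGroupoid M} (E : CentralExtension X)

theorem src_smul (a : Circle) (r : E.grpd.arr) : E.grpd.src (E.smul a r) = E.grpd.src r := by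
  rw [← E.src_π, E.π_smul, E.src_π]

theorem tgt_smul (a : Circle) (r : E.grpd.arr) : E.grpd.tgt (E.smul a r) = E.grpd.tgt r := by
  rw [← E.tgt_π, E.π_smul, E.tgt_π]

/-- The `S¹`-gerbe `ℜ → 𝔛` associated to an `S¹`-central extension, where `ℜ` and `𝔛` are the
stacks of `R`-torsors and of `X`-torsors. The morphism `ℜ → 𝔛` is the one induced by the morphism
of groupoids `π`: it sends `P` to the `X`-torsor over the same base which receives a
`π`-equivariant map from `P` (i.e. to `P / S¹`), naturally in `P`; this determines it up to a
unique 2-isomorphism. The trivialization of the band sends `l : U → S¹` to the automorphism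
`x ↦ x · (l · 1)` of a torsor over `U`. -/
structure AssociatedGerbe where
  proj : BasedFunctor (stack E.grpd) (stack X)
  toProj : ∀ P : Torsor E.grpd, SmoothMap P.total (Torsor.total (proj.obj P))
  proj_toProj : ∀ (P : Torsor E.grpd) (x : P.total),
    (Torsor.str (proj.obj P)).proj (toProj P x) = castMap (proj.w_obj P).symm (P.str.proj x)
  anchor_toProj : ∀ (P : Torsor E.grpd) (x : P.total),
    (Torsor.str (proj.obj P)).anchor (toProj P x) = P.str.anchor x
  toProj_act : ∀ (P : Torsor E.grpd) (x : P.total) (r : E.grpd.arr)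
    (e : P.str.anchor x = E.grpd.src r), toProj P (P.str.act x r e) =
      (Torsor.str (proj.obj P)).act (toProj P x) (E.π r)
        ((anchor_toProj P x).trans (e.trans (E.src_π r).symm))
  toProj_natural : ∀ {P Q : Torsor E.grpd} (f : P ⟶ Q) (x : P.total),
    Torsor.Hom.total (proj.map f) (toProj P x) = toProj Q (Torsor.Hom.total f x)
  gerbe : S1GerbeStr proj
  band_apply : ∀ (P : Torsor E.grpd) (l : SmoothMap P.base S1) (x : P.total),
    Torsor.Hom.total (gerbe.band P l) x =
      P.str.act x (E.smul (S1.toCircle (l (P.str.proj x))) (E.grpd.one (P.str.anchor x)))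
        ((E.grpd.src_one _).symm.trans (E.src_smul _ _).symm)

end CentralExtension

/-! ### Morita equivalence of central extensions -/

/-- An `X`-`Y`-bitorsor: a manifold with commuting actions of `X` and `Y` which is an `X`-torsor
over the objects `N` of `Y` and a `Y`-torsor over the objects `M` of `X`, the structure map of each
being the anchor map of the other. The `X`-action is recorded as a right action; the left action
is `leftAct`. -/
structure Bitorsor {M N : Mfd.{u}} (X : LieGroupoid M) (Y : LieGroupoid N) : Type (u + 1) where
  total : Mfd.{u}
  left : TorsorStr X total N
  right : TorsorStr Y total M
  left_anchor : ∀ z, left.anchor z = right.proj z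
  right_anchor : ∀ z, right.anchor z = left.proj z
  comm : ∀ z x y (hx : left.anchor z = X.src x) (hy : right.anchor z = Y.src y)
    (hx' : left.anchor (right.act z y hy) = X.src x)
    (hy' : right.anchor (left.act z x hx) = Y.src y),
    right.act (left.act z x hx) y hy' = left.act (right.act z y hy) x hx'

namespace Bitorsor

variable {M N : Mfd.{u}} {X : LieGroupoid M} {Y : LieGroupoid N} (Z : Bitorsor X Y)

/-- `x · z`, defined if `t(x) = f(z)` for the map `f : Z → X₀`. -/
def leftAct (x : X.arr) (z : Z.total) (e : X.tgt x = Z.left.anchor z) : Z.total :=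
  Z.left.act z (X.inv x) (e.symm.trans (X.src_inv x).symm)

/-- `x · z · y`, defined if `t(x) = f(z)` and `g(z) = s(y)`. -/
def biAct (x : X.arr) (z : Z.total) (y : Y.arr) (e : X.tgt x = Z.left.anchor z)
    (e' : Z.right.anchor z = Y.src y) : Z.total :=
  Z.right.act (Z.leftAct x z e) y
    ((Z.right_anchor _).trans ((Z.left.proj_act _ _ _).trans ((Z.right_anchor z).symm.trans e')))

end Bitorsor

/-- An `S¹`-equivariant `R`-`R'`-bitorsor: a bitorsor with an action of `S¹` such that
`(l r) · z · r' = r · (l z) · r' = r · z · (l r')`. -/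
structure EquivariantBitorsor {M M' : Mfd.{u}} {X : LieGroupoid M} {X' : LieGroupoid M'}
    (E : CentralExtension X) (E' : CentralExtension X') : Type (u + 1)
    extends Bitorsor E.grpd E'.grpd where
  smul : Circle → total → total
  one_smul : ∀ z, smul 1 z = z
  mul_smul : ∀ a b z, smul (a * b) z = smul a (smul b z)
  smul_smooth : ∀ (T : Mfd.{u}) (l : SmoothMap T S1) (z : SmoothMap T total),
    Smooth (fun x => smul (S1.toCircle (l x)) (z x))
  left_anchor_smul : ∀ a z, left.anchor (smul a z) = left.anchor z
  right_anchor_smul : ∀ a z, right.anchor (smul a z) = right.anchor z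
  smul_left : ∀ (a : Circle) r z r' (e : E.grpd.tgt r = left.anchor z)
    (e' : right.anchor z = E'.grpd.src r'),
    toBitorsor.biAct (E.smul a r) z r' ((E.tgt_smul a r).trans e) e' =
      toBitorsor.biAct r (smul a z) r' (e.trans (left_anchor_smul a z).symm)
        ((right_anchor_smul a z).trans e')
  smul_right : ∀ (a : Circle) r z r' (e : E.grpd.tgt r = left.anchor z)
    (e' : right.anchor z = E'.grpd.src r'),
    toBitorsor.biAct r (smul a z) r' (e.trans (left_anchor_smul a z).symm)
        ((right_anchor_smul a z).trans e') =
      toBitorsor.biAct r z (E'.smul a r') e (e'.trans (E'.src_smul a r').symm)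

/-- Morita equivalence of `S¹`-central extensions. -/
def MoritaEquivalent {M M' : Mfd.{u}} {X : LieGroupoid M} {X' : LieGroupoid M'}
    (E : CentralExtension X) (E' : CentralExtension X') : Prop :=
  Nonempty (EquivariantBitorsor E E')

/-- There is an `S¹`-equivariant Morita morphism from `R` to `R'`. -/
def ExistsEquivariantMoritaMorphism {M M' : Mfd.{u}} {X : LieGroupoid M} {X' : LieGroupoid M'}
    (E : CentralExtension X) (E' : CentralExtension X') : Prop :=
  ∃ φ : LieGroupoidHom E.grpd E'.grpd, φ.IsMorita ∧
    ∀ (a : Circle) r, φ.onArr (E.smul a r) = E'.smul a (φ.onArr r)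

/-- `𝔛 ≅ 𝔛'`, and over this isomorphism `ℜ ≅ ℜ'` as `S¹`-gerbes. -/
def GerbesIsomorphic {M M' : Mfd.{u}} {X : LieGroupoid M} {X' : LieGroupoid M'}
    (E : CentralExtension X) (E' : CentralExtension X') : Prop :=
  ∃ (𝒢 : E.AssociatedGerbe) (𝒢' : E'.AssociatedGerbe) (F : StackIso (stack X) (stack X')),
    Nonempty (S1GerbeIso 𝒢.gerbe 𝒢'.gerbe F)

end DiffStack

/-! The proof runs (i) ⇒ (ii) ⇒ (iii) ⇒ (i).

(i) ⇒ (ii). Pull `R` back along the surjective submersion `Z → X₀` of the bitorsor. The arrows of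
the pulled back groupoid are triples `(z₁, r, z₂)`. Its projection to `R` is Morita by construction.
Since `r · z₂` and `z₁` lie in the same fibre over `X₀`, there is a unique `r'` with `r · z₂ = z₁ ·
r'`. The map `(z₁, r, z₂) ↦ r'` is the second Morita morphism (`Bitorsor.pullHom_isMorita`), and the
axioms on the circle action of `Z` make it equivariant.

(ii) ⇒ (iii). A Morita morphism `φ` induces an equivalence of stacks (`moritaIso`): induction of
torsors along `φ` is inverse to restriction, because both comparison morphisms cover the identity of
the base and a morphism of torsors over a diffeomorphism is invertible. An equivariant `φ` descends
to a Morita morphism of the base groupoids (`CentralExtension.baseHom_isMorita`), and the square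
with the quotients by `S¹` commutes by the universal property of induction. The zigzag is treated by
inverting one leg and composing. That induction along `π` is an `S¹`-gerbe at all is
`CentralExtension.gerbeStr`; it rests on the fact that the fibres of `P → P/S¹` are exactly the
circle orbits.

(iii) ⇒ (i). Let `Z` be the image under `G : ℜ ≅ ℜ'` of the universal torsor `R₁ → X₀`; it is an
`R'`-torsor over `X₀`. An arrow of `R` identifies two fibres of the universal torsor, and `G` turns
this into an action of `R` on `Z` commuting with that of `R'` (`StackBitorsor.act`). Faithfulness
makes the action free, fullness makes it transitive on the fibres of the anchor map with smooth
division (`StackBitorsor.exists_div`), and essential surjectivity makes the anchor a surjective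
submersion (`StackBitorsor.anchor_submersion`). Compatibility with the bands gives equivariance
(`StackBitorsor.act_smul`).

Fibred products along submersions and the quotients defining induced torsors are constructed as
locally representable sheaves of plots (`PlotSpace`), so that smoothness is always tested on
families. The tool used most is that morphisms of torsors are cartesian (`Torsor.Hom.lift`). -/

namespace DiffStack

/-! ### Pointwise smoothness, open submanifolds and model manifolds. -/

open Topology TopologicalSpace

/-! ### Germs of smooth maps -/

section Germs

variable {M : Mfd.{u}} {N : Mfd.{v}} {K : Mfd.{w}}
variable {E : Type*} [NormedAddCommGroup E] [NormedSpace ℝ E]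
variable {F : Type*} [NormedAddCommGroup F] [NormedSpace ℝ F]

/-- `f` is `C^∞` at the point `x`. -/
def SmoothAt (f : M → N) (x : M) : Prop :=
  ContinuousAt f x ∧ ∀ c ∈ M.atlas, ∀ d ∈ N.atlas, x ∈ c.2.source → f x ∈ d.2.source →
    ContDiffAt ℝ ∞ (d.2 ∘ f ∘ c.2.symm) (c.2 x)

/-- A map from a manifold to a normed space is `C^∞` at the point `x`. -/
def VSmoothAt (h : M → E) (x : M) : Prop :=
  ∀ c ∈ M.atlas, x ∈ c.2.source → ContDiffAt ℝ ∞ (h ∘ c.2.symm) (c.2 x)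

theorem smooth_iff_smoothAt {f : M → N} : Smooth f ↔ ∀ x, SmoothAt f x :=
  ⟨fun h x => ⟨h.1.continuousAt, h.2 x⟩,
    fun h => ⟨continuous_iff_continuousAt.2 fun x => (h x).1, fun x => (h x).2⟩⟩

theorem Smooth.smoothAt {f : M → N} (h : Smooth f) (x : M) : SmoothAt f x :=
  smooth_iff_smoothAt.1 h x

theorem eventuallyEq_comp_symm {α : Type*} {f g : M → α} {x : M} (h : f =ᶠ[𝓝 x] g) {n : ℕ}
    (c : OpenPartialHomeomorph M (EuclideanSpace ℝ (Fin n))) (hx : x ∈ c.source) :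
    f ∘ c.symm =ᶠ[𝓝 (c x)] g ∘ c.symm := by
  have hc : Filter.Tendsto c.symm (𝓝 (c x)) (𝓝 x) := by
    have := c.continuousAt_symm (c.map_source hx)
    rwa [ContinuousAt, c.left_inv hx] at this
  exact hc.eventually h

theorem VSmoothAt.congr {h k : M → E} {x : M} (hh : VSmoothAt h x) (e : k =ᶠ[𝓝 x] h) :
    VSmoothAt k x := fun c hc hx =>
  (hh c hc hx).congr_of_eventuallyEq (eventuallyEq_comp_symm e c.2 hx)

/-- Transition maps are smooth, so a single chart around the point decides. -/
theorem VSmoothAt.of_chart {h : M → E} {x : M} {c : Chart M} (hc : c ∈ M.atlas)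
    (hx : x ∈ c.2.source) (hh : ContDiffAt ℝ ∞ (h ∘ c.2.symm) (c.2 x)) : VSmoothAt h x := by
  intro d hd hx'
  have h1 := M.compatible d hd c hc x hx' hx
  have h3 : (c.2 ∘ d.2.symm) (d.2 x) = c.2 x := by simp [d.2.left_inv hx']
  rw [← h3] at hh
  refine (hh.comp _ h1).congr_of_eventuallyEq ?_
  have hcont := d.2.continuousAt_symm (d.2.map_source hx')
  have hmem : c.2.source ∈ 𝓝 (d.2.symm (d.2 x)) := by
    simpa [d.2.left_inv hx'] using c.2.open_source.mem_nhds hx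
  filter_upwards [hcont hmem] with y hy
  have hy' : d.2.symm y ∈ c.2.source := hy
  simp [c.2.left_inv hy']

theorem VSmoothAt.continuousAt {h : M → E} {x : M} (hh : VSmoothAt h x) : ContinuousAt h x := by
  obtain ⟨c, hc, hx⟩ := M.cover x
  have h1 := (hh c hc hx).continuousAt
  have h2 := ContinuousAt.comp (f := c.2) (x := x) h1 (c.2.continuousAt hx)
  refine h2.congr ?_
  filter_upwards [c.2.open_source.mem_nhds hx] with y hy
  simp [c.2.left_inv hy]

theorem VSmoothAt.contDiffAt_comp {h : M → E} {x : M} {g : E → F} (hg : ContDiffAt ℝ ∞ g (h x))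
    (hh : VSmoothAt h x) : VSmoothAt (fun y => g (h y)) x := by
  intro c hc hx
  have h3 : (h ∘ c.2.symm) (c.2 x) = h x := by simp [c.2.left_inv hx]
  rw [← h3] at hg
  exact hg.comp _ (hh c hc hx)

theorem VSmoothAt.prodMk {h : M → E} {k : M → F} {x : M} (hh : VSmoothAt h x)
    (hk : VSmoothAt k x) : VSmoothAt (fun y => (h y, k y)) x :=
  fun c hc hx => (hh c hc hx).prodMk (hk c hc hx)

theorem vsmoothAt_const (e : E) (x : M) : VSmoothAt (fun _ : M => e) x :=
  fun _ _ _ => contDiffAt_const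

theorem vsmoothAt_chart {c : Chart M} (hc : c ∈ M.atlas) {x : M} (hx : x ∈ c.2.source) :
    VSmoothAt c.2 x := fun d hd hx' => M.compatible d hd c hc x hx' hx

theorem VSmoothAt.comp_smoothAt {h : N → E} {f : M → N} {x : M} (hh : VSmoothAt h (f x))
    (hf : SmoothAt f x) : VSmoothAt (fun y => h (f y)) x := by
  intro c hc hx
  obtain ⟨e, he, hxe⟩ := N.cover (f x)
  have h1 := hf.2 c hc e he hx hxe
  have h2 := hh e he hxe
  have h3 : (e.2 ∘ f ∘ c.2.symm) (c.2 x) = e.2 (f x) := by simp [c.2.left_inv hx]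
  rw [← h3] at h2
  refine (h2.comp _ h1).congr_of_eventuallyEq ?_
  refine (eventuallyEq_comp_symm (f := fun y => h (f y)) (g := fun y => h (e.2.symm (e.2 (f y))))
    ?_ c.2 hx)
  filter_upwards [hf.1 (e.2.open_source.mem_nhds hxe)] with y hy
  rw [e.2.left_inv hy]

/-- Reduces maps between manifolds to vector-valued functions. Continuity stays as a separate
condition because the coordinates `d.2 (f y)` are meaningful only while `f y` remains in the domain
of the chart. -/
theorem smoothAt_iff_chart {f : M → N} {x : M} {d : Chart N} (hd : d ∈ N.atlas)
    (hx : f x ∈ d.2.source) :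
    SmoothAt f x ↔ ContinuousAt f x ∧ VSmoothAt (fun y => d.2 (f y)) x := by
  refine ⟨fun h => ⟨h.1, (vsmoothAt_chart hd hx).comp_smoothAt h⟩, fun h => ⟨h.1, ?_⟩⟩
  intro c hc d' hd' hxc hxd'
  have h1 := h.2 c hc hxc
  have h2 := N.compatible d hd d' hd' (f x) hx hxd'
  have h3 : (((fun y => d.2 (f y)) ∘ c.2.symm)) (c.2 x) = d.2 (f x) := by
    simp [c.2.left_inv hxc]
  rw [← h3] at h2
  refine (h2.comp _ h1).congr_of_eventuallyEq ?_
  refine (eventuallyEq_comp_symm (f := fun y => d'.2 (f y))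
    (g := fun y => d'.2 (d.2.symm (d.2 (f y)))) ?_ c.2 hxc)
  filter_upwards [h.1 (d.2.open_source.mem_nhds hx)] with y hy
  rw [d.2.left_inv hy]

theorem SmoothAt.comp {g : N → K} {f : M → N} {x : M} (hg : SmoothAt g (f x))
    (hf : SmoothAt f x) : SmoothAt (fun y => g (f y)) x := by
  obtain ⟨d, hd, hx⟩ := K.cover (g (f x))
  rw [smoothAt_iff_chart hd hx] at hg
  rw [smoothAt_iff_chart (f := fun y => g (f y)) hd hx]
  exact ⟨hg.1.comp hf.1, hg.2.comp_smoothAt hf⟩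

theorem VSmoothAt.chart_symm {h : M → EuclideanSpace ℝ (Fin n)}
    {d : OpenPartialHomeomorph N (EuclideanSpace ℝ (Fin n))} (hd : ⟨n, d⟩ ∈ N.atlas) {x : M}
    (hh : VSmoothAt h x) (hx : h x ∈ d.target) : SmoothAt (fun y => d.symm (h y)) x := by
  rw [smoothAt_iff_chart hd (d.map_target hx)]
  refine ⟨(d.continuousAt_symm hx).comp hh.continuousAt, hh.congr ?_⟩
  filter_upwards [hh.continuousAt (d.open_target.mem_nhds hx)] with y hy
  exact d.right_inv hy

theorem smooth_const (y : N) : Smooth (fun _ : M => y) :=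
  ⟨continuous_const, fun _ _ _ d _ _ _ => contDiffAt_const (c := d.2 y)⟩

end Germs

/-- A constant map. -/
def SmoothMap.const {M : Mfd.{u}} {N : Mfd.{v}} (y : N) : SmoothMap M N := ⟨fun _ => y, smooth_const y⟩

/-! ### Open submanifolds -/

/-- An open subset of a manifold. -/
noncomputable def Mfd.restrict (M : Mfd.{u}) (V : Opens M) : Mfd.{u} where
  carrier := V
  -- Restricting a chart needs a point of `V`, so the atlas is empty when `V` is.
  atlas := {c | ∃ d ∈ M.atlas, ∃ h : Nonempty V, c = ⟨d.1, d.2.subtypeRestr h⟩}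
  cover x := by
    obtain ⟨c, hc, hx⟩ := M.cover x
    exact ⟨_, ⟨c, hc, ⟨x⟩, rfl⟩, by simpa using hx⟩
  compatible := by
    rintro _ ⟨c, hc, h, rfl⟩ _ ⟨d, hd, h', rfl⟩ x hx hx'
    simp only [OpenPartialHomeomorph.subtypeRestr_source, Set.mem_preimage] at hx hx'
    refine (M.compatible c hc d hd x hx hx').congr_of_eventuallyEq ?_
    filter_upwards [(c.2.subtypeRestr h).open_target.mem_nhds
      ((c.2.subtypeRestr h).map_source (x := x) (by simpa using hx))] with y hy
    have := c.2.subtypeRestr_symm_apply h hy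
    simp only [Function.comp_apply, OpenPartialHomeomorph.subtypeRestr_coe,
      Set.domRestrict_apply] at this ⊢
    rw [this]

section Restrict

variable {M : Mfd.{u}} {N : Mfd.{v}} {V : Opens M}

/-- The inclusion of an open subset. -/
def Mfd.val {M : Mfd.{u}} {V : Opens M} (x : M.restrict V) : M := Subtype.val (p := (· ∈ V)) x

theorem Mfd.val_mem (x : M.restrict V) : Mfd.val x ∈ V := Subtype.property (p := (· ∈ V)) x

/-- A point of an open subset. -/
def Mfd.mkPt (x : M) (h : x ∈ V) : M.restrict V := (⟨x, h⟩ : V)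

theorem Mfd.val_injective : Function.Injective (Mfd.val : M.restrict V → M) :=
  Subtype.val_injective

theorem Mfd.isOpenEmbedding_val : IsOpenEmbedding (Mfd.val : M.restrict V → M) :=
  V.isOpenEmbedding'

theorem vsmoothAt_restrict_iff {E : Type*} [NormedAddCommGroup E] [NormedSpace ℝ E] {f : M → E}
    {x : M.restrict V} : VSmoothAt (fun y : M.restrict V => f (Mfd.val y)) x ↔ VSmoothAt f (Mfd.val x) := by
  obtain ⟨c, hc, hx⟩ := M.cover (Mfd.val x)
  have hV : Nonempty V := ⟨x⟩
  have hc' : (⟨c.1, c.2.subtypeRestr hV⟩ : Chart (M.restrict V)) ∈ (M.restrict V).atlas :=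
    ⟨c, hc, hV, rfl⟩
  have hx' : x ∈ (c.2.subtypeRestr hV).source := by
    rw [OpenPartialHomeomorph.subtypeRestr_source]; exact hx
  have key : (fun y : M.restrict V => f (Mfd.val y)) ∘ (c.2.subtypeRestr hV).symm
      =ᶠ[𝓝 (c.2 (Mfd.val x))] f ∘ c.2.symm := by
    filter_upwards [(c.2.subtypeRestr hV).open_target.mem_nhds
      ((c.2.subtypeRestr hV).map_source (x := x) hx')] with y hy
    exact congrArg f (c.2.subtypeRestr_symm_apply hV hy)
  constructor
  · intro h
    exact VSmoothAt.of_chart hc hx ((h _ hc' hx').congr_of_eventuallyEq key.symm)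
  · intro h
    exact VSmoothAt.of_chart hc' hx' ((h c hc hx).congr_of_eventuallyEq key)

theorem smoothAt_restrict_iff {f : M → N} {x : M.restrict V} :
    SmoothAt (fun y : M.restrict V => f (Mfd.val y)) x ↔ SmoothAt f (Mfd.val x) := by
  obtain ⟨d, hd, hx⟩ := N.cover (f (Mfd.val x))
  rw [smoothAt_iff_chart (f := f) hd hx,
    smoothAt_iff_chart (f := fun y : M.restrict V => f (Mfd.val y)) hd hx,
    vsmoothAt_restrict_iff (f := fun y => d.2 (f y))]
  refine and_congr_left fun _ => ?_
  exact Mfd.isOpenEmbedding_val.continuousAt_iff (g := f)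

theorem smooth_val : Smooth (Mfd.val : M.restrict V → M) :=
  smooth_iff_smoothAt.2 fun x =>
    (smoothAt_restrict_iff (f := fun y : M => y)).2 ((Smooth.id M).smoothAt (Mfd.val x))

/-- The inclusion of an open subset as a smooth map. -/
def Mfd.incl (M : Mfd.{u}) (V : Opens M) : SmoothMap (M.restrict V) M := ⟨Mfd.val, smooth_val⟩

theorem SmoothAt.of_val {f : N → M.restrict V} {x : N} (h : SmoothAt (fun y => Mfd.val (f y)) x) :
    SmoothAt f x := by
  obtain ⟨c, hc, hx⟩ := M.cover (Mfd.val (f x))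
  have hV : Nonempty V := ⟨f x⟩
  have hc' : (⟨c.1, c.2.subtypeRestr hV⟩ : Chart (M.restrict V)) ∈ (M.restrict V).atlas :=
    ⟨c, hc, hV, rfl⟩
  rw [smoothAt_iff_chart (f := fun y => Mfd.val (f y)) hc hx] at h
  rw [smoothAt_iff_chart hc' (by rw [OpenPartialHomeomorph.subtypeRestr_source]; exact hx)]
  exact ⟨Mfd.isOpenEmbedding_val.isInducing.continuousAt_iff.2 h.1, h.2⟩

theorem Smooth.of_val {f : N → M.restrict V} (h : Smooth (fun y => Mfd.val (f y))) : Smooth f :=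
  smooth_iff_smoothAt.2 fun x => SmoothAt.of_val (h.smoothAt x)

/-- A smooth map with values in an open subset. -/
def SmoothMap.codRestrict (f : SmoothMap N M) (V : Opens M) (h : ∀ x, f x ∈ V) :
    SmoothMap N (M.restrict V) := ⟨fun x => Mfd.mkPt (f x) (h x), Smooth.of_val f.smooth⟩

/-- An open subset of an open subset. -/
theorem Mfd.exists_restrict_restrict (W : Opens (M.restrict V)) {x : M.restrict V} (hx : x ∈ W) :
    ∃ (V' : Opens M) (_ : Mfd.val x ∈ V') (j : SmoothMap (M.restrict V') ((M.restrict V).restrict W)),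
      ∀ v, Mfd.val (Mfd.val (j v)) = Mfd.val v := by
  let V' : Opens M := ⟨Mfd.val '' (W : Set (M.restrict V)),
    Mfd.isOpenEmbedding_val.isOpenMap _ W.isOpen⟩
  have hmem : ∀ k : M.restrict V', ∃ h : Mfd.val k ∈ V, Mfd.mkPt (Mfd.val k) h ∈ W := by
    intro k
    obtain ⟨w, hw, hk⟩ := Mfd.val_mem k
    have h : Mfd.val k ∈ V := hk ▸ Mfd.val_mem w
    refine ⟨h, ?_⟩
    have : Mfd.mkPt (Mfd.val k) h = w := Mfd.val_injective hk.symm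
    rwa [this]
  exact ⟨V', ⟨x, hx, rfl⟩, ((M.incl V').codRestrict V fun k => (hmem k).1).codRestrict W
    fun k => (hmem k).2, fun _ => rfl⟩

/-- The restriction of a smooth map to the preimage of an open subset. -/
noncomputable def SmoothMap.restrictPreimage (f : SmoothMap N M) (V : Opens M) :
    SmoothMap (N.restrict (Opens.comap ⟨f, f.smooth.1⟩ V)) (M.restrict V) :=
  (f.comp (N.incl _)).codRestrict V fun x => Mfd.val_mem x

/-- Smoothness is local. -/
theorem Smooth.of_local {f : M → N} (h : ∀ x, ∃ (V : Opens M) (_ : x ∈ V)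
    (g : SmoothMap (M.restrict V) N), ∀ y, f (Mfd.val y) = g y) : Smooth f := by
  refine smooth_iff_smoothAt.2 fun x => ?_
  obtain ⟨V, hV, g, hg⟩ := h x
  have h1 : (fun y : M.restrict V => f (Mfd.val y)) = g := funext hg
  refine (smoothAt_restrict_iff (V := V) (x := Mfd.mkPt x hV)).1 ?_
  rw [h1]
  exact g.smooth.smoothAt _

end Restrict

/-! ### The point, and vector spaces -/

/-- The manifold with one point. -/
def Mfd.pt : Mfd.{u} where
  carrier := PUnit
  atlas := {c | c.2.source = Set.univ ∧ c.1 = 0}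
  cover x := ⟨⟨0, (Homeomorph.homeomorphOfUnique PUnit
    (EuclideanSpace ℝ (Fin 0))).toOpenPartialHomeomorph⟩, ⟨rfl, rfl⟩, trivial⟩
  compatible := by
    rintro ⟨n, c⟩ ⟨-, h⟩ ⟨m, d⟩ ⟨-, h'⟩ x hx hx'
    obtain rfl : n = 0 := h
    obtain rfl : m = 0 := h'
    exact contDiffAt_of_subsingleton

instance : Subsingleton Mfd.pt.{u} := inferInstanceAs (Subsingleton PUnit)

/-- The point. -/
def Mfd.star : Mfd.pt.{u} := PUnit.unit

/-- A finite dimensional normed space as a manifold. -/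
noncomputable def Mfd.ofVec (E : Type) [NormedAddCommGroup E] [NormedSpace ℝ E] [FiniteDimensional ℝ E] :
    Mfd.{u} where
  -- The lift puts the model space in the universe of the other manifolds.
  carrier := ULift.{u} E
  atlas := {⟨Module.finrank ℝ E,
    (Homeomorph.ulift.trans (toEuclidean (E := E)).toHomeomorph).toOpenPartialHomeomorph⟩}
  cover x := ⟨_, rfl, Set.mem_univ _⟩
  compatible := by
    rintro _ rfl _ rfl x - -
    refine contDiffAt_id.congr_of_eventuallyEq (Filter.Eventually.of_forall fun y => ?_)
    simp

section OfVec

variable {M : Mfd.{u}} {E : Type} [NormedAddCommGroup E] [NormedSpace ℝ E] [FiniteDimensional ℝ E]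

/-- The vector underlying a point of `Mfd.ofVec E`. -/
def Mfd.vec (x : Mfd.ofVec.{u} E) : E := ULift.down x

/-- The point of `Mfd.ofVec E` given by a vector. -/
def Mfd.ofVecMk (x : E) : Mfd.ofVec.{u} E := ULift.up x

@[simp] theorem Mfd.vec_ofVecMk (x : E) : Mfd.vec (Mfd.ofVecMk.{u} x) = x := rfl
@[simp] theorem Mfd.ofVecMk_vec (x : Mfd.ofVec.{u} E) : Mfd.ofVecMk (Mfd.vec x) = x := rfl

theorem Mfd.continuous_ofVecMk : Continuous (Mfd.ofVecMk : E → Mfd.ofVec.{u} E) :=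
  continuous_uliftUp

theorem smoothAt_ofVec_iff {f : M → Mfd.ofVec.{v} E} {x : M} :
    SmoothAt f x ↔ VSmoothAt (fun y => Mfd.vec (f y)) x := by
  have hd : (⟨Module.finrank ℝ E, (Homeomorph.ulift.trans
    (toEuclidean (E := E)).toHomeomorph).toOpenPartialHomeomorph⟩ : Chart (Mfd.ofVec.{v} E)) ∈
    (Mfd.ofVec.{v} E).atlas := rfl
  rw [smoothAt_iff_chart hd trivial]
  constructor
  · intro h
    exact (VSmoothAt.contDiffAt_comp (g := (toEuclidean (E := E)).symm)
      (toEuclidean (E := E)).symm.contDiff.contDiffAt h.2).congr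
      (Filter.Eventually.of_forall fun y => ((toEuclidean (E := E)).symm_apply_apply _).symm)
  · intro h
    refine ⟨?_, VSmoothAt.contDiffAt_comp (g := toEuclidean (E := E))
      (toEuclidean (E := E)).contDiff.contDiffAt h⟩
    exact Mfd.continuous_ofVecMk.continuousAt.comp h.continuousAt

theorem vsmoothAt_vec (x : Mfd.ofVec.{v} E) : VSmoothAt (Mfd.vec : Mfd.ofVec.{v} E → E) x :=
  smoothAt_ofVec_iff.1 ((Smooth.id _).smoothAt x)

end OfVec

end DiffStack

/-! ### Submersions: normal form, local lifts, local sections. -/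

namespace DiffStack

open Topology TopologicalSpace

/-! ### Submersions -/

/-- A `C^∞` map between finite dimensional spaces whose derivative is surjective at a point is a
projection in suitable coordinates. -/
theorem exists_straightening {E F : Type*} [NormedAddCommGroup E] [NormedSpace ℝ E]
    [FiniteDimensional ℝ E] [NormedAddCommGroup F] [NormedSpace ℝ F] [FiniteDimensional ℝ F]
    {g : E → F} {U : Set E} (hU : IsOpen U) (hg : ∀ x ∈ U, ContDiffAt ℝ ∞ g x) {x₀ : E}
    (hx₀ : x₀ ∈ U) (hs : Function.Surjective (fderiv ℝ g x₀)) :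
    ∃ (K : Submodule ℝ E) (Ψ : OpenPartialHomeomorph E (F × K)), x₀ ∈ Ψ.source ∧ Ψ.source ⊆ U ∧
      (∀ x, (Ψ x).1 = g x) ∧ (∀ x ∈ Ψ.source, ContDiffAt ℝ ∞ Ψ x) ∧
      ∀ y ∈ Ψ.target, ContDiffAt ℝ ∞ Ψ.symm y := by
  have : CompleteSpace E := FiniteDimensional.complete ℝ E
  have : CompleteSpace F := FiniteDimensional.complete ℝ F
  set f' := fderiv ℝ g x₀ with hf'
  let K : Submodule ℝ E := f'.ker
  obtain ⟨p, hp⟩ := K.exists_isCompl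
  -- The derivative is completed by a projection onto its kernel, so that `(g, q)` has invertible
  -- derivative at `x₀` and the inverse function theorem applies.
  let q : E →L[ℝ] K := LinearMap.toContinuousLinearMap (Submodule.projectionOnto K p hp)
  have hq : ∀ k : K, q k = k := fun k => Submodule.projectionOnto_apply_left hp k
  have hbij : Function.Bijective (f'.prod q) := by
    constructor
    · intro x y hxy
      have h1 : f' x = f' y := congrArg Prod.fst hxy
      have h2 : q x = q y := congrArg Prod.snd hxy
      have h3 : x - y ∈ K := by
        change f' (x - y) = 0
        rw [map_sub, h1, sub_self]
      have h4 := hq ⟨x - y, h3⟩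
      rw [map_sub, h2, sub_self] at h4
      exact sub_eq_zero.1 (congrArg Subtype.val h4).symm
    · rintro ⟨y, k⟩
      obtain ⟨x, rfl⟩ := hs y
      refine ⟨x - q x + k, ?_⟩
      have hk : ∀ k : K, f' k = 0 := fun k => k.2
      refine Prod.ext ?_ ?_
      · change f' (x - q x + k) = f' x
        rw [map_add, map_sub, hk, hk, sub_zero, add_zero]
      · change q (x - q x + k) = k
        rw [map_add, map_sub, hq, hq, sub_self, zero_add]
  let e : E ≃L[ℝ] F × K := ContinuousLinearEquiv.ofBijective (f'.prod q)
    (LinearMap.ker_eq_bot.2 hbij.1) (LinearMap.range_eq_top.2 hbij.2)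
  let Φ : E → F × K := fun x => (g x, q x)
  have hΦ : ∀ x ∈ U, ContDiffAt ℝ ∞ Φ x := fun x hx => (hg x hx).prodMk q.contDiff.contDiffAt
  have hne : (∞ : WithTop ℕ∞) ≠ 0 := by simp
  have hΦ' : HasFDerivAt Φ (e : E →L[ℝ] F × K) x₀ :=
    ((hg x₀ hx₀).differentiableAt hne).hasFDerivAt.prodMk q.hasFDerivAt
  let Ψ₀ := (hΦ x₀ hx₀).toOpenPartialHomeomorph Φ hΦ' hne
  have hΨ₀ : ∀ x, Ψ₀ x = Φ x := fun x => rfl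
  -- Invertibility of the derivative is an open condition. Shrinking to where it holds makes the
  -- inverse smooth at every point of the target and not only at the image of `x₀`.
  have hev : ∀ᶠ x in 𝓝 x₀, fderiv ℝ Φ x ∈ Set.range ((↑) : (E ≃L[ℝ] F × K) → E →L[ℝ] F × K) := by
    have hc : ContinuousAt (fderiv ℝ Φ) x₀ :=
      (hΦ x₀ hx₀).continuousAt_fderiv (by simp)
    have h0 : fderiv ℝ Φ x₀ = e := hΦ'.fderiv
    refine hc ?_
    rw [h0]
    exact ContinuousLinearEquiv.nhds e
  obtain ⟨W, hW, hWo, hxW⟩ := eventually_nhds_iff.1 hev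
  refine ⟨K, Ψ₀.restrOpen (U ∩ W) (hU.inter hWo), ?_, ?_, ?_, ?_, ?_⟩
  · exact ⟨ContDiffAt.mem_toOpenPartialHomeomorph_source _ hΦ' hne, hx₀, hxW⟩
  · exact fun x hx => hx.2.1
  · exact fun x => rfl
  · exact fun x hx => hΦ x hx.2.1
  · intro y hy
    have hy' := (Ψ₀.restrOpen (U ∩ W) (hU.inter hWo)).map_target hy
    obtain ⟨e', he'⟩ := hW _ hy'.2.2
    refine OpenPartialHomeomorph.contDiffAt_symm _ hy (f₀' := e') ?_ (hΦ _ hy'.2.1)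
    rw [he']
    exact ((hΦ _ hy'.2.1).differentiableAt hne).hasFDerivAt

/-- Local normal form of a submersion. -/
theorem IsSubmersion.exists_chart {A : Mfd.{u}} {C : Mfd.{v}} {f : SmoothMap A C}
    (hf : IsSubmersion f) (a : A) {d : Chart C} (hd : d ∈ C.atlas) (ha : f a ∈ d.2.source) :
    ∃ (m : ℕ) (K : Submodule ℝ (EuclideanSpace ℝ (Fin m)))
      (α : OpenPartialHomeomorph A (EuclideanSpace ℝ (Fin d.1) × K)), a ∈ α.source ∧
      (∀ x ∈ α.source, f x ∈ d.2.source ∧ (α x).1 = d.2 (f x)) ∧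
      (∀ x ∈ α.source, VSmoothAt α x) ∧
      ∀ (T : Mfd.{w}) (h : T → EuclideanSpace ℝ (Fin d.1) × K) (t : T), VSmoothAt h t →
        h t ∈ α.target → SmoothAt (fun s => α.symm (h s)) t := by
  obtain ⟨c, hc, hac⟩ := A.cover a
  let U : Set (EuclideanSpace ℝ (Fin c.1)) := c.2.target ∩ c.2.symm ⁻¹' (f ⁻¹' d.2.source)
  have hU : IsOpen U :=
    c.2.isOpen_inter_preimage_symm (f.smooth.1.isOpen_preimage _ d.2.open_source)
  have hg : ∀ x ∈ U, ContDiffAt ℝ ∞ (d.2 ∘ f ∘ c.2.symm) x := by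
    intro x hx
    have := f.smooth.2 (c.2.symm x) c hc d hd (c.2.map_target hx.1) hx.2
    rwa [c.2.right_inv hx.1] at this
  obtain ⟨K, Ψ, h1, h2, h3, h4, h5⟩ := exists_straightening hU hg (x₀ := c.2 a)
    ⟨c.2.map_source hac, by simpa [c.2.left_inv hac] using ha⟩ (hf a c hc d hd hac ha)
  have hsrc : ∀ x ∈ (c.2.trans Ψ).source, x ∈ c.2.source ∧ c.2 x ∈ Ψ.source := by
    intro x hx
    simpa using hx
  refine ⟨c.1, K, c.2.trans Ψ, by simpa using ⟨hac, h1⟩, ?_, ?_, ?_⟩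
  · intro x hx
    obtain ⟨hx1, hx2⟩ := hsrc x hx
    have h6 := (h2 hx2).2
    simp only [Set.mem_preimage, c.2.left_inv hx1] at h6
    refine ⟨h6, ?_⟩
    simp [h3, c.2.left_inv hx1]
  · intro x hx
    obtain ⟨hx1, hx2⟩ := hsrc x hx
    exact VSmoothAt.contDiffAt_comp (g := Ψ) (h4 _ hx2) (vsmoothAt_chart hc hx1)
  · intro T h t hh ht
    have ht' : h t ∈ Ψ.target ∧ Ψ.symm (h t) ∈ c.2.target := by simpa using ht
    have h6 : VSmoothAt (fun s => Ψ.symm (h s)) t := VSmoothAt.contDiffAt_comp (h5 _ ht'.1) hh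
    exact h6.chart_symm hc ht'.2

/-- Lifting along a submersion, locally. -/
theorem IsSubmersion.exists_local_lift {M : Mfd.{u}} {N : Mfd.{v}} {T : Mfd.{w}}
    {f : SmoothMap M N} (hf : IsSubmersion f) (g : SmoothMap T N) {x₀ : M} {t₀ : T}
    (h₀ : f x₀ = g t₀) :
    ∃ (V : Opens T) (hV : t₀ ∈ V) (σ : SmoothMap (T.restrict V) M),
      (∀ v, f (σ v) = g (Mfd.val v)) ∧ σ (Mfd.mkPt t₀ hV) = x₀ := by
  obtain ⟨d, hd, hx⟩ := N.cover (f x₀)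
  obtain ⟨m, K, α, h1, h2, -, h4⟩ := hf.exists_chart x₀ hd hx
  -- In the coordinates `α` the submersion is the first projection: the lift takes its first
  -- coordinate from `g` and keeps the second equal to that of `x₀`.
  let h : T → EuclideanSpace ℝ (Fin d.1) × K := fun t => (d.2 (g t), (α x₀).2)
  have hh : ∀ t, g t ∈ d.2.source → VSmoothAt h t := fun t ht =>
    ((vsmoothAt_chart hd ht).comp_smoothAt (g.smooth.smoothAt t)).prodMk (vsmoothAt_const _ _)
  have hα : h t₀ = α x₀ := Prod.ext (by simp only [h, ← h₀]; exact (h2 x₀ h1).2.symm) rfl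
  let V : Set T := {t | g t ∈ d.2.source ∧ h t ∈ α.target}
  have hV : IsOpen V := by
    rw [isOpen_iff_mem_nhds]
    rintro t ⟨ht, ht'⟩
    filter_upwards [g.smooth.1.continuousAt (d.2.open_source.mem_nhds ht),
      (hh t ht).continuousAt (α.open_target.mem_nhds ht')] with s hs hs'
    exact ⟨hs, hs'⟩
  refine ⟨⟨V, hV⟩, ⟨h₀ ▸ hx, hα ▸ α.map_source h1⟩, ⟨fun v => α.symm (h (Mfd.val v)), ?_⟩, ?_, ?_⟩
  · refine smooth_iff_smoothAt.2 fun v => ?_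
    have hv : Mfd.val v ∈ V := Mfd.val_mem v
    exact (smoothAt_restrict_iff (f := fun t => α.symm (h t))).2 (h4 T h _ (hh _ hv.1) hv.2)
  · intro v
    have hv : Mfd.val v ∈ V := Mfd.val_mem v
    obtain ⟨h5, h6⟩ := h2 _ (α.map_target hv.2)
    rw [α.right_inv hv.2] at h6
    exact d.2.injOn h5 hv.1 h6.symm
  · change α.symm (h t₀) = x₀
    rw [hα, α.left_inv h1]

/-- A smooth map with local sections through every point is a submersion. -/
theorem isSubmersion_of_local_sections {M : Mfd.{u}} {N : Mfd.{v}} {f : SmoothMap M N}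
    (h : ∀ x : M, ∃ (V : Opens N) (hV : f x ∈ V) (σ : SmoothMap (N.restrict V) M),
      (∀ v, f (σ v) = Mfd.val v) ∧ σ (Mfd.mkPt (f x) hV) = x) : IsSubmersion f := by
  intro x c hc d hd hx hx'
  obtain ⟨V, hV, σ, h1, h2⟩ := h x
  have hn : Nonempty V := ⟨⟨f x, hV⟩⟩
  let d' : OpenPartialHomeomorph (N.restrict V) (EuclideanSpace ℝ (Fin d.1)) :=
    d.2.subtypeRestr hn
  have hd' : (⟨d.1, d'⟩ : Chart (N.restrict V)) ∈ (N.restrict V).atlas := ⟨d, hd, hn, rfl⟩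
  let y : N.restrict V := Mfd.mkPt (f x) hV
  have hy : y ∈ d'.source := by
    simp only [d', OpenPartialHomeomorph.subtypeRestr_source]; exact hx'
  have h3 := σ.smooth.2 y ⟨d.1, d'⟩ hd' c hc hy (by rw [h2]; exact hx)
  have h4 := f.smooth.2 x c hc d hd hx hx'
  have hd'y : d' y = d.2 (f x) := rfl
  simp only [hd'y] at h3
  have hne : (∞ : WithTop ℕ∞) ≠ 0 := by simp
  have hval : (c.2 ∘ σ ∘ d'.symm) (d.2 (f x)) = c.2 x := by
    simp only [Function.comp_apply, ← hd'y, d'.left_inv hy]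
    rw [h2]
  have h5 := (h3.differentiableAt hne).hasFDerivAt
  have h6 := (h4.differentiableAt hne).hasFDerivAt
  rw [← hval] at h6
  -- By the chain rule for `f ∘ σ = id`, the derivative of the section is a right inverse of the
  -- derivative of `f`.
  have h7 := h6.comp _ h5
  have h8 : (d.2 ∘ f ∘ c.2.symm) ∘ (c.2 ∘ σ ∘ d'.symm) =ᶠ[𝓝 (d.2 (f x))] id := by
    have hcont : ContinuousAt (fun z => σ (d'.symm z)) (d' y) :=
      σ.smooth.1.continuousAt.comp (d'.continuousAt_symm (d'.map_source hy))
    have hmem : c.2.source ∈ 𝓝 (σ (d'.symm (d' y))) := by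
      rw [d'.left_inv hy, h2]; exact c.2.open_source.mem_nhds hx
    filter_upwards [hcont hmem, d'.open_target.mem_nhds (d'.map_source hy)] with z hz hz'
    have hz1 : σ (d'.symm z) ∈ c.2.source := hz
    simp only [Function.comp_apply, c.2.left_inv hz1, h1, id]
    exact d'.right_inv hz'
  have h9 := (h7.congr_of_eventuallyEq h8.symm).unique (hasFDerivAt_id _)
  rw [hval] at h9
  intro v
  exact ⟨_, DFunLike.congr_fun h9 v⟩

/-- Submersions are the maps with local sections through every point, and such sections can be
lifted in two stages. -/
theorem IsSubmersion.comp {M : Mfd.{u}} {N : Mfd.{v}} {K : Mfd.{w}} {g : SmoothMap N K}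
    {f : SmoothMap M N} (hg : IsSubmersion g) (hf : IsSubmersion f) :
    IsSubmersion (g.comp f) := by
  refine isSubmersion_of_local_sections fun x => ?_
  obtain ⟨V, hV, σ, h1, h2⟩ := hg.exists_local_lift (x₀ := f x) (t₀ := g (f x))
    ⟨fun y => y, Smooth.id K⟩ rfl
  obtain ⟨W, hW, τ, h3, h4⟩ := hf.exists_local_lift (x₀ := x) (t₀ := Mfd.mkPt (g (f x)) hV) σ h2.symm
  obtain ⟨W', hW', j, hj⟩ := Mfd.exists_restrict_restrict W hW
  refine ⟨W', hW', τ.comp j, fun k => ?_, ?_⟩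
  · change g (f (τ (j k))) = _
    rw [h3, h1, hj]
  · refine Eq.trans (congrArg τ ?_) h4
    exact Mfd.val_injective (Mfd.val_injective (hj _))

/-- A local section of the composite, followed by `f`, is a local section of `g`; surjectivity of
`f` supplies one through every point. -/
theorem IsSubmersion.of_comp {M : Mfd.{u}} {N : Mfd.{v}} {K : Mfd.{w}} {g : SmoothMap N K}
    {f : SmoothMap M N} (hf : Function.Surjective f) (h : IsSubmersion (g.comp f)) :
    IsSubmersion g := by
  refine isSubmersion_of_local_sections fun y => ?_
  obtain ⟨x, rfl⟩ := hf y
  obtain ⟨V, hV, σ, h1, h2⟩ := h.exists_local_lift (x₀ := x) (t₀ := g (f x))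
    ⟨fun y => y, Smooth.id K⟩ rfl
  exact ⟨V, hV, f.comp σ, h1, congrArg f h2⟩

theorem IsSurjectiveSubmersion.comp {M : Mfd.{u}} {N : Mfd.{v}} {K : Mfd.{w}} {g : SmoothMap N K}
    {f : SmoothMap M N} (hg : IsSurjectiveSubmersion g) (hf : IsSurjectiveSubmersion f) :
    IsSurjectiveSubmersion (g.comp f) :=
  ⟨hg.1.comp hf.1, hg.2.comp hf.2⟩

theorem IsSurjectiveSubmersion.exists_local_lift {M : Mfd.{u}} {N : Mfd.{v}} {T : Mfd.{w}}
    {f : SmoothMap M N} (hf : IsSurjectiveSubmersion f) (g : SmoothMap T N) (t₀ : T) :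
    ∃ (V : Opens T) (_ : t₀ ∈ V) (σ : SmoothMap (T.restrict V) M),
      ∀ v, f (σ v) = g (Mfd.val v) := by
  obtain ⟨x₀, h₀⟩ := hf.1 (g t₀)
  obtain ⟨V, hV, σ, h, -⟩ := hf.2.exists_local_lift g h₀
  exact ⟨V, hV, σ, h⟩

end DiffStack

/-! ### Locally representable sheaves of plots, and fibred products. -/

namespace DiffStack

open Topology TopologicalSpace

/-! ### Manifolds from their points with values in manifolds -/

/-- A sheaf of maps, the plots, to the set `P` which is locally representable by manifolds. -/
structure PlotSpace (P : Type u) where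
  IsPlot : ∀ {T : Mfd.{u}}, (T → P) → Prop
  comp : ∀ {T T' : Mfd.{u}} {f : T → P} (_ : IsPlot f) (g : SmoothMap T' T),
    IsPlot fun t => f (g t)
  of_local : ∀ {T : Mfd.{u}} {f : T → P}, (∀ t, ∃ (V : Opens T) (_ : t ∈ V),
    IsPlot fun v : T.restrict V => f (Mfd.val v)) → IsPlot f
  -- The last clause says that `W` is an open subsheaf: a plot meets the image of `j` in an open
  -- set, and any set-theoretic lift to `W` is automatically smooth.
  exists_chart : ∀ p : P, ∃ (W : Mfd.{u}) (j : W → P), p ∈ Set.range j ∧ IsPlot j ∧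
    Function.Injective j ∧ ∀ {T : Mfd.{u}} {f : T → P}, IsPlot f → IsOpen (f ⁻¹' Set.range j) ∧
      ∀ (V : Opens T) (g : T.restrict V → W), (∀ v, j (g v) = f (Mfd.val v)) → Smooth g

namespace PlotSpace

variable {P : Type u} (D : PlotSpace P)

/-- A local parametrization of a plot space. -/
structure IsChart (W : Mfd.{u}) (j : W → P) : Prop where
  isPlot : D.IsPlot j
  injective : Function.Injective j
  isOpen_preimage : ∀ {T : Mfd.{u}} {f : T → P}, D.IsPlot f → IsOpen (f ⁻¹' Set.range j)
  smooth_lift : ∀ {T : Mfd.{u}} {f : T → P}, D.IsPlot f → ∀ (V : Opens T) (g : T.restrict V → W),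
    (∀ v, j (g v) = f (Mfd.val v)) → Smooth g

theorem exists_isChart (p : P) : ∃ (W : Mfd.{u}) (j : W → P), p ∈ Set.range j ∧ D.IsChart W j := by
  obtain ⟨W, j, h1, h2, h3, h4⟩ := D.exists_chart p
  exact ⟨W, j, h1, h2, h3, fun hf => (h4 hf).1, fun hf => (h4 hf).2⟩

/-- The finest topology for which all plots are continuous. -/
@[reducible] def topology : TopologicalSpace P where
  IsOpen U := ∀ (T : Mfd.{u}) (f : T → P), D.IsPlot f → IsOpen (f ⁻¹' U)
  isOpen_univ _ _ _ := isOpen_univ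
  isOpen_inter _ _ h h' T f hf := (h T f hf).inter (h' T f hf)
  isOpen_sUnion S h T f hf := by
    rw [Set.sUnion_eq_biUnion, Set.preimage_iUnion₂]
    exact isOpen_biUnion fun U hU => h U hU T f hf

theorem IsPlot.continuous {T : Mfd.{u}} {f : T → P} (hf : D.IsPlot f) :
    @Continuous _ _ _ D.topology f :=
  @Continuous.mk _ _ _ D.topology _ fun _ hU => hU T f hf

namespace IsChart

variable {D} {W : Mfd.{u}} {j : W → P}

/-- The lift of a plot to a parametrization. -/
theorem exists_lift (h : D.IsChart W j) {T : Mfd.{u}} {f : T → P} (hf : D.IsPlot f) (V : Opens T)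
    (hV : ∀ t ∈ V, f t ∈ Set.range j) :
    ∃ g : SmoothMap (T.restrict V) W, ∀ v, j (g v) = f (Mfd.val v) := by
  choose g hg using fun v : T.restrict V => hV _ (Mfd.val_mem v)
  exact ⟨⟨g, h.smooth_lift hf V g hg⟩, hg⟩

/-- Openness is tested on plots. If `g` lifts the plot `f` over the open set where it meets the
image of `j`, then `f ⁻¹' (j '' U)` is the image of `g ⁻¹' U` in `T`. -/
theorem isOpenEmbedding (h : D.IsChart W j) : @IsOpenEmbedding _ _ _ D.topology j := by
  let _ := D.topology
  refine IsOpenEmbedding.of_continuous_injective_isOpenMap (h.isPlot.continuous D) h.injective ?_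
  intro U hU T f hf
  obtain ⟨g, hg⟩ := h.exists_lift hf ⟨_, h.isOpen_preimage hf⟩ fun t ht => ht
  have : f ⁻¹' (j '' U) = Mfd.val '' (g ⁻¹' U) := by
    ext t
    constructor
    · rintro ⟨w, hw, ht⟩
      refine ⟨Mfd.mkPt t ⟨w, ht⟩, ?_, rfl⟩
      have : g (Mfd.mkPt t ⟨w, ht⟩) = w := h.injective ((hg _).trans ht.symm)
      simpa [this] using hw
    · rintro ⟨v, hv, rfl⟩
      exact ⟨_, hv, hg v⟩
  rw [this]
  exact Mfd.isOpenEmbedding_val.isOpenMap _ (hU.preimage g.smooth.1)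

/-- The chart of a plot space given by a chart of a parametrization. -/
noncomputable def chart (h : D.IsChart W j) [Nonempty W] (c : Chart W) : @Chart P D.topology :=
  let _ := D.topology
  ⟨c.1, (h.isOpenEmbedding.toOpenPartialHomeomorph j).symm.trans c.2⟩

end IsChart

/-- The manifold structure of a locally representable sheaf. -/
noncomputable def toMfd : Mfd.{u} where
  carrier := P
  top := D.topology
  atlas := {d | ∃ (W : Mfd.{u}) (j : W → P) (h : D.IsChart W j) (_ : Nonempty W) (c : Chart W),
    c ∈ W.atlas ∧ d = h.chart c}
  cover p := by
    let _ := D.topology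
    obtain ⟨W, j, ⟨w, hw⟩, h⟩ := D.exists_isChart p
    obtain ⟨c, hc, hwc⟩ := W.cover w
    have : Nonempty W := ⟨w⟩
    refine ⟨_, ⟨W, j, h, ⟨w⟩, c, hc, rfl⟩, ?_⟩
    have h1 := (h.isOpenEmbedding.toOpenPartialHomeomorph j).left_inv (x := w) trivial
    simp only [IsOpenEmbedding.toOpenPartialHomeomorph_apply, hw] at h1
    refine ⟨⟨w, trivial, hw⟩, ?_⟩
    change (h.isOpenEmbedding.toOpenPartialHomeomorph j).symm p ∈ c.2.source
    rwa [h1]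
  compatible := by
    let _ := D.topology
    rintro _ ⟨W, j, h, hW, c, hc, rfl⟩ _ ⟨W', j', h', hW', c', hc', rfl⟩ p hp hp'
    set J := h.isOpenEmbedding.toOpenPartialHomeomorph j
    set J' := h'.isOpenEmbedding.toOpenPartialHomeomorph j'
    obtain ⟨⟨w, -, rfl⟩, hp2⟩ := hp
    obtain ⟨⟨w', -, hww'⟩, hp'2⟩ := hp'
    have hJ : ∀ w, J.symm (j w) = w := fun w => J.left_inv trivial
    have hJ' : ∀ w, J'.symm (j' w) = w := fun w => J'.left_inv trivial
    have hww' : j' w' = j w := hww'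
    have hwc : w ∈ c.2.source := by
      have : J.symm (j w) ∈ c.2.source := hp2
      rwa [hJ] at this
    have hwc' : w' ∈ c'.2.source := by
      have : J'.symm (j w) ∈ c'.2.source := hp'2
      rwa [← hww', hJ'] at this
    -- The transition map is the lift through `j'` of the plot `j`, hence smooth.
    obtain ⟨g, hg⟩ := h'.exists_lift h.isPlot ⟨_, h'.isOpen_preimage h.isPlot⟩ fun t ht => ht
    have hwV : j w ∈ Set.range j' := ⟨w', hww'⟩
    have hgw : g (Mfd.mkPt w hwV) = w' := h'.injective ((hg _).trans hww'.symm)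
    have h1 : SmoothAt (fun x => J'.symm (j x)) w := by
      have e : (fun v => J'.symm (j (Mfd.val v))) = g := by
        ext v
        rw [← hg v, hJ']
      refine (smoothAt_restrict_iff (V := ⟨_, h'.isOpen_preimage h.isPlot⟩)
        (f := fun x => J'.symm (j x)) (x := Mfd.mkPt w hwV)).1 ?_
      rw [e]
      exact g.smooth.smoothAt _
    have hv : J'.symm (j w) = w' := by rw [← hww', hJ']
    have h2 := h1.2 c hc c' hc' hwc
      (show J'.symm (j w) ∈ c'.2.source by rw [hv]; exact hwc')
    have h3 : (h.chart c).2 (j w) = c.2 w := by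
      change c.2 (J.symm (j w)) = _
      rw [hJ]
    change ContDiffAt ℝ ∞ _ ((h.chart c).2 (j w))
    rw [h3]
    exact h2

/-- Together with `isPlot_of_smooth`, this says that `D.toMfd` represents the sheaf of plots. -/
theorem smooth_of_isPlot {T : Mfd.{u}} {f : T → D.toMfd} (hf : D.IsPlot f) : Smooth f := by
  let _ := D.topology
  refine smooth_iff_smoothAt.2 fun t => ?_
  obtain ⟨W, j, ⟨w, hw⟩, h⟩ := D.exists_isChart (f t)
  have hW : Nonempty W := ⟨w⟩
  obtain ⟨c, hc, hwc⟩ := W.cover w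
  set J := h.isOpenEmbedding.toOpenPartialHomeomorph j
  have hJ : ∀ w, J.symm (j w) = w := fun w => J.left_inv trivial
  have hd : h.chart c ∈ D.toMfd.atlas := ⟨W, j, h, hW, c, hc, rfl⟩
  have hx : f t ∈ (h.chart c).2.source := by
    refine ⟨⟨w, trivial, hw⟩, ?_⟩
    change J.symm (f t) ∈ c.2.source
    rwa [← hw, hJ]
  refine (smoothAt_iff_chart hd hx).2 ⟨(hf.continuous D).continuousAt, ?_⟩
  obtain ⟨g, hg⟩ := h.exists_lift hf ⟨_, h.isOpen_preimage hf⟩ fun t ht => ht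
  have htV : f t ∈ Set.range j := ⟨w, hw⟩
  have hgw : g (Mfd.mkPt t htV) = w := h.injective ((hg _).trans hw.symm)
  have e : (fun v => (h.chart c).2 (f (Mfd.val v))) = fun v => c.2 (g v) := by
    ext1 v
    change c.2 (J.symm (f (Mfd.val v))) = _
    rw [← hg v, hJ]
  refine (vsmoothAt_restrict_iff (V := ⟨_, h.isOpen_preimage hf⟩)
    (f := fun t => (h.chart c).2 (f t)) (x := Mfd.mkPt t htV)).1 ?_
  rw [e]
  exact (vsmoothAt_chart hc (by rw [hgw]; exact hwc)).comp_smoothAt (g.smooth.smoothAt _)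

/-- Plots are local, and over the open preimage of a parametrization `j` the map is `j ∘ g` with `g`
smooth, as one sees in the charts of `D.toMfd`. -/
theorem isPlot_of_smooth {T : Mfd.{u}} {f : T → D.toMfd} (hf : Smooth f) : D.IsPlot f := by
  let _ := D.topology
  refine D.of_local fun t => ?_
  obtain ⟨W, j, hw, h⟩ := D.exists_isChart (f t)
  have hW : Nonempty W := ⟨hw.choose⟩
  set J := h.isOpenEmbedding.toOpenPartialHomeomorph j
  have hJ : ∀ w, J.symm (j w) = w := fun w => J.left_inv trivial
  have hopen : IsOpen (f ⁻¹' Set.range j) := h.isOpenEmbedding.isOpen_range.preimage hf.1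
  refine ⟨⟨_, hopen⟩, hw, ?_⟩
  choose g hg using fun v : T.restrict ⟨_, hopen⟩ => Mfd.val_mem v
  have e : (fun v : T.restrict ⟨_, hopen⟩ => f (Mfd.val v)) = fun v => j (g v) :=
    funext fun v => (hg v).symm
  rw [e]
  refine D.comp h.isPlot ⟨g, ?_⟩
  have hfv : Smooth fun v : T.restrict ⟨_, hopen⟩ => f (Mfd.val v) := hf.comp smooth_val
  refine smooth_iff_smoothAt.2 fun v => ?_
  obtain ⟨c, hc, hwc⟩ := W.cover (g v)
  have hd : h.chart c ∈ D.toMfd.atlas := ⟨W, j, h, hW, c, hc, rfl⟩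
  have hx : f (Mfd.val v) ∈ (h.chart c).2.source := by
    refine ⟨⟨g v, trivial, hg v⟩, ?_⟩
    change J.symm (f (Mfd.val v)) ∈ c.2.source
    rwa [← hg v, hJ]
  have h1 := (smoothAt_iff_chart (f := fun v : T.restrict ⟨_, hopen⟩ => f (Mfd.val v)) hd hx).1
    (hfv.smoothAt v)
  refine (smoothAt_iff_chart hc hwc).2 ⟨?_, ?_⟩
  · refine h.isOpenEmbedding.isInducing.continuousAt_iff.2 ?_
    have := h1.1
    rw [e] at this
    exact this
  · refine h1.2.congr (Filter.Eventually.of_forall fun v => ?_)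
    change _ = c.2 (J.symm (f (Mfd.val v)))
    rw [← hg v, hJ]

end PlotSpace

/-! ### Fibred products -/

section FiberProd

variable {A B C : Mfd.{u}} {f : SmoothMap A C} (hf : IsSubmersion f) (g : SmoothMap B C)

/-- Pairs of smooth maps as plots of a fibred product. -/
noncomputable def fiberProdPlots : PlotSpace {p : A × B // f p.1 = g p.2} where
  IsPlot h := Smooth (fun t => (h t).1.1) ∧ Smooth (fun t => (h t).1.2)
  comp h k := ⟨h.1.comp k.smooth, h.2.comp k.smooth⟩
  of_local {T h} H := by
    refine ⟨Smooth.of_local fun t => ?_, Smooth.of_local fun t => ?_⟩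
    · obtain ⟨V, hV, h1, h2⟩ := H t
      exact ⟨V, hV, ⟨_, h1⟩, fun _ => rfl⟩
    · obtain ⟨V, hV, h1, h2⟩ := H t
      exact ⟨V, hV, ⟨_, h2⟩, fun _ => rfl⟩
  exists_chart := by
    rintro ⟨⟨a, b⟩, hab⟩
    simp only at hab
    obtain ⟨d, hd, had⟩ := C.cover (f a)
    obtain ⟨e, he, hbe⟩ := B.cover b
    obtain ⟨m, K, α, h1, h2, h3, h4⟩ := hf.exists_chart a hd had
    -- Coordinates near `(a, b)` are those of `b` together with the fibre coordinates of the
    -- submersion at `a`. The remaining coordinates of `a` are those of `f a = g b`, so `k` recovers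
    -- all `α`-coordinates of `a`.
    let ℰ := EuclideanSpace ℝ (Fin e.1) × K
    let k : ℰ → EuclideanSpace ℝ (Fin d.1) × K := fun y => (d.2 (g (e.2.symm y.1)), y.2)
    let O : Set (Mfd.ofVec.{u} ℰ) := {y | (Mfd.vec y).1 ∈ e.2.target ∧
      g (e.2.symm (Mfd.vec y).1) ∈ d.2.source ∧ k (Mfd.vec y) ∈ α.target}
    have hv1 : ∀ y, VSmoothAt (fun y : Mfd.ofVec.{u} ℰ => (Mfd.vec y).1) y := fun y =>
      VSmoothAt.contDiffAt_comp contDiffAt_fst (vsmoothAt_vec y)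
    have hv2 : ∀ y, VSmoothAt (fun y : Mfd.ofVec.{u} ℰ => (Mfd.vec y).2) y := fun y =>
      VSmoothAt.contDiffAt_comp contDiffAt_snd (vsmoothAt_vec y)
    have hsB : ∀ y : Mfd.ofVec.{u} ℰ, (Mfd.vec y).1 ∈ e.2.target →
        SmoothAt (fun y : Mfd.ofVec.{u} ℰ => e.2.symm (Mfd.vec y).1) y :=
      fun y hy => (hv1 y).chart_symm he hy
    have hsC : ∀ y : Mfd.ofVec.{u} ℰ, (Mfd.vec y).1 ∈ e.2.target →
        SmoothAt (fun y : Mfd.ofVec.{u} ℰ => g (e.2.symm (Mfd.vec y).1)) y :=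
      fun y hy => (g.smooth.smoothAt _).comp (hsB y hy)
    have hsk : ∀ y : Mfd.ofVec.{u} ℰ, (Mfd.vec y).1 ∈ e.2.target →
        g (e.2.symm (Mfd.vec y).1) ∈ d.2.source →
        VSmoothAt (fun y : Mfd.ofVec.{u} ℰ => k (Mfd.vec y)) y := fun y hy hy' =>
      (VSmoothAt.comp_smoothAt (f := fun y : Mfd.ofVec.{u} ℰ => g (e.2.symm (Mfd.vec y).1))
        (vsmoothAt_chart hd hy') (hsC y hy)).prodMk (hv2 y)
    have hO : IsOpen O := by
      rw [isOpen_iff_mem_nhds]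
      rintro y ⟨hy1, hy2, hy3⟩
      filter_upwards [(hv1 y).continuousAt (e.2.open_target.mem_nhds hy1),
        (hsC y hy1).1 (d.2.open_source.mem_nhds hy2),
        (hsk y hy1 hy2).continuousAt (α.open_target.mem_nhds hy3)] with z hz1 hz2 hz3
      exact ⟨hz1, hz2, hz3⟩
    have hcomm : ∀ w : (Mfd.ofVec.{u} ℰ).restrict ⟨O, hO⟩, f (α.symm (k (Mfd.vec (Mfd.val w)))) =
        g (e.2.symm (Mfd.vec (Mfd.val w)).1) := by
      intro w
      obtain ⟨-, hw2, hw3⟩ := Mfd.val_mem w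
      obtain ⟨h5, h6⟩ := h2 _ (α.map_target hw3)
      rw [α.right_inv hw3] at h6
      exact d.2.injOn h5 hw2 h6.symm
    let j : (Mfd.ofVec.{u} ℰ).restrict ⟨O, hO⟩ → {p : A × B // f p.1 = g p.2} := fun w =>
      ⟨⟨α.symm (k (Mfd.vec (Mfd.val w))), e.2.symm (Mfd.vec (Mfd.val w)).1⟩, hcomm w⟩
    have hinv : ∀ w, Mfd.vec (Mfd.val w) = (e.2 (j w).1.2, (α (j w).1.1).2) := by
      intro w
      obtain ⟨hw1, hw2, hw3⟩ := Mfd.val_mem w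
      refine Prod.ext (e.2.right_inv hw1).symm ?_
      simp only [j, α.right_inv hw3]
      rfl
    -- The image of the parametrization is cut out by two open conditions, one on each component;
    -- this gives the openness required of a chart.
    have hrange : ∀ p : {p : A × B // f p.1 = g p.2}, p ∈ Set.range j ↔
        p.1.1 ∈ α.source ∧ p.1.2 ∈ e.2.source := by
      rintro ⟨⟨a, b⟩, hab⟩
      simp only at hab
      constructor
      · rintro ⟨w, hw⟩
        obtain ⟨hw1, hw2, hw3⟩ := Mfd.val_mem w
        rw [← hw]
        exact ⟨α.map_target hw3, e.2.map_target hw1⟩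
      · rintro ⟨ha : a ∈ α.source, hb : b ∈ e.2.source⟩
        have hk : k (e.2 b, (α a).2) = α a := by
          refine Prod.ext ?_ rfl
          simp only [k, e.2.left_inv hb, ← hab, (h2 a ha).2]
        refine ⟨Mfd.mkPt (Mfd.ofVecMk (e.2 b, (α a).2)) ⟨e.2.map_source hb, ?_, ?_⟩, ?_⟩
        · simpa [e.2.left_inv hb, ← hab] using (h2 a ha).1
        · change k (e.2 b, (α a).2) ∈ α.target
          rw [hk]
          exact α.map_source ha
        · refine Subtype.ext (Prod.ext ?_ ?_)
          · change α.symm (k (e.2 b, (α a).2)) = a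
            rw [hk, α.left_inv ha]
          · exact e.2.left_inv hb
    refine ⟨(Mfd.ofVec.{u} ℰ).restrict ⟨O, hO⟩, j, (hrange _).2 ⟨h1, hbe⟩, ⟨?_, ?_⟩, ?_, ?_⟩
    · refine smooth_iff_smoothAt.2 fun w => ?_
      obtain ⟨hw1, hw2, hw3⟩ := Mfd.val_mem w
      exact (smoothAt_restrict_iff (f := fun y : Mfd.ofVec.{u} ℰ => α.symm (k (Mfd.vec y)))).2
        (h4 _ _ _ (hsk _ hw1 hw2) hw3)
    · refine smooth_iff_smoothAt.2 fun w => ?_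
      obtain ⟨hw1, hw2, hw3⟩ := Mfd.val_mem w
      exact (smoothAt_restrict_iff (f := fun y : Mfd.ofVec.{u} ℰ => e.2.symm (Mfd.vec y).1)).2
        (hsB _ hw1)
    · intro w w' h
      refine Mfd.val_injective ?_
      have h5 : Mfd.vec (Mfd.val w) = Mfd.vec (Mfd.val w') := by rw [hinv, hinv, h]
      rw [← Mfd.ofVecMk_vec (Mfd.val w), h5, Mfd.ofVecMk_vec]
    · intro T h hh
      have hpre : h ⁻¹' Set.range j = (fun t => (h t).1.1) ⁻¹' α.source ∩
          (fun t => (h t).1.2) ⁻¹' e.2.source := by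
        ext t
        exact hrange (h t)
      refine ⟨?_, fun V l hl => ?_⟩
      · rw [hpre]
        exact (α.open_source.preimage hh.1.1).inter (e.2.open_source.preimage hh.2.1)
      · refine Smooth.of_val (smooth_iff_smoothAt.2 fun v => ?_)
        obtain ⟨h5, h6⟩ := (hrange (h (Mfd.val v))).1 ⟨_, hl v⟩
        rw [smoothAt_ofVec_iff]
        have h7 : (fun v => Mfd.vec (Mfd.val (l v))) =
            fun v : T.restrict V => (e.2 (h (Mfd.val v)).1.2, (α (h (Mfd.val v)).1.1).2) := by
          ext1 v
          rw [hinv, hl]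
        rw [h7]
        refine VSmoothAt.prodMk ?_ ?_
        · exact (vsmoothAt_chart he h6).comp_smoothAt
            ((hh.2.comp smooth_val).smoothAt v)
        · exact VSmoothAt.contDiffAt_comp contDiffAt_snd
            (VSmoothAt.comp_smoothAt (h3 _ h5) ((hh.1.comp smooth_val).smoothAt v))

/-- The fibred product of a submersion and a smooth map. -/
noncomputable def Mfd.fiberProd : Mfd.{u} := (fiberProdPlots hf g).toMfd

namespace FiberProd

/-- A point of the fibred product. -/
def mk (a : A) (b : B) (e : f a = g b) : Mfd.fiberProd hf g := ⟨(a, b), e⟩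

/-- The first projection. -/
def fst : SmoothMap (Mfd.fiberProd hf g) A :=
  ⟨fun p => (show {p : A × B // f p.1 = g p.2} from p).1.1,
    ((fiberProdPlots hf g).isPlot_of_smooth (Smooth.id _)).1⟩

/-- The second projection. -/
def snd : SmoothMap (Mfd.fiberProd hf g) B :=
  ⟨fun p => (show {p : A × B // f p.1 = g p.2} from p).1.2,
    ((fiberProdPlots hf g).isPlot_of_smooth (Smooth.id _)).2⟩

variable {hf g}

theorem comm (p : Mfd.fiberProd hf g) : f (fst hf g p) = g (snd hf g p) :=
  Subtype.property (p := fun p : A × B => f p.1 = g p.2) p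

theorem ext {p q : Mfd.fiberProd hf g} (h : fst hf g p = fst hf g q)
    (h' : snd hf g p = snd hf g q) : p = q := Subtype.ext (Prod.ext h h')

theorem smooth_mk {T : Mfd.{u}} {a : T → A} {b : T → B} (ha : Smooth a) (hb : Smooth b)
    (e : ∀ t, f (a t) = g (b t)) : Smooth fun t => mk hf g (a t) (b t) (e t) :=
  (fiberProdPlots hf g).smooth_of_isPlot ⟨ha, hb⟩

variable (hf g)

/-- Maps to the fibred product. -/
def lift {T : Mfd.{u}} (a : SmoothMap T A) (b : SmoothMap T B) (e : ∀ t, f (a t) = g (b t)) :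
    SmoothMap T (Mfd.fiberProd hf g) := ⟨_, smooth_mk a.smooth b.smooth e⟩

/-- A local lift of `g` along `f` through the first component is a local section through the given
point. -/
theorem isSubmersion_snd : IsSubmersion (snd hf g) := by
  refine isSubmersion_of_local_sections fun p => ?_
  obtain ⟨V, hV, σ, h1, h2⟩ := hf.exists_local_lift g (x₀ := fst hf g p) (comm p)
  exact ⟨V, hV, lift hf g σ (B.incl V) h1, fun _ => rfl, ext h2 rfl⟩

theorem isSubmersion_fst (hg : IsSubmersion g) : IsSubmersion (fst hf g) := by
  refine isSubmersion_of_local_sections fun p => ?_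
  obtain ⟨V, hV, σ, h1, h2⟩ := hg.exists_local_lift f (x₀ := snd hf g p) (comm p).symm
  exact ⟨V, hV, lift hf g (A.incl V) σ fun v => (h1 v).symm, fun _ => rfl, ext rfl h2⟩

theorem surjective_snd (h : Function.Surjective f) : Function.Surjective (snd hf g) := fun b =>
  let ⟨a, ha⟩ := h (g b)
  ⟨mk hf g a b ha, rfl⟩

end FiberProd

end FiberProd

end DiffStack

/-! ### Algebra of Lie groupoids and of torsors. -/

namespace DiffStack

open Topology TopologicalSpace

/-! ### Calculus in Lie groupoids -/

namespace LieGroupoid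

variable {M : Mfd.{u}} (X : LieGroupoid M)

/-- Products carry a proof of composability depending on the factors; this replaces rewriting inside
a product. -/
theorem mul_congr {g g' h h' : X.arr} (hg : g = g') (hh : h = h') (e : X.tgt g = X.src h)
    (e' : X.tgt g' = X.src h') : X.mul g h e = X.mul g' h' e' := by
  subst hg hh; rfl

theorem one_mul' (m : M) (h : X.arr) (e : X.tgt (X.one m) = X.src h) :
    X.mul (X.one m) h e = h := by
  obtain rfl : m = X.src h := (X.tgt_one m).symm.trans e
  exact X.one_mul h

theorem mul_one' (m : M) (h : X.arr) (e : X.tgt h = X.src (X.one m)) :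
    X.mul h (X.one m) e = h := by
  obtain rfl : m = X.tgt h := (X.src_one m).symm.trans e.symm
  exact X.mul_one h

theorem inv_mul_cancel_left (g h : X.arr) (e : X.tgt g = X.src h)
    (e' : X.tgt (X.inv g) = X.src (X.mul g h e)) :
    X.mul (X.inv g) (X.mul g h e) e' = h := by
  rw [← X.mul_assoc (X.inv g) g h (X.tgt_inv g) e]
  simp only [X.inv_mul, X.one_mul']

theorem mul_inv_cancel_left (g h : X.arr) (e : X.tgt (X.inv g) = X.src h)
    (e' : X.tgt g = X.src (X.mul (X.inv g) h e)) :
    X.mul g (X.mul (X.inv g) h e) e' = h := by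
  rw [← X.mul_assoc g (X.inv g) h (X.src_inv g).symm e]
  simp only [X.mul_inv, X.one_mul']

theorem mul_left_cancel {g h h' : X.arr} {e : X.tgt g = X.src h} {e' : X.tgt g = X.src h'}
    (H : X.mul g h e = X.mul g h' e') : h = h' := by
  rw [← X.inv_mul_cancel_left g h e ((X.tgt_inv g).trans (X.src_mul _ _ _).symm)]
  simp only [H, X.inv_mul_cancel_left]

theorem eq_inv_of_mul {g h : X.arr} {e : X.tgt g = X.src h} (m : M) (H : X.mul g h e = X.one m) :
    h = X.inv g := by
  refine X.mul_left_cancel (e := e) (e' := (X.src_inv g).symm) ?_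
  rw [H, X.mul_inv]
  have := congrArg X.src H
  rw [X.src_mul, X.src_one] at this
  rw [this]

@[simp] theorem inv_inv (g : X.arr) : X.inv (X.inv g) = g :=
  (X.eq_inv_of_mul (e := X.tgt_inv g) _ (X.inv_mul g)).symm

theorem inv_one (m : M) : X.inv (X.one m) = X.one m :=
  (X.eq_inv_of_mul (e := (X.tgt_one m).trans (X.src_one m).symm) m (X.one_mul' _ _ _)).symm

theorem inv_mul_rev (g h : X.arr) (e : X.tgt g = X.src h) :
    X.inv (X.mul g h e) = X.mul (X.inv h) (X.inv g)
      ((X.tgt_inv h).trans (e.symm.trans (X.src_inv g).symm)) := by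
  refine (X.eq_inv_of_mul (X.src g) (e := ?_) ?_).symm
  · rw [X.tgt_mul, X.src_mul, X.src_inv]
  · rw [X.mul_assoc g h _ e (by rw [X.src_mul, X.src_inv])]
    simp only [X.mul_inv_cancel_left, X.mul_inv]

/-- The product of two smooth families of arrows. -/
def mulMap {T : Mfd.{u}} (g h : SmoothMap T X.arr) (e : ∀ x, X.tgt (g x) = X.src (h x)) :
    SmoothMap T X.arr := ⟨_, X.mul_smooth T g h e⟩

end LieGroupoid

/-- Preservation of units is not among the axioms of a morphism: `φ(1)` is idempotent, and
cancellation makes it a unit. -/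
theorem LieGroupoidHom.map_one {M N : Mfd.{u}} {X : LieGroupoid M} {Y : LieGroupoid N}
    (φ : LieGroupoidHom X Y) (m : M) : φ.onArr (X.one m) = Y.one (φ.onObj m) := by
  have h := φ.map_mul (X.one m) (X.one m) ((X.tgt_one m).trans (X.src_one m).symm)
  rw [X.one_mul'] at h
  have hs : Y.src (φ.onArr (X.one m)) = φ.onObj m := by rw [φ.src_comm, X.src_one]
  have ht : Y.tgt (φ.onArr (X.one m)) = φ.onObj m := by rw [φ.tgt_comm, X.tgt_one]
  have h' : Y.mul (φ.onArr (X.one m)) (Y.one (φ.onObj m)) (by rw [ht, Y.src_one]) =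
      Y.mul (φ.onArr (X.one m)) (φ.onArr (X.one m)) (ht.trans hs.symm) := by
    rw [Y.mul_one']; exact h
  exact (Y.mul_left_cancel h').symm

theorem LieGroupoidHom.map_inv {M N : Mfd.{u}} {X : LieGroupoid M} {Y : LieGroupoid N}
    (φ : LieGroupoidHom X Y) (g : X.arr) : φ.onArr (X.inv g) = Y.inv (φ.onArr g) := by
  refine Y.eq_inv_of_mul (φ.onObj (X.src g)) (e := ?_) ?_
  · rw [φ.tgt_comm, φ.src_comm, X.src_inv]
  · rw [← φ.map_mul g (X.inv g) (X.src_inv g).symm, X.mul_inv, φ.map_one]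

/-! ### Calculus in torsors -/

namespace TorsorStr

variable {M : Mfd.{u}} {Γ : LieGroupoid M} {P S : Mfd.{u}} (τ : TorsorStr Γ P S)

theorem act_congr {p p' : P} {γ γ' : Γ.arr} (hp : p = p') (hγ : γ = γ') (e : τ.anchor p = Γ.src γ)
    (e' : τ.anchor p' = Γ.src γ') : τ.act p γ e = τ.act p' γ' e' := by
  subst hp hγ; rfl

theorem act_one' (p : P) (m : M) (e : τ.anchor p = Γ.src (Γ.one m)) : τ.act p (Γ.one m) e = p := by
  obtain rfl : m = τ.anchor p := (Γ.src_one m).symm.trans e.symm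
  exact τ.act_one p

theorem act_act_inv (p : P) (γ : Γ.arr) (e : τ.anchor p = Γ.src γ)
    (e' : τ.anchor (τ.act p γ e) = Γ.src (Γ.inv γ)) : τ.act (τ.act p γ e) (Γ.inv γ) e' = p := by
  rw [τ.act_mul p γ (Γ.inv γ) e (Γ.src_inv γ).symm]
  simp only [Γ.mul_inv, τ.act_one']

theorem act_left_cancel {p : P} {γ γ' : Γ.arr} {e : τ.anchor p = Γ.src γ}
    {e' : τ.anchor p = Γ.src γ'} (h : τ.act p γ e = τ.act p γ' e') : γ = γ' :=
  (τ.simply_transitive p (τ.act p γ' e') (τ.proj_act _ _ _).symm).unique ⟨e, h⟩ ⟨e', rfl⟩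

/-- The arrow `γ` with `p · γ = p'`. -/
noncomputable def div (p p' : P) (h : τ.proj p = τ.proj p') : Γ.arr :=
  (τ.simply_transitive p p' h).choose

theorem src_div (p p' : P) (h : τ.proj p = τ.proj p') : τ.anchor p = Γ.src (τ.div p p' h) :=
  (τ.simply_transitive p p' h).choose_spec.1.1

theorem act_div (p p' : P) (h : τ.proj p = τ.proj p') :
    τ.act p (τ.div p p' h) (τ.src_div p p' h) = p' :=
  (τ.simply_transitive p p' h).choose_spec.1.2

theorem tgt_div (p p' : P) (h : τ.proj p = τ.proj p') : Γ.tgt (τ.div p p' h) = τ.anchor p' := by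
  rw [← τ.anchor_act p _ (τ.src_div p p' h), τ.act_div]

theorem div_eq {p p' : P} (h : τ.proj p = τ.proj p') {γ : Γ.arr} (e : τ.anchor p = Γ.src γ)
    (H : τ.act p γ e = p') : τ.div p p' h = γ :=
  τ.act_left_cancel ((τ.act_div p p' h).trans H.symm)

/-- The action on smooth families. -/
def actMap {T : Mfd.{u}} (p : SmoothMap T P) (γ : SmoothMap T Γ.arr)
    (e : ∀ x, τ.anchor (p x) = Γ.src (γ x)) : SmoothMap T P := ⟨_, τ.act_smooth T p γ e⟩

/-- Division of smooth families. -/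
noncomputable def divMap {T : Mfd.{u}} (p p' : SmoothMap T P) (h : ∀ x, τ.proj (p x) = τ.proj (p' x)) :
    SmoothMap T Γ.arr :=
  ⟨fun x => τ.div (p x) (p' x) (h x), τ.division_smooth T p p' _ (fun _ => τ.src_div _ _ _)
    fun _ => τ.act_div _ _ _⟩

end TorsorStr

/-! ### Morphisms of torsors are cartesian -/

namespace Torsor

variable {M : Mfd.{u}} {Γ : LieGroupoid M} {P Q R : Torsor Γ}

/-- A morphism of torsors is determined by the map of total spaces. -/
theorem hom_ext {f g : Hom P Q} (h : ∀ p, f.total p = g.total p) : f = g := by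
  refine Hom.ext (SmoothMap.ext (funext fun s => ?_)) (SmoothMap.ext (funext h))
  obtain ⟨p, rfl⟩ := P.str.proj_submersion.1 s
  rw [← f.proj_comm, ← g.proj_comm, h]

namespace Hom

variable (f : Hom P Q)

/-- The arrow carrying `p` to `p'` fixes `f.total p`, so it is a unit. -/
theorem injective_on_fibers {p p' : P.total} (h : P.str.proj p = P.str.proj p')
    (h' : f.total p = f.total p') : p = p' := by
  have h1 := f.equivariant p _ (P.str.src_div p p' h)
  rw [P.str.act_div, ← h'] at h1
  have h2 : P.str.div p p' h = Γ.one (Q.str.anchor (f.total p)) :=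
    Q.str.act_left_cancel (h1.symm.trans (Q.str.act_one _).symm)
  have h3 := P.str.act_div p p' h
  simp only [h2, P.str.act_one'] at h3
  exact h3

/-- Start from any point over `s` and move it by the arrow that carries its image to `q`. With
`injective_on_fibers` this identifies `P` with the pullback of `Q` along the base map. -/
theorem exists_lift (s : P.base) (q : Q.total) (h : Q.str.proj q = f.base s) :
    ∃ p, P.str.proj p = s ∧ f.total p = q := by
  obtain ⟨p, rfl⟩ := P.str.proj_submersion.1 s
  have h' : Q.str.proj (f.total p) = Q.str.proj q := (f.proj_comm p).trans h.symm
  refine ⟨P.str.act p (Q.str.div _ _ h') ((f.anchor_comm p).symm.trans (Q.str.src_div _ _ h')),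
    P.str.proj_act _ _ _, ?_⟩
  rw [f.equivariant, Q.str.act_div]

/-- The lift of a family of points of the target of a morphism of torsors. -/
noncomputable def lift {T : Mfd.{u}} (s : SmoothMap T P.base) (q : SmoothMap T Q.total)
    (h : ∀ t, Q.str.proj (q t) = f.base (s t)) : SmoothMap T P.total where
  toFun t := (f.exists_lift (s t) (q t) (h t)).choose
  smooth := Smooth.of_local fun t => by
    -- Near `t` the lift is a local section of `P` translated by a smooth quotient formed in `Q`.
    obtain ⟨V, hV, σ, hσ⟩ := P.str.proj_submersion.exists_local_lift s t
    have h' : ∀ v, Q.str.proj ((f.total.comp σ) v) = Q.str.proj ((q.comp (T.incl V)) v) :=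
      fun v => (f.proj_comm (σ v)).trans ((congrArg f.base (hσ v)).trans (h _).symm)
    refine ⟨V, hV, P.str.actMap σ (Q.str.divMap _ _ h')
      (fun v => (f.anchor_comm _).symm.trans (Q.str.src_div _ _ (h' v))), fun v => ?_⟩
    have hc := (f.exists_lift (s (Mfd.val v)) (q (Mfd.val v)) (h (Mfd.val v))).choose_spec
    refine f.injective_on_fibers ?_ ?_
    · exact hc.1.trans ((hσ v).symm.trans (P.str.proj_act _ _ _).symm)
    · refine hc.2.trans ((f.equivariant _ _ _).trans ?_).symm
      exact Q.str.act_div _ _ (h' v)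

variable {T : Mfd.{u}} (s : SmoothMap T P.base) (q : SmoothMap T Q.total)
    (h : ∀ t, Q.str.proj (q t) = f.base (s t))

@[simp] theorem proj_lift (t : T) : P.str.proj (f.lift s q h t) = s t :=
  (f.exists_lift (s t) (q t) (h t)).choose_spec.1

@[simp] theorem total_lift (t : T) : f.total (f.lift s q h t) = q t :=
  (f.exists_lift (s t) (q t) (h t)).choose_spec.2

/-- A morphism of torsors over a diffeomorphism is an isomorphism. -/
theorem isIso {P Q : Torsor Γ} (f : P ⟶ Q) (g : SmoothMap Q.base P.base)
    (h : ∀ s, Hom.base f (g s) = s) (h' : ∀ s, g (Hom.base f s) = s) : IsIso f := by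
  let k : SmoothMap Q.total P.total := Hom.lift f (g.comp Q.str.proj) ⟨fun x => x, Smooth.id _⟩
    fun t => (h _).symm
  have hk : ∀ q, Hom.total f (k q) = q := fun q => Hom.total_lift f _ _ _ q
  have hk' : ∀ q, P.str.proj (k q) = g (Q.str.proj q) := fun q => Hom.proj_lift f _ _ _ q
  have hak : ∀ q, P.str.anchor (k q) = Q.str.anchor q := fun q => by
    rw [← Hom.anchor_comm f, hk]
  let inv : Q ⟶ P :=
    { base := g
      total := k
      proj_comm := hk'
      anchor_comm := hak
      equivariant := fun q γ e => by
        refine Hom.injective_on_fibers f ?_ ?_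
        · rw [hk', P.str.proj_act, hk', Q.str.proj_act]
        · rw [hk, Hom.equivariant]
          simp only [hk] }
  refine ⟨inv, hom_ext fun p => ?_, hom_ext fun q => hk q⟩
  refine Hom.injective_on_fibers f ?_ ?_
  · change P.str.proj (k (Hom.total f p)) = P.str.proj p
    rw [hk', Hom.proj_comm, h']
  · exact hk _

end Hom

/-- The morphism of torsors over the same base carrying a given section to a given section. -/
noncomputable def homOfSections {S A B : Mfd.{u}} (σ : TorsorStr Γ A S) (τ : TorsorStr Γ B S)
    (a : SmoothMap S A) (b : SmoothMap S B) (ha : ∀ s, σ.proj (a s) = s) (hb : ∀ s, τ.proj (b s) = s)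
    (hab : ∀ s, σ.anchor (a s) = τ.anchor (b s)) : Hom (⟨S, A, σ⟩ : Torsor Γ) ⟨S, B, τ⟩ where
  base := ⟨fun s => s, Smooth.id _⟩
  -- The point `a(s) · γ` is sent to `b(s) · γ`.
  total := τ.actMap (b.comp σ.proj) (σ.divMap (a.comp σ.proj) ⟨fun p => p, Smooth.id _⟩
    fun p => ha _) fun p => (hab _).symm.trans (σ.src_div _ _ (ha (σ.proj p)))
  proj_comm p := (τ.proj_act _ _ _).trans (hb _)
  anchor_comm p := (τ.anchor_act _ _ _).trans (σ.tgt_div _ _ (ha (σ.proj p)))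
  equivariant p γ e := by
    have h1 : σ.div (a (σ.proj (σ.act p γ e))) (σ.act p γ e) (ha _) =
        Γ.mul (σ.div (a (σ.proj p)) p (ha _)) γ ((σ.tgt_div _ _ _).trans e) := by
      refine σ.div_eq _ ?_ ?_
      · rw [σ.proj_act, Γ.src_mul, ← σ.src_div]
      · simp only [σ.proj_act]
        rw [← σ.act_mul _ _ _ (σ.src_div _ _ (ha _))]
        simp only [σ.act_div]
    have h2 : b (σ.proj (σ.act p γ e)) = b (σ.proj p) := by rw [σ.proj_act]
    exact (τ.act_congr h2 h1 _ ((hab _).symm.trans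
      ((σ.src_div _ _ (ha (σ.proj p))).trans (Γ.src_mul _ _ _).symm))).trans
      (τ.act_mul _ _ _ _ ((σ.tgt_div _ _ (ha (σ.proj p))).trans e)).symm

theorem homOfSections_apply {S A B : Mfd.{u}} (σ : TorsorStr Γ A S) (τ : TorsorStr Γ B S)
    (a : SmoothMap S A) (b : SmoothMap S B) (ha : ∀ s, σ.proj (a s) = s) (hb : ∀ s, τ.proj (b s) = s)
    (hab : ∀ s, σ.anchor (a s) = τ.anchor (b s)) (s : S) :
    (homOfSections σ τ a b ha hb hab).total (a s) = b s := by
  have h1 : σ.div (a (σ.proj (a s))) (a s) (ha _) = Γ.one (σ.anchor (a s)) := by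
    refine σ.div_eq _ ?_ ?_
    · rw [ha, Γ.src_one]
    · simp only [ha, σ.act_one']
  exact (τ.act_congr (congrArg b (ha s)) h1 _ ((hab s).symm.trans (Γ.src_one _).symm)).trans
    (τ.act_one' _ _ _)

/-! ### Trivial torsors -/

/-- The trivial torsor over `T` given by a map `a : T → M`. -/
noncomputable def triv (Γ : LieGroupoid M) {T : Mfd.{u}} (a : SmoothMap T M) : Torsor Γ where
  base := T
  total := Mfd.fiberProd Γ.src_submersion a
  str :=
    { proj := FiberProd.snd _ _
      anchor := Γ.tgt.comp (FiberProd.fst _ _)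
      proj_submersion := ⟨FiberProd.surjective_snd _ _ fun m => ⟨Γ.one m, Γ.src_one m⟩,
        FiberProd.isSubmersion_snd _ _⟩
      act := fun p γ e => FiberProd.mk _ _ (Γ.mul (FiberProd.fst _ _ p) γ e) (FiberProd.snd _ _ p)
        ((Γ.src_mul _ _ _).trans (FiberProd.comm p))
      act_smooth := fun U p γ e => FiberProd.smooth_mk
        (Γ.mul_smooth U ((FiberProd.fst _ _).comp p) γ e) ((FiberProd.snd _ _).smooth.comp p.smooth) _
      anchor_act := fun p γ e => Γ.tgt_mul _ _ _
      act_one := fun p => FiberProd.ext (Γ.mul_one' _ _ _) rfl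
      act_mul := fun p γ δ e e' => FiberProd.ext (Γ.mul_assoc _ _ _ e e') rfl
      proj_act := fun p γ e => rfl
      simply_transitive := fun p p' h => by
        have hs : Γ.src (FiberProd.fst _ _ p) = Γ.src (FiberProd.fst _ _ p') := by
          rw [FiberProd.comm, FiberProd.comm]; exact congrArg a h
        refine ⟨Γ.mul (Γ.inv (FiberProd.fst _ _ p)) (FiberProd.fst _ _ p')
          ((Γ.tgt_inv _).trans hs), ⟨?_, ?_⟩, ?_⟩
        · exact (Γ.src_inv _).symm.trans (Γ.src_mul _ _ _).symm
        · exact FiberProd.ext (Γ.mul_inv_cancel_left _ _ _ _) h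
        · rintro γ ⟨e, rfl⟩
          exact (Γ.inv_mul_cancel_left _ _ _ _).symm
      division_smooth := fun U p p' γ e h => by
        have hs : ∀ x, Γ.tgt (Γ.inv (FiberProd.fst _ _ (p x))) = Γ.src (FiberProd.fst _ _ (p' x)) := by
          intro x
          rw [← h, Γ.tgt_inv]
          exact (Γ.src_mul _ _ _).symm
        have : γ = Γ.mulMap (Γ.inv.comp ((FiberProd.fst _ _).comp p)) ((FiberProd.fst _ _).comp p')
            hs := by
          ext x
          refine Γ.mul_left_cancel (e := e x) (e' := (Γ.src_inv _).symm.trans (Γ.src_mul _ _ _).symm)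
            (Eq.trans ?_ (Γ.mul_inv_cancel_left _ _ (hs x) _).symm)
          rw [← h]
          rfl
        rw [this]
        exact SmoothMap.smooth _ }

section Triv

variable {T : Mfd.{u}} (a : SmoothMap T M)

/-- The unit section of a trivial torsor. -/
noncomputable def trivUnit : SmoothMap T (triv Γ a).total :=
  FiberProd.lift _ _ (Γ.one.comp a) ⟨fun t => t, Smooth.id _⟩ fun _ => Γ.src_one _

@[simp] theorem anchor_trivUnit (t : T) : (triv Γ a).str.anchor (trivUnit (Γ := Γ) a t) = a t :=
  Γ.tgt_one _

variable {a}

/-- The morphism from a trivial torsor given by a family of points of `Q`. -/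
noncomputable def trivHom (q : SmoothMap T Q.total) (h : ∀ t, Q.str.anchor (q t) = a t) :
    triv Γ a ⟶ Q where
  base := Q.str.proj.comp q
  total := Q.str.actMap (T := Mfd.fiberProd Γ.src_submersion a) (q.comp (FiberProd.snd _ _))
    (FiberProd.fst _ _) fun p => (h _).trans (FiberProd.comm p).symm
  proj_comm _ := Q.str.proj_act _ _ _
  anchor_comm _ := Q.str.anchor_act _ _ _
  equivariant _ _ e := (Q.str.act_mul _ _ _ _ e).symm

@[simp] theorem trivHom_unit (q : SmoothMap T Q.total) (h : ∀ t, Q.str.anchor (q t) = a t) (t : T) :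
    Hom.total (trivHom (Γ := Γ) q h) (trivUnit a t) = q t := Q.str.act_one' _ _ _

/-- The unit section generates the trivial torsor. With `trivHom`, morphisms `triv Γ a ⟶ Q` amount
to families of points of `Q` with anchor `a`. -/
theorem triv_hom_ext {f g : triv Γ a ⟶ Q}
    (h : ∀ t : T, Hom.total f (trivUnit a t) = Hom.total g (trivUnit a t)) : f = g := by
  refine hom_ext fun p => ?_
  have hp : p = (triv Γ a).str.act (trivUnit a (FiberProd.snd _ _ p)) (FiberProd.fst _ _ p)
      ((Γ.tgt_one _).trans (FiberProd.comm p).symm) :=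
    FiberProd.ext (Γ.one_mul' _ _ _).symm rfl
  rw [hp]
  refine (Hom.equivariant f _ _ _).trans (Eq.trans ?_ (Hom.equivariant g _ _ _).symm)
  simp only [h]

end Triv

end Torsor

end DiffStack

/-! ### Induction of a torsor along a morphism of groupoids, as a quotient manifold. -/

namespace DiffStack

open Topology TopologicalSpace

/-! ### The torsor induced along a morphism of groupoids -/

namespace Induced

variable {M N : Mfd.{u}} {Γ : LieGroupoid M} {Δ : LieGroupoid N} (φ : LieGroupoidHom Γ Δ)
  (Q : Torsor Γ)

/-- The manifold of pairs `(δ, q)` with `s(δ) = φ(a(q))`. -/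
noncomputable abbrev Pairs : Mfd.{u} :=
  Mfd.fiberProd Δ.src_submersion (φ.onObj.comp Q.str.anchor)

/-- The arrow of a pair. -/
noncomputable abbrev arrow : SmoothMap (Pairs φ Q) Δ.arr := FiberProd.fst _ _

/-- The point of a pair. -/
noncomputable abbrev point : SmoothMap (Pairs φ Q) Q.total := FiberProd.snd _ _

variable {φ Q}

theorem src_arrow (w : Pairs φ Q) : Δ.src (arrow φ Q w) = φ.onObj (Q.str.anchor (point φ Q w)) :=
  FiberProd.comm w

/-- The relation `(φ(γ) δ, q) ∼ (δ, q γ)`. -/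
def Rel (w w' : Pairs φ Q) : Prop :=
  ∃ (γ : Γ.arr) (e : Q.str.anchor (point φ Q w) = Γ.src γ)
    (e' : Δ.tgt (φ.onArr γ) = Δ.src (arrow φ Q w')),
    point φ Q w' = Q.str.act (point φ Q w) γ e ∧
      arrow φ Q w = Δ.mul (φ.onArr γ) (arrow φ Q w') e'

theorem Rel.proj {w w' : Pairs φ Q} (h : Rel w w') :
    Q.str.proj (point φ Q w) = Q.str.proj (point φ Q w') := by
  obtain ⟨γ, e, e', h1, -⟩ := h
  rw [h1, Q.str.proj_act]

/-- The action on `Q` is free, so the relating arrow is a unit. Hence over a local section of `Q`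
every class has exactly one representative, which is the source of the charts. -/
theorem Rel.eq_of_point_eq {w w' : Pairs φ Q} (h : Rel w w')
    (h' : point φ Q w = point φ Q w') : w = w' := by
  obtain ⟨γ, e, e', h1, h2⟩ := h
  have hγ : γ = Γ.one (Q.str.anchor (point φ Q w)) := by
    refine Q.str.act_left_cancel (e := e) (e' := (Γ.src_one _).symm) ?_
    rw [← h1, Q.str.act_one, h']
  refine FiberProd.ext ?_ h'
  simp only [hγ, φ.map_one, Δ.one_mul'] at h2
  exact h2

variable (φ Q)

/-- The equivalence relation defining the induced torsor. -/
def setoid : Setoid (Pairs φ Q) where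
  r := Rel
  iseqv :=
    { refl := fun w => ⟨Γ.one (Q.str.anchor (point φ Q w)), (Γ.src_one _).symm, by
          rw [φ.tgt_comm, Γ.tgt_one, src_arrow], (Q.str.act_one _).symm, by
          simp only [φ.map_one, Δ.one_mul']⟩
      symm := by
        rintro w w' ⟨γ, e, e', h1, h2⟩
        refine ⟨Γ.inv γ, ?_, ?_, ?_, ?_⟩
        · rw [h1, Q.str.anchor_act, Γ.src_inv]
        · rw [h2, Δ.src_mul, φ.tgt_comm, Γ.tgt_inv, φ.src_comm]
        · simp only [h1, Q.str.act_act_inv]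
        · simp only [h2, φ.map_inv, Δ.inv_mul_cancel_left]
      trans := by
        rintro w w' w'' ⟨γ, e, e', h1, h2⟩ ⟨δ, f, f', h3, h4⟩
        have hγδ : Γ.tgt γ = Γ.src δ := by rw [← f, h1, Q.str.anchor_act]
        refine ⟨Γ.mul γ δ hγδ, e.trans (Γ.src_mul _ _ _).symm, ?_, ?_, ?_⟩
        · rw [← f', φ.tgt_comm, φ.tgt_comm, Γ.tgt_mul]
        · rw [← Q.str.act_mul _ _ _ e]
          simp only [h3, h1]
        · simp only [h2, h4, φ.map_mul]
          rw [Δ.mul_assoc] }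

/-- The points of the induced torsor. -/
abbrev Carrier : Type u := Quotient (setoid φ Q)

variable {φ Q}

/-- The projection of the induced torsor. -/
noncomputable def projFun : Carrier φ Q → Q.base :=
  Quotient.lift (fun w => Q.str.proj (point φ Q w)) fun _ _ h => h.proj

variable (φ Q)

/-- Plots of the induced torsor are maps which lift locally to pairs. -/
def IsPlot {T : Mfd.{u}} (f : T → Carrier φ Q) : Prop :=
  ∀ t, ∃ (V : Opens T) (_ : t ∈ V) (g : SmoothMap (T.restrict V) (Pairs φ Q)),
    ∀ v, f (Mfd.val v) = Quotient.mk (setoid φ Q) (g v)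

variable {φ Q}

theorem IsPlot.comp {T T' : Mfd.{u}} {f : T → Carrier φ Q} (hf : IsPlot φ Q f)
    (g : SmoothMap T' T) : IsPlot φ Q fun t => f (g t) := by
  intro t
  obtain ⟨V, hV, h, hh⟩ := hf (g t)
  exact ⟨Opens.comap ⟨g, g.smooth.1⟩ V, hV, h.comp (g.restrictPreimage V),
    fun v => hh (g.restrictPreimage V v)⟩

theorem isPlot_mk {T : Mfd.{u}} (g : SmoothMap T (Pairs φ Q)) :
    IsPlot φ Q fun t => Quotient.mk (setoid φ Q) (g t) := fun _ =>
  ⟨⊤, trivial, g.comp (T.incl ⊤), fun _ => rfl⟩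

theorem IsPlot.smooth_proj {T : Mfd.{u}} {f : T → Carrier φ Q} (hf : IsPlot φ Q f) :
    Smooth fun t => projFun (f t) := by
  refine Smooth.of_local fun t => ?_
  obtain ⟨V, hV, h, hh⟩ := hf t
  refine ⟨V, hV, Q.str.proj.comp ((point φ Q).comp h), fun v => ?_⟩
  rw [hh]
  rfl

section Chart

variable {V : Opens Q.base} (σ : SmoothMap (Q.base.restrict V) Q.total)

/-- The parametrization of the induced torsor given by a local section. -/
noncomputable def param (w : Mfd.fiberProd Δ.src_submersion (φ.onObj.comp (Q.str.anchor.comp σ))) :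
    Carrier φ Q :=
  Quotient.mk _ (FiberProd.mk Δ.src_submersion (φ.onObj.comp Q.str.anchor) (FiberProd.fst _ _ w)
    (σ (FiberProd.snd _ _ w)) (FiberProd.comm w))

theorem isPlot_param : IsPlot φ Q (param (φ := φ) σ) :=
  isPlot_mk ⟨_, FiberProd.smooth_mk (FiberProd.fst _ _).smooth
    (σ.smooth.comp (FiberProd.snd _ _).smooth) fun w => FiberProd.comm w⟩

variable {σ} (hσ : ∀ v, Q.str.proj (σ v) = Mfd.val v)
include hσ

theorem param_injective : Function.Injective (param (φ := φ) σ) := by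
  intro w w' h
  have h0 : Rel _ _ := Quotient.exact h
  have hv : FiberProd.snd _ _ w = FiberProd.snd _ _ w' :=
    Mfd.val_injective ((hσ _).symm.trans (h0.proj.trans (hσ _)))
  exact FiberProd.ext (congrArg (arrow φ Q) (h0.eq_of_point_eq (congrArg σ hv))) hv

/-- The representative `w` is moved onto the section `σ`, the arrow from `σ v` to its point being
absorbed into the arrow component. -/
theorem param_eq (w : Pairs φ Q) (v : Q.base.restrict V)
    (hv : Q.str.proj (point φ Q w) = Mfd.val v) (e) (e') :
    param σ (FiberProd.mk _ _ (Δ.mul (φ.onArr (Q.str.div (σ v) (point φ Q w) ((hσ v).trans hv.symm)))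
      (arrow φ Q w) e) v e') = Quotient.mk (setoid φ Q) w :=
  Quotient.sound ⟨_, Q.str.src_div _ _ ((hσ v).trans hv.symm), e, (Q.str.act_div _ _ _).symm, rfl⟩

theorem range_param (p : Carrier φ Q) : p ∈ Set.range (param σ) ↔ projFun p ∈ V := by
  constructor
  · rintro ⟨w, rfl⟩
    change Q.str.proj (σ (FiberProd.snd _ _ w)) ∈ V
    rw [hσ]
    exact Mfd.val_mem _
  · induction p using Quotient.inductionOn with
    | h w =>
      intro h
      refine ⟨_, param_eq hσ w (Mfd.mkPt _ h) rfl ?_ ?_⟩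
      · rw [φ.tgt_comm, Q.str.tgt_div, src_arrow]
      · rw [Δ.src_mul, φ.src_comm, ← Q.str.src_div]
        rfl

/-- Take a local representative of the plot and move it onto the section as in `param_eq`; the
moving arrow is a smooth quotient in `Q`, and by injectivity of `param` the result is `g`. -/
theorem smooth_param_lift {T : Mfd.{u}} {f : T → Carrier φ Q} (hf : IsPlot φ Q f)
    (g : T → Mfd.fiberProd Δ.src_submersion (φ.onObj.comp (Q.str.anchor.comp σ)))
    (hg : ∀ t, param σ (g t) = f t) : Smooth g := by
  refine Smooth.of_local fun t => ?_
  obtain ⟨U, hU, h, hh⟩ := hf t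
  have hV : ∀ v, Q.str.proj (point φ Q (h v)) ∈ V := fun v => by
    have := (range_param hσ (f (Mfd.val v))).1 ⟨_, hg _⟩
    rwa [hh] at this
  let s : SmoothMap (T.restrict U) (Q.base.restrict V) :=
    (Q.str.proj.comp ((point φ Q).comp h)).codRestrict V hV
  have hs : ∀ v, Q.str.proj ((σ.comp s) v) = Q.str.proj (((point φ Q).comp h) v) :=
    fun v => hσ (s v)
  let γ : SmoothMap (T.restrict U) Γ.arr := Q.str.divMap _ _ hs
  have e : ∀ v, Δ.tgt ((φ.onArr.comp γ) v) = Δ.src (((arrow φ Q).comp h) v) := fun v =>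
    (φ.tgt_comm _).trans ((congrArg φ.onObj (Q.str.tgt_div _ _ (hs v))).trans (src_arrow (h v)).symm)
  have e' : ∀ v, Δ.src (Δ.mulMap (φ.onArr.comp γ) ((arrow φ Q).comp h) e v) =
      (φ.onObj.comp (Q.str.anchor.comp σ)) (s v) := fun v =>
    (Δ.src_mul _ _ _).trans ((φ.src_comm _).trans
      (congrArg φ.onObj (Q.str.src_div _ _ (hs v)).symm))
  refine ⟨U, hU, FiberProd.lift _ _ (Δ.mulMap (φ.onArr.comp γ) ((arrow φ Q).comp h) e) s e',
    fun v => param_injective hσ ?_⟩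
  rw [hg, hh]
  exact (param_eq hσ (h v) (s v) rfl (e v) (e' v)).symm

end Chart

variable (φ Q)

/-- The smooth structure of the induced torsor. -/
noncomputable def plots : PlotSpace (Carrier φ Q) where
  IsPlot := IsPlot φ Q
  comp h g := h.comp g
  of_local {T f} H t := by
    obtain ⟨V, hV, hf⟩ := H t
    obtain ⟨W, hW, g, hg⟩ := hf (Mfd.mkPt t hV)
    obtain ⟨V', hV', j, hj⟩ := Mfd.exists_restrict_restrict W hW
    refine ⟨V', hV', g.comp j, fun v => ?_⟩
    rw [← hj]
    exact hg (j v)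
  exists_chart p := by
    obtain ⟨V, hV, σ, hσ⟩ := Q.str.proj_submersion.exists_local_lift
      (⟨fun s => s, Smooth.id _⟩ : SmoothMap Q.base Q.base) (projFun p)
    refine ⟨_, param σ, (range_param hσ p).2 hV, isPlot_param σ, param_injective hσ, ?_⟩
    intro T f hf
    refine ⟨?_, fun U g hg => smooth_param_lift hσ (hf.comp (T.incl U)) g hg⟩
    have : f ⁻¹' Set.range (param σ) = (fun t => projFun (f t)) ⁻¹' V := by
      ext t
      exact range_param hσ (f t)
    rw [this]
    exact V.isOpen.preimage hf.smooth_proj.1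

/-- The total space of the induced torsor. -/
noncomputable def total : Mfd.{u} := (plots φ Q).toMfd

/-- The class of a pair. -/
noncomputable def mk : SmoothMap (Pairs φ Q) (total φ Q) :=
  ⟨fun w => Quotient.mk _ w, (plots φ Q).smooth_of_isPlot
    (isPlot_mk ⟨fun w => w, Smooth.id _⟩)⟩

theorem mk_surjective : Function.Surjective (mk φ Q) := Quotient.mk_surjective

variable {φ Q}

theorem mk_eq_mk {w w' : Pairs φ Q} : mk φ Q w = mk φ Q w' ↔ Rel w w' :=
  Quotient.eq (r := setoid φ Q)

theorem exists_local_rep {T : Mfd.{u}} (p : SmoothMap T (total φ Q)) (t : T) :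
    ∃ (V : Opens T) (_ : t ∈ V) (g : SmoothMap (T.restrict V) (Pairs φ Q)),
      ∀ v, p (Mfd.val v) = mk φ Q (g v) :=
  (plots φ Q).isPlot_of_smooth p.smooth t

/-- Maps out of the induced torsor. -/
theorem smooth_of_comp_mk {Y : Mfd.{v}} {f : total φ Q → Y} (h : Smooth fun w => f (mk φ Q w)) :
    Smooth f := by
  refine Smooth.of_local fun p => ?_
  obtain ⟨V, hV, g, hg⟩ := exists_local_rep (⟨fun p => p, Smooth.id _⟩ :
    SmoothMap (total φ Q) (total φ Q)) p
  exact ⟨V, hV, ⟨_, h.comp g.smooth⟩, fun v => congrArg f (hg v)⟩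

theorem mk_injective_of_point_eq {w w' : Pairs φ Q} (h : mk φ Q w = mk φ Q w')
    (h' : point φ Q w = point φ Q w') : w = w' :=
  (mk_eq_mk.1 h).eq_of_point_eq h'

variable (φ Q)

/-- The projection. -/
noncomputable def proj : SmoothMap (total φ Q) Q.base :=
  ⟨projFun, smooth_of_comp_mk (Q.str.proj.smooth.comp (point φ Q).smooth)⟩

/-- The anchor. -/
noncomputable def anchor : SmoothMap (total φ Q) N :=
  ⟨Quotient.lift (fun w => Δ.tgt (arrow φ Q w)) (by
    rintro w w' ⟨γ, e, e', h1, h2⟩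
    rw [h2, Δ.tgt_mul]), smooth_of_comp_mk (Δ.tgt.smooth.comp (arrow φ Q).smooth)⟩

variable {φ Q}

@[simp] theorem anchor_mk (w : Pairs φ Q) : anchor φ Q (mk φ Q w) = Δ.tgt (arrow φ Q w) := rfl

/-- The action on pairs. -/
noncomputable def pairAct (w : Pairs φ Q) (δ : Δ.arr) (e : Δ.tgt (arrow φ Q w) = Δ.src δ) :
    Pairs φ Q := FiberProd.mk _ _ (Δ.mul (arrow φ Q w) δ e) (point φ Q w)
      ((Δ.src_mul _ _ _).trans (src_arrow w))

/-- The action. -/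
noncomputable def act (p : total φ Q) (δ : Δ.arr) (e : anchor φ Q p = Δ.src δ) : total φ Q :=
  mk φ Q (pairAct (mk_surjective φ Q p).choose δ
    (((congrArg (anchor φ Q) (mk_surjective φ Q p).choose_spec)).trans e))

/-- The action was defined through a chosen representative; right multiplication respects `Rel`, so
any representative may be used. -/
theorem act_mk (w : Pairs φ Q) (δ : Δ.arr) (e : anchor φ Q (mk φ Q w) = Δ.src δ) :
    act (mk φ Q w) δ e = mk φ Q (pairAct w δ e) := by
  rw [act, mk_eq_mk]
  obtain ⟨γ, f, f', h1, h2⟩ := mk_eq_mk.1 (mk_surjective φ Q (mk φ Q w)).choose_spec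
  refine ⟨γ, f, f'.trans (Δ.src_mul _ _ _).symm, h1, ?_⟩
  change Δ.mul (arrow φ Q (mk_surjective φ Q (mk φ Q w)).choose) δ _ =
    Δ.mul (φ.onArr γ) (Δ.mul (arrow φ Q w) δ _) _
  rw [← Δ.mul_assoc _ _ _ f' e]
  exact Δ.mul_congr h2 rfl _ _

/-- Moving the representative of a point of the induced torsor to a given point of the fibre. -/
theorem exists_rep (p : total φ Q) (q : Q.total) (h : Q.str.proj q = proj φ Q p) :
    ∃ w, point φ Q w = q ∧ mk φ Q w = p := by
  obtain ⟨w, rfl⟩ := mk_surjective φ Q p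
  replace h : Q.str.proj q = Q.str.proj (point φ Q w) := h
  have e : Δ.tgt (φ.onArr (Q.str.div q (point φ Q w) h)) = Δ.src (arrow φ Q w) := by
    rw [φ.tgt_comm, Q.str.tgt_div, src_arrow]
  refine ⟨FiberProd.mk _ _ (Δ.mul (φ.onArr (Q.str.div q (point φ Q w) h)) (arrow φ Q w) e) q ?_,
    rfl, ?_⟩
  · rw [Δ.src_mul, φ.src_comm, ← Q.str.src_div]
    rfl
  · exact mk_eq_mk.2 ⟨_, Q.str.src_div _ _ h, e, (Q.str.act_div _ _ _).symm, rfl⟩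

variable (φ Q)

/-- The torsor structure. -/
noncomputable def str : TorsorStr Δ (total φ Q) Q.base where
  proj := proj φ Q
  anchor := anchor φ Q
  proj_submersion := by
    constructor
    · intro s
      obtain ⟨q, rfl⟩ := Q.str.proj_submersion.1 s
      exact ⟨mk φ Q (FiberProd.mk _ _ (Δ.one (φ.onObj (Q.str.anchor q))) q (Δ.src_one _)), rfl⟩
    · refine IsSubmersion.of_comp (mk_surjective φ Q) ?_
      exact Q.str.proj_submersion.2.comp (FiberProd.isSubmersion_snd _ _)
  act := act
  act_smooth T p δ e := by
    refine Smooth.of_local fun t => ?_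
    obtain ⟨V, hV, g, hg⟩ := exists_local_rep p t
    have e' : ∀ v, Δ.tgt (arrow φ Q (g v)) = Δ.src (δ (Mfd.val v)) := fun v => by
      rw [← e, hg, anchor_mk]
    refine ⟨V, hV, (mk φ Q).comp ⟨fun v => pairAct (g v) (δ (Mfd.val v)) (e' v),
      FiberProd.smooth_mk (Δ.mul_smooth _ ((arrow φ Q).comp g) (δ.comp (T.incl V)) e')
        ((point φ Q).smooth.comp g.smooth) _⟩, fun v => ?_⟩
    simp only [hg, act_mk]
    rfl
  anchor_act p δ e := by
    obtain ⟨w, rfl⟩ := mk_surjective φ Q p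
    rw [act_mk]
    exact Δ.tgt_mul _ _ _
  act_one p := by
    obtain ⟨w, rfl⟩ := mk_surjective φ Q p
    rw [act_mk]
    exact congrArg _ (FiberProd.ext (Δ.mul_one' _ _ _) rfl)
  act_mul p γ δ e e' := by
    obtain ⟨w, rfl⟩ := mk_surjective φ Q p
    simp only [act_mk]
    exact congrArg _ (FiberProd.ext (Δ.mul_assoc _ _ _ e e') rfl)
  proj_act p δ e := by
    obtain ⟨w, rfl⟩ := mk_surjective φ Q p
    rw [act_mk]
    rfl
  simply_transitive p p' h := by
    obtain ⟨w, rfl⟩ := mk_surjective φ Q p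
    -- With representatives over the same point of `Q`, the dividing arrow is the quotient of the
    -- arrow components.
    obtain ⟨w', h1, rfl⟩ := exists_rep p' (point φ Q w) h
    have hs : Δ.src (arrow φ Q w) = Δ.src (arrow φ Q w') := by
      rw [src_arrow, src_arrow, h1]
    refine ⟨Δ.mul (Δ.inv (arrow φ Q w)) (arrow φ Q w') ((Δ.tgt_inv _).trans hs),
      ⟨(Δ.src_inv _).symm.trans (Δ.src_mul _ _ _).symm, ?_⟩, ?_⟩
    · refine (act_mk _ _ _).trans ?_
      exact congrArg _ (FiberProd.ext (Δ.mul_inv_cancel_left _ _ _ _) h1.symm)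
    · rintro γ ⟨e, he⟩
      rw [act_mk] at he
      obtain rfl := mk_injective_of_point_eq he h1.symm
      exact (Δ.inv_mul_cancel_left _ _ _ _).symm
  division_smooth T p p' δ e h := by
    refine Smooth.of_local fun t => ?_
    obtain ⟨V, hV, g, hg⟩ := exists_local_rep p t
    obtain ⟨V', hV', g', hg'⟩ := exists_local_rep (p'.comp (T.incl V)) (Mfd.mkPt t hV)
    have hpr : ∀ v : (T.restrict V).restrict V', Q.str.proj (point φ Q (g (Mfd.val v))) =
        Q.str.proj (point φ Q (g' v)) := fun v => by
      have h1 : proj φ Q (p' (Mfd.val (Mfd.val v))) = proj φ Q (p (Mfd.val (Mfd.val v))) := by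
        obtain ⟨w, hw⟩ := mk_surjective φ Q (p (Mfd.val (Mfd.val v)))
        rw [← h]
        simp only [← hw, act_mk]
        rfl
      have h2 := hg' v
      change p' (Mfd.val (Mfd.val v)) = _ at h2
      rw [h2, hg] at h1
      exact h1.symm
    let γ : SmoothMap ((T.restrict V).restrict V') Γ.arr := Q.str.divMap
      ((point φ Q).comp (g.comp ((T.restrict V).incl V'))) ((point φ Q).comp g') hpr
    have e1 : ∀ v, Δ.tgt ((φ.onArr.comp γ) v) = Δ.src (((arrow φ Q).comp g') v) := fun v =>
      (φ.tgt_comm _).trans ((congrArg φ.onObj (Q.str.tgt_div _ _ (hpr v))).trans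
        (src_arrow (g' v)).symm)
    -- `δ'` is the arrow component of `p'` after its representative is moved to the point of `g`;
    -- then `δ` is locally `arrow(g)⁻¹ δ'`.
    let δ' := Δ.mulMap (φ.onArr.comp γ) ((arrow φ Q).comp g') e1
    have e2 : ∀ v, Δ.src (arrow φ Q (g (Mfd.val v))) = Δ.src (δ' v) := fun v =>
      (src_arrow _).trans ((congrArg φ.onObj (Q.str.src_div _ _ (hpr v))).trans
        ((φ.src_comm _).symm.trans (Δ.src_mul _ _ _).symm))
    let d : SmoothMap ((T.restrict V).restrict V') Δ.arr :=
      Δ.mulMap (Δ.inv.comp ((arrow φ Q).comp (g.comp ((T.restrict V).incl V')))) δ'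
        fun v => (Δ.tgt_inv _).trans (e2 v)
    have key : ∀ x, δ (Mfd.val (Mfd.val x)) = d x := by
      intro x
      have h0 := h (Mfd.val (Mfd.val x))
      have he := e (Mfd.val (Mfd.val x))
      have h3 := hg' x
      change p' (Mfd.val (Mfd.val x)) = _ at h3
      rw [h3] at h0
      have h5 := hg (Mfd.val x)
      simp only [h5, act_mk] at h0
      let w : Pairs φ Q := FiberProd.mk _ _ (δ' x) (point φ Q (g (Mfd.val x)))
        ((e2 x).symm.trans (src_arrow _))
      have h6 : mk φ Q (g' x) = mk φ Q w := ((mk_eq_mk (w := w) (w' := g' x)).2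
        ⟨γ x, Q.str.src_div _ _ (hpr x), e1 x, (Q.str.act_div _ _ (hpr x)).symm, rfl⟩).symm
      have h7 := mk_injective_of_point_eq (h0.trans h6) rfl
      have h8 : Δ.mul (arrow φ Q (g (Mfd.val x))) (δ (Mfd.val (Mfd.val x)))
          (by rw [← he, h5, anchor_mk]) = δ' x := congrArg (arrow φ Q) h7
      exact ((Δ.mul_congr rfl h8.symm _ ((Δ.tgt_inv _).trans (Δ.src_mul _ _ _).symm)).trans
        (Δ.inv_mul_cancel_left _ _ _ _)).symm
    obtain ⟨V'', hV'', j, hj⟩ := Mfd.exists_restrict_restrict V' hV'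
    refine ⟨V'', hV'', d.comp j, fun v => ?_⟩
    rw [← hj v]
    exact key (j v)

end Induced

end DiffStack

/-! ### The equivalence of stacks given by a Morita morphism. -/

namespace DiffStack

open Topology TopologicalSpace

/-! ### Equivariant maps along morphisms of groupoids -/

/-- The identity morphism. -/
def LieGroupoidHom.id {M : Mfd.{u}} (Γ : LieGroupoid M) : LieGroupoidHom Γ Γ where
  onObj := ⟨fun m => m, Smooth.id _⟩
  onArr := ⟨fun m => m, Smooth.id _⟩
  src_comm _ := rfl
  tgt_comm _ := rfl
  map_mul _ _ _ := rfl

/-- A map from a `Γ`-torsor to a `Δ`-torsor, equivariant along `φ : Γ → Δ`. -/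
structure EquivMap {M N : Mfd.{u}} {Γ : LieGroupoid M} {Δ : LieGroupoid N}
    (φ : LieGroupoidHom Γ Δ) (P : Torsor Γ) (Q : Torsor Δ) where
  base : SmoothMap P.base Q.base
  total : SmoothMap P.total Q.total
  proj_comm : ∀ p, Q.str.proj (total p) = base (P.str.proj p)
  anchor_comm : ∀ p, Q.str.anchor (total p) = φ.onObj (P.str.anchor p)
  equivariant : ∀ p γ e, total (P.str.act p γ e) = Q.str.act (total p) (φ.onArr γ)
    ((anchor_comm p).trans ((congrArg φ.onObj e).trans (φ.src_comm γ).symm))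

section

variable {M N K : Mfd.{u}} {Γ : LieGroupoid M} {Δ : LieGroupoid N} {Θ : LieGroupoid K}
  {φ : LieGroupoidHom Γ Δ} {ψ : LieGroupoidHom Δ Θ} {θ : LieGroupoidHom Γ Θ}

/-- A morphism of torsors is an equivariant map along the identity. -/
def EquivMap.ofHom {P Q : Torsor Γ} (f : Torsor.Hom P Q) : EquivMap (LieGroupoidHom.id Γ) P Q :=
  ⟨f.base, f.total, f.proj_comm, f.anchor_comm, f.equivariant⟩

/-- An equivariant map along the identity is a morphism of torsors. -/
def EquivMap.toHom {P Q : Torsor Γ} (f : EquivMap (LieGroupoidHom.id Γ) P Q) : Torsor.Hom P Q :=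
  ⟨f.base, f.total, f.proj_comm, f.anchor_comm, f.equivariant⟩

/-- Composition of equivariant maps. -/
def EquivMap.comp {P : Torsor Γ} {Q : Torsor Δ} {R : Torsor Θ} (g : EquivMap ψ Q R)
    (f : EquivMap φ P Q) (h₀ : ∀ m, θ.onObj m = ψ.onObj (φ.onObj m))
    (h₁ : ∀ γ, θ.onArr γ = ψ.onArr (φ.onArr γ)) : EquivMap θ P R where
  base := g.base.comp f.base
  total := g.total.comp f.total
  proj_comm p := (g.proj_comm _).trans (congrArg g.base (f.proj_comm p))
  anchor_comm p := (g.anchor_comm _).trans ((congrArg ψ.onObj (f.anchor_comm p)).trans (h₀ _).symm)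
  equivariant p γ e := by
    refine (congrArg g.total (f.equivariant p γ e)).trans ((g.equivariant _ _ _).trans ?_)
    exact R.str.act_congr rfl (h₁ γ).symm _ _

/-- The torsor induced along `φ`. -/
noncomputable def ind (φ : LieGroupoidHom Γ Δ) (Q : Torsor Γ) : Torsor Δ :=
  ⟨Q.base, Induced.total φ Q, Induced.str φ Q⟩

/-- The pair `(1, q)`. -/
noncomputable def Induced.unit (φ : LieGroupoidHom Γ Δ) (Q : Torsor Γ) :
    SmoothMap Q.total (Induced.Pairs φ Q) :=
  FiberProd.lift _ _ (Δ.one.comp (φ.onObj.comp Q.str.anchor)) ⟨fun q => q, Smooth.id _⟩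
    fun _ => Δ.src_one _

/-- The universal equivariant map. -/
noncomputable def toInd (φ : LieGroupoidHom Γ Δ) (Q : Torsor Γ) : EquivMap φ Q (ind φ Q) where
  base := ⟨fun s => s, Smooth.id _⟩
  total := (Induced.mk φ Q).comp (Induced.unit φ Q)
  proj_comm _ := rfl
  anchor_comm _ := Δ.tgt_one _
  equivariant q γ e := by
    refine Eq.trans ?_ (Induced.act_mk (Induced.unit φ Q q) (φ.onArr γ) ((Δ.tgt_one _).trans
      ((congrArg φ.onObj e).trans (φ.src_comm γ).symm))).symm
    refine (Induced.mk_eq_mk.2 ⟨γ, e, ?_, rfl, ?_⟩).symm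
    · change Δ.tgt (φ.onArr γ) = Δ.src (Δ.one (φ.onObj (Q.str.anchor (Q.str.act q γ e))))
      rw [Δ.src_one, φ.tgt_comm, Q.str.anchor_act]
    · refine (Δ.one_mul' _ _ _).trans (Δ.mul_one' _ _ _).symm

theorem ind_mk_eq (Q : Torsor Γ) (w : Induced.Pairs φ Q) :
    Induced.mk φ Q w = (ind φ Q).str.act ((toInd φ Q).total (Induced.point φ Q w))
      (Induced.arrow φ Q w) ((Δ.tgt_one _).trans (Induced.src_arrow w).symm) := by
  refine Eq.trans ?_ (Induced.act_mk (Induced.unit φ Q (Induced.point φ Q w)) _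
    ((Δ.tgt_one _).trans (Induced.src_arrow w).symm)).symm
  exact congrArg _ (FiberProd.ext (Δ.one_mul' _ _ _).symm rfl)

/-- Every point of the induced torsor is a translate of a point of the original one. -/
theorem ind_exists_eq {Q : Torsor Γ} (p : (ind φ Q).total) :
    ∃ (q : Q.total) (δ : Δ.arr) (e : (ind φ Q).str.anchor ((toInd φ Q).total q) = Δ.src δ),
      p = (ind φ Q).str.act ((toInd φ Q).total q) δ e := by
  obtain ⟨w, rfl⟩ := Induced.mk_surjective φ Q p
  exact ⟨_, _, _, ind_mk_eq Q w⟩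

/-- Equivariant maps out of the induced torsor. -/
noncomputable def indDesc {Q : Torsor Γ} {P : Torsor Θ} (g : EquivMap θ Q P)
    (h₀ : ∀ m, θ.onObj m = ψ.onObj (φ.onObj m))
    (h₁ : ∀ γ, θ.onArr γ = ψ.onArr (φ.onArr γ)) : EquivMap ψ (ind φ Q) P :=
  have e : ∀ w : Induced.Pairs φ Q, P.str.anchor (g.total (Induced.point φ Q w)) =
      Θ.src (ψ.onArr (Induced.arrow φ Q w)) := fun w => by
    rw [g.anchor_comm, ψ.src_comm, Induced.src_arrow, h₀]
  { base := g.base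
    total :=
      { toFun := Quotient.lift (fun w => P.str.act (g.total (Induced.point φ Q w))
          (ψ.onArr (Induced.arrow φ Q w)) (e w)) (by
          rintro w w' ⟨γ, f, f', h1, h2⟩
          have h3 : Θ.tgt (θ.onArr γ) = Θ.src (ψ.onArr (Induced.arrow φ Q w')) := by
            rw [ψ.src_comm, ← f', h₁, ψ.tgt_comm]
          have h4 : ψ.onArr (Induced.arrow φ Q w) =
              Θ.mul (θ.onArr γ) (ψ.onArr (Induced.arrow φ Q w')) h3 := by
            rw [h2, ψ.map_mul]
            exact Θ.mul_congr (h₁ γ).symm rfl _ _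
          simp only [h1, h4, g.equivariant]
          rw [P.str.act_mul _ _ _ _ h3])
        smooth := Induced.smooth_of_comp_mk (P.str.act_smooth _
          (g.total.comp (Induced.point φ Q)) (ψ.onArr.comp (Induced.arrow φ Q)) e) }
    proj_comm := fun p => by
      obtain ⟨w, rfl⟩ := Induced.mk_surjective φ Q p
      exact (P.str.proj_act _ _ _).trans (g.proj_comm _)
    anchor_comm := fun p => by
      obtain ⟨w, rfl⟩ := Induced.mk_surjective φ Q p
      exact (P.str.anchor_act _ _ _).trans (ψ.tgt_comm _)
    equivariant := fun p δ f => by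
      obtain ⟨w, rfl⟩ := Induced.mk_surjective φ Q p
      have f' : Δ.tgt (Induced.arrow φ Q w) = Δ.src δ := f
      have h1 : Θ.tgt (ψ.onArr (Induced.arrow φ Q w)) = Θ.src (ψ.onArr δ) := by
        rw [ψ.tgt_comm, ψ.src_comm, f']
      refine (congrArg _ (Induced.act_mk w δ f)).trans ?_
      refine Eq.trans ?_ (P.str.act_mul (g.total (Induced.point φ Q w)) _ _ (e w) h1).symm
      exact P.str.act_congr rfl (ψ.map_mul _ _ f') _ _ }

@[simp] theorem indDesc_toInd {Q : Torsor Γ} {P : Torsor Θ} (g : EquivMap θ Q P)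
    (h₀ : ∀ m, θ.onObj m = ψ.onObj (φ.onObj m))
    (h₁ : ∀ γ, θ.onArr γ = ψ.onArr (φ.onArr γ)) (q : Q.total) :
    (indDesc g h₀ h₁).total ((toInd φ Q).total q) = g.total q := by
  change P.str.act (g.total q) (ψ.onArr (Δ.one (φ.onObj (Q.str.anchor q)))) _ = _
  simp only [ψ.map_one, P.str.act_one']

theorem ind_hom_ext {Q : Torsor Γ} {P : Torsor Δ} {f g : Torsor.Hom (ind φ Q) P}
    (h : ∀ q, f.total ((toInd φ Q).total q) = g.total ((toInd φ Q).total q)) : f = g := by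
  refine Torsor.hom_ext fun p => ?_
  obtain ⟨q, δ, e, rfl⟩ := ind_exists_eq p
  rw [f.equivariant, g.equivariant]
  simp only [h]

/-- The functor `P ↦ ind φ P` on morphisms. -/
noncomputable def indMap (φ : LieGroupoidHom Γ Δ) {P Q : Torsor Γ} (f : Torsor.Hom P Q) :
    Torsor.Hom (ind φ P) (ind φ Q) :=
  (indDesc (ψ := LieGroupoidHom.id Δ) (θ := φ) ((toInd φ Q).comp (θ := φ) (EquivMap.ofHom f)
    (fun _ => rfl) fun _ => rfl) (fun _ => rfl) fun _ => rfl).toHom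

@[simp] theorem indMap_toInd {P Q : Torsor Γ} (f : Torsor.Hom P Q) (p : P.total) :
    (indMap φ f).total ((toInd φ P).total p) = (toInd φ Q).total (f.total p) :=
  indDesc_toInd (φ := φ) (ψ := LieGroupoidHom.id Δ) (θ := φ) ((toInd φ Q).comp (θ := φ)
    (EquivMap.ofHom f) (fun _ => rfl) fun _ => rfl) (fun _ => rfl) (fun _ => rfl) p

/-- The morphism of stacks induced by a morphism of groupoids. -/
noncomputable def push (φ : LieGroupoidHom Γ Δ) : BasedFunctor (stack Γ) (stack Δ) where
  obj := ind φ
  map := indMap φ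
  map_id _ := ind_hom_ext fun _ => indMap_toInd _ _
  map_comp f g := ind_hom_ext fun p => (indMap_toInd _ _).trans
    ((congrArg (indMap φ g).total (indMap_toInd f p)).trans
      (indMap_toInd g (Torsor.Hom.total f p))).symm
  w := rfl

/-! ### Morita morphisms induce isomorphisms of stacks -/

/-- The cartesian property, tested on families over the one-point manifold. -/
theorem LieGroupoidHom.IsMorita.existsUnique_arrow (hφ : φ.IsMorita) (m m' : M) (δ : Δ.arr)
    (h : Δ.src δ = φ.onObj m) (h' : Δ.tgt δ = φ.onObj m') :
    ∃! γ : Γ.arr, Γ.src γ = m ∧ Γ.tgt γ = m' ∧ φ.onArr γ = δ := by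
  obtain ⟨z, ⟨h1, h2, h3⟩, hz⟩ := hφ.cartesian Mfd.pt (SmoothMap.const m) (SmoothMap.const m')
    (SmoothMap.const δ) (fun _ => h) fun _ => h'
  refine ⟨z Mfd.star, ⟨h1 _, h2 _, h3 _⟩, ?_⟩
  rintro γ ⟨h4, h5, h6⟩
  have := hz (SmoothMap.const γ) ⟨fun _ => h4, fun _ => h5, fun _ => h6⟩
  rw [← this]
  rfl

/-- The restriction of a torsor along a Morita morphism. -/
noncomputable def pullTorsor (hφ : φ.IsMorita) (Q : Torsor Δ) : Torsor Γ where
  base := Q.base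
  total := Mfd.fiberProd hφ.surjectiveSubmersion.2 Q.str.anchor
  str :=
    have key : ∀ (p : Mfd.fiberProd hφ.surjectiveSubmersion.2 Q.str.anchor) (γ : Γ.arr),
        FiberProd.fst _ _ p = Γ.src γ → Q.str.anchor (FiberProd.snd _ _ p) =
          Δ.src (φ.onArr γ) := fun p γ e =>
      (FiberProd.comm p).symm.trans ((congrArg φ.onObj e).trans (φ.src_comm γ).symm)
    { proj := Q.str.proj.comp (FiberProd.snd _ _)
      anchor := FiberProd.fst _ _
      proj_submersion := Q.str.proj_submersion.comp
        ⟨FiberProd.surjective_snd _ _ hφ.surjectiveSubmersion.1, FiberProd.isSubmersion_snd _ _⟩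
      act := fun p γ e => FiberProd.mk _ _ (Γ.tgt γ) (Q.str.act (FiberProd.snd _ _ p) (φ.onArr γ)
        (key p γ e)) ((φ.tgt_comm γ).symm.trans (Q.str.anchor_act _ _ _).symm)
      act_smooth := fun T p γ e => FiberProd.smooth_mk (Γ.tgt.smooth.comp γ.smooth)
        (Q.str.act_smooth T ((FiberProd.snd _ _).comp p) (φ.onArr.comp γ)
          fun x => key (p x) (γ x) (e x)) _
      anchor_act := fun p γ e => rfl
      act_one := fun p => FiberProd.ext (Γ.tgt_one _)
        ((Q.str.act_congr rfl (φ.map_one _) _ ((FiberProd.comm p).symm.trans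
          (Δ.src_one _).symm)).trans (Q.str.act_one' _ _ _))
      act_mul := fun p γ δ e e' => by
        have h1 : Δ.tgt (φ.onArr γ) = Δ.src (φ.onArr δ) := by rw [φ.tgt_comm, φ.src_comm, e']
        refine FiberProd.ext (Γ.tgt_mul _ _ _).symm ?_
        refine (Q.str.act_mul _ _ _ (key p γ e) h1).trans ?_
        exact Q.str.act_congr rfl (φ.map_mul _ _ e').symm _ _
      proj_act := fun p γ e => Q.str.proj_act _ _ _
      simply_transitive := fun p p' h => by
        have hs := Q.str.src_div (FiberProd.snd _ _ p) (FiberProd.snd _ _ p') h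
        have ht := Q.str.tgt_div (FiberProd.snd _ _ p) (FiberProd.snd _ _ p') h
        obtain ⟨γ, ⟨h1, h2, h3⟩, h4⟩ := hφ.existsUnique_arrow (FiberProd.fst _ _ p)
          (FiberProd.fst _ _ p') _ (hs.symm.trans (FiberProd.comm p).symm)
          (ht.trans (FiberProd.comm p').symm)
        refine ⟨γ, ⟨h1.symm, FiberProd.ext h2 ?_⟩, ?_⟩
        · exact (Q.str.act_congr rfl h3 _ hs).trans (Q.str.act_div _ _ h)
        · rintro γ' ⟨e, rfl⟩
          exact h4 γ' ⟨e.symm, rfl, (Q.str.div_eq h (key p γ' e) rfl).symm⟩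
      division_smooth := fun T p p' γ e h => by
        have hp : ∀ x, Q.str.proj (((FiberProd.snd _ _).comp p) x) =
            Q.str.proj (((FiberProd.snd _ _).comp p') x) := fun x =>
          (Q.str.proj_act _ _ _).symm.trans (congrArg (fun y => Q.str.proj (FiberProd.snd _ _ y)) (h x))
        -- The cartesian property over `T` lifts the smooth quotient in `Q` to a smooth family `z`,
        -- and uniqueness at each point forces `γ = z`.
        obtain ⟨z, ⟨h1, h2, h3⟩, -⟩ := hφ.cartesian T ((FiberProd.fst _ _).comp p)
          ((FiberProd.fst _ _).comp p') (Q.str.divMap _ _ hp)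
          (fun x => (Q.str.src_div _ _ (hp x)).symm.trans (FiberProd.comm (p x)).symm)
          (fun x => (Q.str.tgt_div _ _ (hp x)).trans (FiberProd.comm (p' x)).symm)
        have : γ = z := by
          ext x
          have hd : Q.str.div _ _ (hp x) = φ.onArr (γ x) :=
            Q.str.div_eq (hp x) (key (p x) (γ x) (e x)) (congrArg (FiberProd.snd _ _) (h x))
          refine (hφ.existsUnique_arrow (FiberProd.fst _ _ (p x)) (FiberProd.fst _ _ (p' x))
            (Q.str.div _ _ (hp x)) ((Q.str.src_div _ _ (hp x)).symm.trans (FiberProd.comm (p x)).symm)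
            ((Q.str.tgt_div _ _ (hp x)).trans (FiberProd.comm (p' x)).symm)).unique
            ⟨(e x).symm, congrArg (FiberProd.fst _ _) (h x), hd.symm⟩ ⟨h1 x, h2 x, h3 x⟩
        rw [this]
        exact z.smooth }

/-- The projection of the restricted torsor is equivariant. -/
noncomputable def fromPull (hφ : φ.IsMorita) (Q : Torsor Δ) : EquivMap φ (pullTorsor hφ Q) Q where
  base := ⟨fun s => s, Smooth.id _⟩
  total := FiberProd.snd _ _
  proj_comm _ := rfl
  anchor_comm p := (FiberProd.comm p).symm
  equivariant _ _ _ := rfl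

/-- Equivariant maps are maps to the restricted torsor. -/
noncomputable def toPull (hφ : φ.IsMorita) {P : Torsor Γ} {Q : Torsor Δ} (f : EquivMap φ P Q) :
    Torsor.Hom P (pullTorsor hφ Q) where
  base := f.base
  total := FiberProd.lift _ _ P.str.anchor f.total fun p => (f.anchor_comm p).symm
  proj_comm := f.proj_comm
  anchor_comm _ := rfl
  equivariant p γ e := FiberProd.ext (P.str.anchor_act _ _ _) (f.equivariant p γ e)

theorem pull_hom_ext (hφ : φ.IsMorita) {P : Torsor Γ} {Q : Torsor Δ}
    {f g : Torsor.Hom P (pullTorsor hφ Q)}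
    (h : ∀ p, (fromPull hφ Q).total (f.total p) = (fromPull hφ Q).total (g.total p)) : f = g :=
  Torsor.hom_ext fun p => FiberProd.ext ((f.anchor_comm p).trans (g.anchor_comm p).symm) (h p)

/-- The functor `Q ↦ pullTorsor hφ Q`. -/
noncomputable def pull (hφ : φ.IsMorita) : BasedFunctor (stack Δ) (stack Γ) where
  obj := pullTorsor hφ
  map {P _} f := toPull hφ ((EquivMap.ofHom f).comp (θ := φ) (fromPull hφ P) (fun _ => rfl)
    fun _ => rfl)
  map_id _ := pull_hom_ext hφ fun _ => rfl
  map_comp _ _ := pull_hom_ext hφ fun _ => rfl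
  w := rfl

/-- The torsor induced from the restriction. -/
noncomputable def fromIndPull (hφ : φ.IsMorita) (Q : Torsor Δ) :
    Torsor.Hom (ind φ (pullTorsor hφ Q)) Q :=
  (indDesc (ψ := LieGroupoidHom.id Δ) (fromPull hφ Q) (fun _ => rfl) fun _ => rfl).toHom

theorem fromIndPull_toInd (hφ : φ.IsMorita) (Q : Torsor Δ) (p : (pullTorsor hφ Q).total) :
    (fromIndPull hφ Q).total ((toInd φ _).total p) = (fromPull hφ Q).total p :=
  indDesc_toInd (φ := φ) (ψ := LieGroupoidHom.id Δ) (θ := φ) (fromPull hφ Q) (fun _ => rfl)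
    (fun _ => rfl) p

/-- A family of morphisms of torsors over the identity of the base is a based isomorphism. -/
noncomputable def basedNatIso {F G : BasedFunctor (stack Γ) (stack Δ)}
    (α : ∀ P, F.obj P ⟶ G.obj P) (hα : ∀ P, IsIso (α P))
    (hn : ∀ {P Q : Torsor Γ} (f : P ⟶ Q), F.map f ≫ α Q = α P ≫ G.map f)
    (hl : ∀ P, (stack Δ).p.IsHomLift (𝟙 ((stack Γ).p.obj P)) (α P)) : F ≅ G :=
  BasedNatIso.mkNatIso (NatIso.ofComponents (fun P => @asIso _ _ _ _ (α P) (hα P)) fun f => hn f)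
    fun P => hl P

/-- A Morita morphism induces an isomorphism of stacks. -/
noncomputable def moritaIso (hφ : φ.IsMorita) : StackIso (stack Γ) (stack Δ) where
  hom := push φ
  inv := pull hφ
  -- Morphisms `ind φ P ⟶ Q` and `P ⟶ pullTorsor hφ Q` both encode equivariant maps from `P` to `Q`
  -- along `φ`. The resulting unit and counit cover identities of bases, so they are invertible by
  -- `Torsor.Hom.isIso`.
  unit := (basedNatIso (F := BasedFunctor.id (stack Γ)) (G := BasedFunctor.comp (push φ) (pull hφ))
    (fun P => toPull hφ (toInd φ P))
    (fun _ => Torsor.Hom.isIso _ ⟨fun s => s, Smooth.id _⟩ (fun _ => rfl) fun _ => rfl)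
    (fun f => pull_hom_ext hφ fun p => (indMap_toInd (φ := φ) f p).symm)
    (fun P => Functor.IsHomLift.map (p := (stack Γ).p) (toPull hφ (toInd φ P)))).symm
  counit := basedNatIso (F := BasedFunctor.comp (pull hφ) (push φ)) (G := BasedFunctor.id (stack Δ))
    (fun Q => fromIndPull hφ Q)
    (fun _ => Torsor.Hom.isIso _ ⟨fun s => s, Smooth.id _⟩ (fun _ => rfl) fun _ => rfl)
    (fun {P Q} f => ind_hom_ext fun p =>
      (congrArg (fromIndPull hφ Q).total (indMap_toInd (φ := φ) ((pull hφ).map f) p)).trans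
        ((fromIndPull_toInd hφ Q _).trans
          (congrArg (Torsor.Hom.total f) (fromIndPull_toInd hφ P p)).symm))
    (fun Q => Functor.IsHomLift.map (p := (stack Δ).p) (fromIndPull hφ Q))

end

end DiffStack

/-! ### The circle action on torsors and the gerbe of a central extension. -/

namespace DiffStack

open Topology TopologicalSpace

/-! ### Descent of maps along surjective submersions -/

section Descent

variable {M : Mfd.{u}} {S : Mfd.{v}} {N : Mfd.{w}} {f : SmoothMap M S}

/-- A map which is constant on the fibres of a surjective submersion descends. -/
noncomputable def IsSurjectiveSubmersion.desc (hf : IsSurjectiveSubmersion f) (a : SmoothMap M N)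
    (h : ∀ x y, f x = f y → a x = a y) : SmoothMap S N where
  toFun s := a (hf.1 s).choose
  smooth := Smooth.of_local fun s => by
    obtain ⟨V, hV, σ, hσ⟩ := hf.exists_local_lift ⟨fun x => x, Smooth.id S⟩ s
    exact ⟨V, hV, a.comp σ, fun v => h _ _ ((hf.1 _).choose_spec.trans (hσ v).symm)⟩

theorem IsSurjectiveSubmersion.desc_apply (hf : IsSurjectiveSubmersion f) (a : SmoothMap M N)
    (h : ∀ x y, f x = f y → a x = a y) (x : M) : hf.desc a h (f x) = a x :=
  h _ _ (hf.1 _).choose_spec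

end Descent

namespace CentralExtension

variable {M : Mfd.{u}} {X : LieGroupoid M} (E : CentralExtension X)

/-! ### The central circle -/

/-- The projection of a central extension as a morphism of groupoids. -/
def toHom : LieGroupoidHom E.grpd X where
  onObj := ⟨fun m => m, Smooth.id _⟩
  onArr := E.π
  src_comm := E.src_π
  tgt_comm := E.tgt_π
  map_mul := E.π_mul

theorem π_one (m : M) : E.π (E.grpd.one m) = X.one m := E.toHom.map_one m

theorem smul_mul (a : Circle) (r r' : E.grpd.arr) (e : E.grpd.tgt r = E.grpd.src r')
    (e' : E.grpd.tgt (E.smul a r) = E.grpd.src r') :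
    E.grpd.mul (E.smul a r) r' e' = E.smul a (E.grpd.mul r r' e) := by
  have h := E.smul_mul_smul a 1 r r' e (by rw [E.one_smul]; exact e')
  simpa only [E.one_smul, _root_.mul_one] using h

theorem mul_smul_right (a : Circle) (r r' : E.grpd.arr) (e : E.grpd.tgt r = E.grpd.src r')
    (e' : E.grpd.tgt r = E.grpd.src (E.smul a r')) :
    E.grpd.mul r (E.smul a r') e' = E.smul a (E.grpd.mul r r' e) := by
  have h := E.smul_mul_smul 1 a r r' e (by rw [E.one_smul]; exact e')
  simpa only [E.one_smul, _root_.one_mul] using h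

theorem smul_one_mul (a : Circle) (m : M) (r : E.grpd.arr)
    (e : E.grpd.tgt (E.smul a (E.grpd.one m)) = E.grpd.src r) :
    E.grpd.mul (E.smul a (E.grpd.one m)) r e = E.smul a r := by
  rw [E.smul_mul a _ r ((E.tgt_smul _ _).symm.trans e), E.grpd.one_mul']

theorem mul_smul_one (a : Circle) (m : M) (r : E.grpd.arr)
    (e : E.grpd.tgt r = E.grpd.src (E.smul a (E.grpd.one m))) :
    E.grpd.mul r (E.smul a (E.grpd.one m)) e = E.smul a r := by
  rw [E.mul_smul_right a r _ (e.trans (E.src_smul _ _)), E.grpd.mul_one']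

theorem smul_left_injective (r : E.grpd.arr) {a b : Circle} (h : E.smul a r = E.smul b r) : a = b :=
  (E.simply_transitive r (E.smul b r) (E.π_smul b r).symm).unique h rfl

theorem exists_smul_one {r : E.grpd.arr} {m : M} (h : E.π r = X.one m) :
    ∃ a, r = E.smul a (E.grpd.one m) := by
  obtain ⟨a, ha, -⟩ := E.simply_transitive (E.grpd.one m) r ((E.π_one m).trans h.symm)
  exact ⟨a, ha.symm⟩

/-- The inverted scalar matters later: a left action recorded as a right action uses inverses of
arrows. -/
theorem inv_smul (a : Circle) (r : E.grpd.arr) :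
    E.grpd.inv (E.smul a r) = E.smul a⁻¹ (E.grpd.inv r) := by
  have e : E.grpd.tgt (E.smul a r) = E.grpd.src (E.smul a⁻¹ (E.grpd.inv r)) := by
    rw [E.tgt_smul, E.src_smul, E.grpd.src_inv]
  refine (E.grpd.eq_inv_of_mul (E.grpd.src r) (e := e) ?_).symm
  rw [E.smul_mul_smul a a⁻¹ r _ (E.grpd.src_inv r).symm, mul_inv_cancel, E.one_smul, E.grpd.mul_inv]

/-! ### The action of the circle on torsors -/

section Scale

variable {P S : Mfd.{u}} (τ : TorsorStr E.grpd P S)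

/-- The action `p ↦ p · (a · 1)` of the circle on a torsor. -/
def scale (a : Circle) (p : P) : P :=
  τ.act p (E.smul a (E.grpd.one (τ.anchor p)))
    ((E.grpd.src_one _).symm.trans (E.src_smul _ _).symm)

theorem anchor_scale (a : Circle) (p : P) : τ.anchor (E.scale τ a p) = τ.anchor p :=
  (τ.anchor_act _ _ _).trans ((E.tgt_smul _ _).trans (E.grpd.tgt_one _))

theorem proj_scale (a : Circle) (p : P) : τ.proj (E.scale τ a p) = τ.proj p := τ.proj_act _ _ _

/-- Here and in `act_scale` both sides become `p · (a γ)`; the two together express the centrality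
of the circle. -/
theorem scale_act (a : Circle) (p : P) (γ : E.grpd.arr) (e : τ.anchor p = E.grpd.src γ) :
    E.scale τ a (τ.act p γ e) =
      τ.act p (E.smul a γ) (e.trans (E.src_smul a γ).symm) := by
  have e' : E.grpd.tgt γ = E.grpd.src (E.smul a (E.grpd.one (τ.anchor (τ.act p γ e)))) := by
    rw [E.src_smul, E.grpd.src_one, τ.anchor_act]
  exact (τ.act_mul p γ _ e e').trans (τ.act_congr rfl (E.mul_smul_one a _ γ e') _ _)

theorem act_scale (a : Circle) (p : P) (γ : E.grpd.arr) (e : τ.anchor (E.scale τ a p) = E.grpd.src γ)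
    (e' : τ.anchor p = E.grpd.src γ) :
    τ.act (E.scale τ a p) γ e = τ.act p (E.smul a γ) (e'.trans (E.src_smul a γ).symm) := by
  have e₁ : E.grpd.tgt (E.smul a (E.grpd.one (τ.anchor p))) = E.grpd.src γ := by
    rw [E.tgt_smul, E.grpd.tgt_one, e']
  exact (τ.act_mul p _ γ ((E.grpd.src_one _).symm.trans (E.src_smul _ _).symm) e₁).trans
    (τ.act_congr rfl (E.smul_one_mul a _ γ e₁) _ _)

theorem scale_one (p : P) : E.scale τ 1 p = p :=
  (τ.act_congr rfl (E.one_smul _) _ (E.grpd.src_one _).symm).trans (τ.act_one p)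

theorem scale_mul (a b : Circle) (p : P) : E.scale τ (a * b) p = E.scale τ a (E.scale τ b p) := by
  refine Eq.trans ?_ (E.scale_act τ a p _
    ((E.grpd.src_one _).symm.trans (E.src_smul b _).symm)).symm
  exact τ.act_congr rfl (E.mul_smul a b _) _ _

theorem scale_left_injective (p : P) {a b : Circle} (h : E.scale τ a p = E.scale τ b p) : a = b :=
  E.smul_left_injective _ (τ.act_left_cancel h)

theorem scale_smooth {T : Mfd.{u}} (l : SmoothMap T S1) (p : SmoothMap T P) :
    Smooth fun x => E.scale τ (S1.toCircle (l x)) (p x) :=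
  τ.act_smooth T p ⟨_, E.smul_smooth T l (E.grpd.one.comp (τ.anchor.comp p))⟩ _

/-- Divide first in the torsor, which gives the family of arrows `l(x) · 1`, and then in the
principal bundle `π`. -/
theorem scale_division_smooth {T : Mfd.{u}} (l : T → S1) (p p' : SmoothMap T P)
    (h : ∀ x, E.scale τ (S1.toCircle (l x)) (p x) = p' x) : Smooth l :=
  E.division_smooth T (E.grpd.one.comp (τ.anchor.comp p)) ⟨_, τ.division_smooth T p p'
    (fun x => E.smul (S1.toCircle (l x)) (E.grpd.one (τ.anchor (p x)))) _ h⟩ l fun _ => rfl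

end Scale

variable {E}

theorem total_scale {P Q : Torsor E.grpd} (f : Torsor.Hom P Q) (a : Circle) (p : P.total) :
    f.total (E.scale P.str a p) = E.scale Q.str a (f.total p) :=
  (f.equivariant _ _ _).trans (Q.str.act_congr rfl
    (congrArg (fun m => E.smul a (E.grpd.one m)) (f.anchor_comm p).symm) _ _)

variable (E)

/-- The automorphism of a torsor given by a function with values in the circle. -/
def band (P : Torsor E.grpd) (l : SmoothMap P.base S1) : Torsor.Hom P P where
  base := ⟨fun s => s, Smooth.id _⟩
  total := ⟨fun p => E.scale P.str (S1.toCircle (l (P.str.proj p))) p,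
    E.scale_smooth P.str (l.comp P.str.proj) ⟨fun p => p, Smooth.id _⟩⟩
  proj_comm p := E.proj_scale _ _ _
  anchor_comm p := E.anchor_scale _ _ _
  equivariant p γ e := by
    refine Eq.trans ?_ ((E.scale_act P.str _ p γ e).trans (E.act_scale P.str _ p γ
      ((E.anchor_scale P.str _ _).trans e) e).symm)
    change E.scale P.str (S1.toCircle (l (P.str.proj (P.str.act p γ e)))) _ = _
    rw [P.str.proj_act]

theorem band_total (P : Torsor E.grpd) (l : SmoothMap P.base S1) (p : P.total) :
    (E.band P l).total p = E.scale P.str (S1.toCircle (l (P.str.proj p))) p := rfl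

theorem toInd_scale (P : Torsor E.grpd) (a : Circle) (p : P.total) :
    (toInd E.toHom P).total (E.scale P.str a p) = (toInd E.toHom P).total p := by
  refine ((toInd E.toHom P).equivariant _ _ _).trans ?_
  have h : E.toHom.onArr (E.smul a (E.grpd.one (P.str.anchor p))) = X.one (P.str.anchor p) :=
    (E.π_smul _ _).trans (E.π_one _)
  simp only [h]
  exact (ind E.toHom P).str.act_one' _ _ _

/-- The arrow from `p` to `p'` fixes the common image, so `π` sends it to a unit and it lies in the
central circle. With `toInd_scale`, the fibres of `P → ind E.toHom P` are exactly the circle orbits.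
-/
theorem exists_scale_of_toInd_eq {P : Torsor E.grpd} {p p' : P.total}
    (h : (toInd E.toHom P).total p = (toInd E.toHom P).total p') :
    ∃ a, E.scale P.str a p = p' := by
  have hp : P.str.proj p = P.str.proj p' :=
    ((toInd E.toHom P).proj_comm p).symm.trans
      ((congrArg (ind E.toHom P).str.proj h).trans ((toInd E.toHom P).proj_comm p'))
  have h1 := (toInd E.toHom P).equivariant p _ (P.str.src_div p p' hp)
  rw [P.str.act_div, ← h] at h1
  have h2 : E.π (P.str.div p p' hp) = X.one ((ind E.toHom P).str.anchor ((toInd E.toHom P).total p)) :=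
    (ind E.toHom P).str.act_left_cancel (h1.symm.trans ((ind E.toHom P).str.act_one _).symm)
  have h3 : (ind E.toHom P).str.anchor ((toInd E.toHom P).total p) = P.str.anchor p :=
    (toInd E.toHom P).anchor_comm p
  rw [h3] at h2
  obtain ⟨a, ha⟩ := E.exists_smul_one h2
  exact ⟨a, (P.str.act_congr rfl ha.symm _ (P.str.src_div p p' hp)).trans (P.str.act_div _ _ _)⟩

theorem toInd_surjective (P : Torsor E.grpd) : Function.Surjective (toInd E.toHom P).total := by
  intro p
  obtain ⟨q, δ, e, rfl⟩ := ind_exists_eq p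
  obtain ⟨ρ, rfl⟩ := E.π_submersion.1 δ
  have e' : P.str.anchor q = E.grpd.src ρ :=
    ((toInd E.toHom P).anchor_comm q).symm.trans (e.trans (E.src_π ρ))
  exact ⟨P.str.act q ρ e', (toInd E.toHom P).equivariant q ρ e'⟩

/-- A local representative `(arrow, point)` yields a local section once its arrow is lifted along
`π`. -/
theorem toInd_submersion (P : Torsor E.grpd) :
    IsSurjectiveSubmersion (toInd E.toHom P).total := by
  refine ⟨E.toInd_surjective P, isSubmersion_of_local_sections fun x => ?_⟩
  obtain ⟨V, hV, w, hw⟩ := Induced.exists_local_rep (φ := E.toHom) (Q := P)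
    ⟨fun p => p, Smooth.id _⟩ ((toInd E.toHom P).total x)
  obtain ⟨W, hW, ρ, hρ⟩ := E.π_submersion.exists_local_lift ((Induced.arrow E.toHom P).comp w)
    (Mfd.mkPt _ hV)
  obtain ⟨V', hV', j, hj⟩ := Mfd.exists_restrict_restrict W hW
  have e : ∀ v, P.str.anchor (Induced.point E.toHom P (w (Mfd.val (j v)))) = E.grpd.src (ρ (j v)) :=
    fun v => (Induced.src_arrow (w (Mfd.val (j v)))).symm.trans
      ((congrArg X.src (hρ (j v))).symm.trans (E.src_π _))
  let q : SmoothMap ((ind E.toHom P).total.restrict V') P.total :=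
    P.str.actMap (((Induced.point E.toHom P).comp w).comp ((Mfd.incl _ W).comp j)) (ρ.comp j) e
  have hq : ∀ v, (toInd E.toHom P).total (q v) = Mfd.val v := fun v => by
    refine ((toInd E.toHom P).equivariant _ _ (e v)).trans ?_
    refine Eq.trans ?_ ((ind_mk_eq P (w (Mfd.val (j v)))).symm.trans
      ((hw _).symm.trans (hj v)))
    exact (ind E.toHom P).str.act_congr rfl (hρ (j v)) _ _
  -- The section may miss `x`, but only by a scalar; a constant rescaling makes it pass through `x`.
  obtain ⟨a, ha⟩ := E.exists_scale_of_toInd_eq (hq (Mfd.mkPt _ hV'))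
  refine ⟨V', hV', ⟨_, E.scale_smooth P.str (SmoothMap.const (M := Mfd.restrict _ V') (N := S1) a) q⟩,
    fun v => ?_, ha⟩
  exact (E.toInd_scale P a (q v)).trans (hq v)

/-! ### The associated gerbe -/

/-- An `X`-torsor pulled back to its own total space has a tautological section, so there it is
induced from the trivial torsor of the extension with the same anchor. -/
theorem isEpimorphism_push : IsEpimorphism (push E.toHom) := by
  intro (P : Torsor X)
  let r : Torsor E.grpd := Torsor.triv E.grpd P.str.anchor
  have e : ∀ x : r.total, P.str.anchor (FiberProd.snd E.grpd.src_submersion P.str.anchor x) =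
      X.src (E.π (FiberProd.fst E.grpd.src_submersion P.str.anchor x)) := fun x =>
    (FiberProd.comm x).symm.trans (E.src_π _).symm
  let g : EquivMap E.toHom r P :=
    { base := P.str.proj
      total := P.str.actMap (FiberProd.snd E.grpd.src_submersion P.str.anchor)
        (E.π.comp (FiberProd.fst E.grpd.src_submersion P.str.anchor)) e
      proj_comm := fun x => P.str.proj_act _ _ _
      anchor_comm := fun x => (P.str.anchor_act _ _ _).trans (E.tgt_π _)
      equivariant := fun x γ f => by
        have f' : X.tgt (E.π (FiberProd.fst E.grpd.src_submersion P.str.anchor x)) =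
          X.src (E.π γ) := (E.tgt_π _).trans (Eq.trans f (E.src_π γ).symm)
        refine Eq.trans ?_ (P.str.act_mul _ _ _ (e x) f').symm
        exact P.str.act_congr rfl (E.π_mul _ _ f) _ _ }
  exact ⟨r, (indDesc (ψ := LieGroupoidHom.id X) g (fun _ => rfl) fun _ => rfl).toHom,
    P.str.proj_submersion⟩

/-- Over the manifold of pairs `(q₂, q₁)` with `[q₂] = α [q₁]`, the two components are sections of
`r₁` and `r₂` with equal anchors. One trivial torsor therefore maps to both, compatibly with `α`. -/
theorem isDiagonalEpimorphism_push : IsDiagonalEpimorphism (push E.toHom) := by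
  intro (r₁ : Torsor E.grpd) (r₂ : Torsor E.grpd) (α : ind E.toHom r₁ ≅ ind E.toHom r₂)
  have h₂ := E.toInd_submersion r₂
  let g := (Torsor.Hom.total α.hom).comp (toInd E.toHom r₁).total
  let q₁ := FiberProd.snd h₂.2 g
  let q₂ := FiberProd.fst h₂.2 g
  have hq : ∀ t, r₂.str.anchor (q₂ t) = (r₁.str.anchor.comp q₁) t := fun t =>
    ((toInd E.toHom r₂).anchor_comm (q₂ t)).symm.trans
      ((congrArg (ind E.toHom r₂).str.anchor (FiberProd.comm t)).trans
        ((Torsor.Hom.anchor_comm α.hom _).trans ((toInd E.toHom r₁).anchor_comm (q₁ t))))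
  refine ⟨Torsor.triv E.grpd (r₁.str.anchor.comp q₁), Torsor.trivHom q₁ fun _ => rfl,
    Torsor.trivHom q₂ hq, ?_, ?_⟩
  · exact r₁.str.proj_submersion.comp
      ⟨FiberProd.surjective_snd _ _ h₂.1, FiberProd.isSubmersion_snd _ _⟩
  · refine ind_hom_ext fun x => ?_
    have e₁ : r₁.str.anchor (q₁ (FiberProd.snd _ _ x)) = E.grpd.src (FiberProd.fst _ _ x) :=
      (FiberProd.comm x).symm
    have h₁ : Torsor.Hom.total (indMap E.toHom (Torsor.trivHom (Γ := E.grpd) q₁ fun _ => rfl))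
        ((toInd E.toHom _).total x) = (toInd E.toHom r₁).total (r₁.str.act
          (q₁ (FiberProd.snd _ _ x)) (FiberProd.fst _ _ x) e₁) := indMap_toInd _ _
    have h₂ : Torsor.Hom.total (indMap E.toHom (Torsor.trivHom (Γ := E.grpd) q₂ hq))
        ((toInd E.toHom _).total x) = (toInd E.toHom r₂).total (r₂.str.act
          (q₂ (FiberProd.snd _ _ x)) (FiberProd.fst _ _ x) ((hq _).trans e₁)) := indMap_toInd _ _
    refine Eq.trans ?_ h₂.symm
    refine (congrArg (Torsor.Hom.total α.hom) (h₁.trans ((toInd E.toHom r₁).equivariant _ _ _))).trans ?_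
    refine (Torsor.Hom.equivariant α.hom _ _ _).trans (Eq.trans ?_
      ((toInd E.toHom r₂).equivariant _ _ _).symm)
    exact (ind E.toHom r₂).str.act_congr (FiberProd.comm (FiberProd.snd _ _ x)).symm rfl _ _

/-- An automorphism inducing the identity on `ind E.toHom P` multiplies each point `p` by a scalar
`a p`. Centrality makes `a` constant on the fibres of the projection, so it descends to the base. -/
theorem band_bijective (P : Torsor E.grpd) (b : Torsor.Hom P P)
    (hb : indMap E.toHom b = 𝟙 (ind E.toHom P)) : ∃! l, E.band P l = b := by
  have h1 : ∀ p, ∃ a, E.scale P.str a p = b.total p := fun p =>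
    E.exists_scale_of_toInd_eq (((congrArg (fun f => Torsor.Hom.total f
      ((toInd E.toHom P).total p)) hb).symm).trans (indMap_toInd b p))
  choose a ha using h1
  have hsm : Smooth (M := P.total) (N := S1) a :=
    E.scale_division_smooth P.str a ⟨fun p => p, Smooth.id _⟩ b.total ha
  have hinv : ∀ p p', P.str.proj p = P.str.proj p' → a p = a p' := by
    intro p p' h
    obtain ⟨γ, ⟨e, rfl⟩, -⟩ := P.str.simply_transitive p p' h
    refine E.scale_left_injective P.str (P.str.act p γ e) ?_
    refine Eq.trans ?_ ((b.equivariant p γ e).symm.trans (ha _).symm)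
    refine (E.scale_act P.str _ p γ e).trans ((E.act_scale P.str _ p γ
      ((E.anchor_scale P.str _ _).trans e) e).symm.trans ?_)
    exact P.str.act_congr (ha p) rfl _ _
  let l : SmoothMap P.base S1 := P.str.proj_submersion.desc ⟨a, hsm⟩ hinv
  have hl : ∀ p, l (P.str.proj p) = a p :=
    P.str.proj_submersion.desc_apply (N := S1) (SmoothMap.mk (M := P.total) (N := S1) a hsm) hinv
  refine ⟨l, Torsor.hom_ext fun p => ?_, fun l' hl' => ?_⟩
  · rw [E.band_total, hl]
    exact ha p
  · ext s
    obtain ⟨p, rfl⟩ := P.str.proj_submersion.1 s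
    refine E.scale_left_injective P.str p ?_
    rw [← E.band_total, hl', ← ha p, ← hl]

/-- The gerbe structure on the morphism of stacks induced by a central extension. -/
noncomputable def gerbeStr : S1GerbeStr (push E.toHom) where
  epi := E.isEpimorphism_push
  diag_epi := E.isDiagonalEpimorphism_push
  band := E.band
  band_mul (P : Torsor E.grpd) l m n h := Torsor.hom_ext fun p => by
    have h' : S1.toCircle (n (P.str.proj p)) =
      S1.toCircle (m (P.str.proj p)) * S1.toCircle (l (P.str.proj p)) :=
        (h (P.str.proj p)).trans (mul_comm _ _)
    refine (congrArg (fun a => E.scale P.str a p) h').trans ((E.scale_mul _ _ _ _).trans ?_)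
    exact (congrArg (fun s => E.scale P.str (S1.toCircle (m s)) _) (E.proj_scale P.str _ p)).symm
  band_natural {P Q} a l := Torsor.hom_ext fun p =>
    (total_scale a _ p).trans (congrArg (fun s => E.scale (Torsor.str Q) (S1.toCircle (l s)) _)
      (Torsor.Hom.proj_comm a p)).symm
  band_vertical P l := ind_hom_ext fun p => (indMap_toInd _ _).trans (E.toInd_scale P _ p)
  band_bijective := E.band_bijective

/-- The gerbe associated to a central extension. -/
noncomputable def associatedGerbe : E.AssociatedGerbe where
  proj := push E.toHom
  toProj P := (toInd E.toHom P).total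
  proj_toProj P x := (toInd E.toHom P).proj_comm x
  anchor_toProj P x := (toInd E.toHom P).anchor_comm x
  toProj_act P x r e := (toInd E.toHom P).equivariant x r e
  toProj_natural f x := indMap_toInd f x
  gerbe := E.gerbeStr
  band_apply _ _ _ := rfl

end CentralExtension

end DiffStack

/-! ### From equivariant Morita morphisms to isomorphisms of gerbes. -/

namespace DiffStack

open Topology TopologicalSpace

/-! ### Composition of isomorphisms of stacks and of gerbes -/

section Trans

variable {𝔛 𝔜 ℨ : BasedCategory.{u, u + 1} Mfd.{u}}

/-- Whiskering of a based isomorphism on the left. -/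
def isoWhiskerLeftBased (F : BasedFunctor 𝔛 𝔜) {G H : BasedFunctor 𝔜 ℨ} (α : G ≅ H) :
    BasedFunctor.comp F G ≅ BasedFunctor.comp F H :=
  Bicategory.whiskerLeftIso (B := BasedCategory.{u, u + 1} Mfd.{u}) F α

/-- Whiskering of a based isomorphism on the right. -/
def isoWhiskerRightBased {F G : BasedFunctor 𝔛 𝔜} (α : F ≅ G) (H : BasedFunctor 𝔜 ℨ) :
    BasedFunctor.comp F H ≅ BasedFunctor.comp G H :=
  Bicategory.whiskerRightIso (B := BasedCategory.{u, u + 1} Mfd.{u}) α H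

/-- The inverse isomorphism of stacks. -/
def StackIso.symm (F : StackIso 𝔛 𝔜) : StackIso 𝔜 𝔛 := ⟨F.inv, F.hom, F.counit, F.unit⟩

/-- Composition of isomorphisms of stacks. -/
def StackIso.trans (F : StackIso 𝔛 𝔜) (G : StackIso 𝔜 ℨ) : StackIso 𝔛 ℨ where
  hom := BasedFunctor.comp F.hom G.hom
  inv := BasedFunctor.comp G.inv F.inv
  unit := isoWhiskerLeftBased F.hom (isoWhiskerRightBased G.unit F.inv) ≪≫ F.unit
  counit := isoWhiskerLeftBased G.inv (isoWhiskerRightBased F.counit G.hom) ≪≫ G.counit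

theorem castMap_castMap {A B C : Mfd.{u}} (h : A = B) (h' : B = C) :
    (castMap h').comp (castMap h) = castMap (h.trans h') := by
  subst h h'; rfl

/-- Composition of isomorphisms of gerbes. -/
def S1GerbeIso.trans {ℜ₁ ℜ₂ ℜ₃ : BasedCategory.{u, u + 1} Mfd.{u}} {p₁ : BasedFunctor ℜ₁ 𝔛}
    {p₂ : BasedFunctor ℜ₂ 𝔜} {p₃ : BasedFunctor ℜ₃ ℨ} {𝒢₁ : S1GerbeStr p₁} {𝒢₂ : S1GerbeStr p₂}
    {𝒢₃ : S1GerbeStr p₃} {F : StackIso 𝔛 𝔜} {F' : StackIso 𝔜 ℨ} (G : S1GerbeIso 𝒢₁ 𝒢₂ F)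
    (G' : S1GerbeIso 𝒢₂ 𝒢₃ F') : S1GerbeIso 𝒢₁ 𝒢₃ (F.trans F') where
  iso := G.iso.trans G'.iso
  square := isoWhiskerLeftBased G.iso.hom G'.square ≪≫ isoWhiskerRightBased G.square F'.hom
  band_comm r l := by
    refine (congrArg (fun f => G'.iso.hom.map f) (G.band_comm r l)).trans
      ((G'.band_comm _ _).trans ?_)
    refine congrArg (𝒢₃.band _) ?_
    exact congrArg (fun c => l.comp c) (castMap_castMap _ _)

end Trans

/-! ### Functoriality of induction -/

section Push

variable {M N K : Mfd.{u}} {Γ : LieGroupoid M} {Δ : LieGroupoid N} {Θ : LieGroupoid K}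
  {φ : LieGroupoidHom Γ Δ} {ψ : LieGroupoidHom Δ Θ} {θ : LieGroupoidHom Γ Θ}

theorem ind_equivMap_ext {Q : Torsor Γ} {P : Torsor Θ} {f g : EquivMap ψ (ind φ Q) P}
    (h : ∀ q, f.total ((toInd φ Q).total q) = g.total ((toInd φ Q).total q))
    (p : (ind φ Q).total) : f.total p = g.total p := by
  obtain ⟨q, δ, e, rfl⟩ := ind_exists_eq p
  rw [f.equivariant, g.equivariant]
  simp only [h]

/-- Induction along `φ` and then along `ψ` is induction along `ψ ∘ φ`. -/
noncomputable def pushComp (h₀ : ∀ m, θ.onObj m = ψ.onObj (φ.onObj m))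
    (h₁ : ∀ γ, θ.onArr γ = ψ.onArr (φ.onArr γ)) :
    BasedFunctor.comp (push φ) (push ψ) ≅ push θ :=
  -- The comparison comes from applying the universal property of induction twice, once for `φ` and
  -- once for `ψ`.
  let β (P : Torsor Γ) : EquivMap ψ (ind φ P) (ind θ P) := indDesc (toInd θ P) h₀ h₁
  let α (P : Torsor Γ) : Torsor.Hom (ind ψ (ind φ P)) (ind θ P) :=
    (indDesc (ψ := LieGroupoidHom.id Θ) (β P) (fun _ => rfl) fun _ => rfl).toHom
  have hα (P : Torsor Γ) (p : (ind φ P).total) :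
      (α P).total ((toInd ψ (ind φ P)).total p) = (β P).total p :=
    indDesc_toInd (φ := ψ) (ψ := LieGroupoidHom.id Θ) (θ := ψ) (β P) (fun _ => rfl) (fun _ => rfl) p
  basedNatIso (F := BasedFunctor.comp (push φ) (push ψ)) (G := push θ) α
    (fun _ => Torsor.Hom.isIso _ ⟨fun s => s, Smooth.id _⟩ (fun _ => rfl) fun _ => rfl)
    (fun {P Q} f => ind_hom_ext fun p => by
      refine (congrArg (α Q).total (indMap_toInd (φ := ψ) (indMap φ f) p)).trans
        ((hα Q _).trans (Eq.trans ?_ (congrArg (indMap θ f).total (hα P p)).symm))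
      refine ind_equivMap_ext
        (f := (β Q).comp (θ := ψ) (EquivMap.ofHom (indMap φ f)) (fun _ => rfl) fun _ => rfl)
        (g := (EquivMap.ofHom (indMap θ f)).comp (θ := ψ) (β P) (fun _ => rfl) fun _ => rfl)
        (fun q => ?_) p
      refine (congrArg (β Q).total (indMap_toInd (φ := φ) f q)).trans
        ((indDesc_toInd (toInd θ Q) h₀ h₁ (Torsor.Hom.total f q)).trans (Eq.trans ?_
          (congrArg (indMap θ f).total (indDesc_toInd (toInd θ P) h₀ h₁ q)).symm))
      exact (indMap_toInd (φ := θ) f q).symm)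
    (fun P => Functor.IsHomLift.map (p := (stack Θ).p) (α P))

end Push

/-! ### Equivariant Morita morphisms -/

namespace CentralExtension

variable {M M' : Mfd.{u}} {X : LieGroupoid M} {X' : LieGroupoid M'} {E : CentralExtension X}
  {E' : CentralExtension X'} {φ : LieGroupoidHom E.grpd E'.grpd}

theorem π_onArr_eq (hs : ∀ (a : Circle) r, φ.onArr (E.smul a r) = E'.smul a (φ.onArr r))
    (r r' : E.grpd.arr) (h : E.π r = E.π r') :
    (E'.π.comp φ.onArr) r = (E'.π.comp φ.onArr) r' := by
  obtain ⟨a, rfl, -⟩ := E.simply_transitive r r' h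
  exact ((congrArg E'.π (hs a r)).trans (E'.π_smul _ _)).symm

/-- The map of arrows of the base groupoids induced by an equivariant morphism. -/
noncomputable def baseArr
    (hs : ∀ (a : Circle) r, φ.onArr (E.smul a r) = E'.smul a (φ.onArr r)) :
    SmoothMap X.arr X'.arr := E.π_submersion.desc (E'.π.comp φ.onArr) (π_onArr_eq hs)

theorem baseArr_π (hs : ∀ (a : Circle) r, φ.onArr (E.smul a r) = E'.smul a (φ.onArr r))
    (r : E.grpd.arr) : baseArr hs (E.π r) = E'.π (φ.onArr r) :=
  E.π_submersion.desc_apply (E'.π.comp φ.onArr) (π_onArr_eq hs) r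

/-- The morphism of the base groupoids induced by an equivariant morphism. -/
noncomputable def baseHom
    (hs : ∀ (a : Circle) r, φ.onArr (E.smul a r) = E'.smul a (φ.onArr r)) :
    LieGroupoidHom X X' where
  onObj := φ.onObj
  onArr := baseArr hs
  src_comm g := by
    obtain ⟨r, rfl⟩ := E.π_submersion.1 g
    rw [baseArr_π, E'.src_π, E.src_π, φ.src_comm]
  tgt_comm g := by
    obtain ⟨r, rfl⟩ := E.π_submersion.1 g
    rw [baseArr_π, E'.tgt_π, E.tgt_π, φ.tgt_comm]
  map_mul g h e := by
    obtain ⟨r, rfl⟩ := E.π_submersion.1 g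
    obtain ⟨r', rfl⟩ := E.π_submersion.1 h
    have e' : E.grpd.tgt r = E.grpd.src r' := by rw [← E.tgt_π, ← E.src_π, e]
    have h1 : X.mul (E.π r) (E.π r') e = E.π (E.grpd.mul r r' e') := (E.π_mul r r' e').symm
    simp only [h1, baseArr_π, φ.map_mul, E'.π_mul]

variable (hs : ∀ (a : Circle) r, φ.onArr (E.smul a r) = E'.smul a (φ.onArr r)) (hφ : φ.IsMorita)

include hφ in
-- The images under `φ` of lifts of `g` and `h` differ by a scalar. Absorbing it into the lift of
-- `g`, the Morita property of `φ` makes the lifts equal.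
theorem baseHom_ext {g h : X.arr} (h₁ : X.src g = X.src h) (h₂ : X.tgt g = X.tgt h)
    (h₃ : baseArr hs g = baseArr hs h) : g = h := by
  obtain ⟨r, rfl⟩ := E.π_submersion.1 g
  obtain ⟨r', rfl⟩ := E.π_submersion.1 h
  rw [baseArr_π, baseArr_π] at h₃
  rw [E.src_π, E.src_π] at h₁
  rw [E.tgt_π, E.tgt_π] at h₂
  obtain ⟨a, ha, -⟩ := E'.simply_transitive _ _ h₃
  rw [← hs] at ha
  have := (hφ.existsUnique_arrow (E.grpd.src r') (E.grpd.tgt r') (φ.onArr r') (φ.src_comm _)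
    (φ.tgt_comm _)).unique ⟨(E.src_smul a r).trans h₁, (E.tgt_smul a r).trans h₂, ha⟩
      ⟨rfl, rfl, rfl⟩
  rw [← this, E.π_smul]

include hφ in
-- Lift `y` locally along `E'.π` and apply the cartesian property of `φ`. The local solutions agree
-- by `baseHom_ext`, so they glue.
theorem baseHom_isMorita : (baseHom hs).IsMorita where
  surjectiveSubmersion := hφ.surjectiveSubmersion
  cartesian T a b y ha hb := by
    have h1 : ∀ t, ∃ (V : Opens T) (_ : t ∈ V) (z : SmoothMap (T.restrict V) X.arr), ∀ v,
        X.src (z v) = a (Mfd.val v) ∧ X.tgt (z v) = b (Mfd.val v) ∧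
          baseArr hs (z v) = y (Mfd.val v) := fun t => by
      obtain ⟨V, hV, ρ, hρ⟩ := E'.π_submersion.exists_local_lift y t
      obtain ⟨z, ⟨h1, h2, h3⟩, -⟩ := hφ.cartesian _ (a.comp (T.incl V)) (b.comp (T.incl V)) ρ
        (fun v => by rw [← E'.src_π, hρ]; exact ha _) (fun v => by rw [← E'.tgt_π, hρ]; exact hb _)
      refine ⟨V, hV, E.π.comp z, fun v => ⟨(E.src_π _).trans (h1 v), (E.tgt_π _).trans (h2 v), ?_⟩⟩
      exact (baseArr_π hs _).trans ((congrArg E'.π (h3 v)).trans (hρ v))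
    have h2 : ∀ t, ∃ g, X.src g = a t ∧ X.tgt g = b t ∧ baseArr hs g = y t := fun t => by
      obtain ⟨V, hV, z, hz⟩ := h1 t
      exact ⟨_, hz (Mfd.mkPt t hV)⟩
    choose g hg using h2
    refine ⟨⟨g, Smooth.of_local fun t => ?_⟩, ⟨fun t => (hg t).1, fun t => (hg t).2.1,
      fun t => (hg t).2.2⟩, ?_⟩
    · obtain ⟨V, hV, z, hz⟩ := h1 t
      exact ⟨V, hV, z, fun v => baseHom_ext hs hφ ((hg _).1.trans (hz v).1.symm)
        ((hg _).2.1.trans (hz v).2.1.symm) ((hg _).2.2.trans (hz v).2.2.symm)⟩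
    · rintro g' ⟨h1, h2, h3⟩
      exact SmoothMap.ext (funext fun t => baseHom_ext hs hφ ((h1 t).trans (hg t).1.symm)
        ((h2 t).trans (hg t).2.1.symm) ((h3 t).trans (hg t).2.2.symm))

include hs in
theorem onArr_smul_one (a : Circle) (m : M) :
    φ.onArr (E.smul a (E.grpd.one m)) = E'.smul a (E'.grpd.one (φ.onObj m)) := by
  rw [hs, φ.map_one]

include hs in
theorem equivMap_total_scale {P : Torsor E.grpd} {Q : Torsor E'.grpd} (f : EquivMap φ P Q)
    (a : Circle) (p : P.total) : f.total (E.scale P.str a p) = E'.scale Q.str a (f.total p) := by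
  refine (f.equivariant _ _ _).trans (Q.str.act_congr rfl ?_ _ _)
  rw [onArr_smul_one hs, f.anchor_comm]

/-- An equivariant Morita morphism induces an isomorphism of gerbes. -/
noncomputable def gerbeIso :
    S1GerbeIso E.gerbeStr E'.gerbeStr (moritaIso (baseHom_isMorita hs hφ)) where
  iso := moritaIso hφ
  square :=
    -- The morphism `θ` is `π' ∘ φ` and also `baseHom ∘ π`; both ways around the square are
    -- induction along `θ`.
    let θ : LieGroupoidHom E.grpd X' :=
      ⟨φ.onObj, E'.π.comp φ.onArr, fun g => (E'.src_π _).trans (φ.src_comm g),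
        fun g => (E'.tgt_π _).trans (φ.tgt_comm g),
        fun g h e => (congrArg E'.π (φ.map_mul g h e)).trans (E'.π_mul _ _ _)⟩
    pushComp (θ := θ) (fun _ => rfl) (fun _ => rfl) ≪≫
      (pushComp (φ := E.toHom) (ψ := baseHom hs) (θ := θ) (fun _ => rfl)
        fun γ => (baseArr_π hs γ).symm).symm
  band_comm P l := ind_hom_ext fun p => (indMap_toInd (φ := φ) (E.band P l) p).trans
    (equivMap_total_scale hs (toInd φ P) _ p)

/-- The inverse of the isomorphism of gerbes induced by an equivariant Morita morphism. -/
noncomputable def gerbeIsoSymm :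
    S1GerbeIso E'.gerbeStr E.gerbeStr (moritaIso (baseHom_isMorita hs hφ)).symm where
  iso := (moritaIso hφ).symm
  square :=
    let hX := baseHom_isMorita hs hφ
    -- For the inverse functors, the `π'`-equivariant map out of `Q` is composed with `fromPull`,
    -- descended to the induced torsor, and then turned by `toPull` into a morphism to the
    -- restricted torsor.
    let γ (Q : Torsor E'.grpd) : EquivMap (baseHom hs) (ind E.toHom (pullTorsor hφ Q))
        (ind E'.toHom Q) :=
      indDesc (θ := ⟨φ.onObj, E'.π.comp φ.onArr, fun g => (E'.src_π _).trans (φ.src_comm g),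
          fun g => (E'.tgt_π _).trans (φ.tgt_comm g),
          fun g h e => (congrArg E'.π (φ.map_mul g h e)).trans (E'.π_mul _ _ _)⟩)
        ((toInd E'.toHom Q).comp (fromPull hφ Q) (fun _ => rfl) fun _ => rfl) (fun _ => rfl)
        fun r => (baseArr_π hs r).symm
    have hγ (Q : Torsor E'.grpd) (p : (pullTorsor hφ Q).total) :
        (γ Q).total ((toInd E.toHom _).total p) =
          (toInd E'.toHom Q).total ((fromPull hφ Q).total p) := indDesc_toInd _ _ _ p
    basedNatIso (F := BasedFunctor.comp (pull hφ) (push E.toHom))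
      (G := BasedFunctor.comp (push E'.toHom) (pull hX)) (fun Q => toPull hX (γ Q))
      (fun _ => Torsor.Hom.isIso _ ⟨fun s => s, Smooth.id _⟩ (fun _ => rfl) fun _ => rfl)
      (fun {P Q} f => pull_hom_ext hX fun p => by
        refine ind_equivMap_ext
          (f := (γ Q).comp (θ := baseHom hs) (EquivMap.ofHom (indMap E.toHom ((pull hφ).map f)))
            (fun _ => rfl) fun _ => rfl)
          (g := (EquivMap.ofHom (indMap E'.toHom f)).comp (θ := baseHom hs) (γ P) (fun _ => rfl)
            fun _ => rfl) (fun q => ?_) p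
        refine (congrArg (γ Q).total (indMap_toInd (φ := E.toHom) ((pull hφ).map f) q)).trans
          ((hγ Q _).trans (Eq.trans ?_ (congrArg (indMap E'.toHom f).total (hγ P q)).symm))
        exact (indMap_toInd (φ := E'.toHom) f ((fromPull hφ P).total q)).symm)
      (fun Q => Functor.IsHomLift.map (p := (stack X).p) (toPull hX (γ Q)))
  band_comm Q l := pull_hom_ext hφ fun p =>
    (equivMap_total_scale hs (fromPull hφ Q) (S1.toCircle (l (Torsor.str Q |>.proj _))) p).symm

end CentralExtension

theorem gerbesIsomorphic_of_morita {M M' M'' : Mfd.{u}} {X : LieGroupoid M} {X' : LieGroupoid M'}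
    {X'' : LieGroupoid M''} {E : CentralExtension X} {E' : CentralExtension X'}
    {E'' : CentralExtension X''} (h' : ExistsEquivariantMoritaMorphism E'' E')
    (h : ExistsEquivariantMoritaMorphism E'' E) : GerbesIsomorphic E E' := by
  obtain ⟨φ, hφ, hs⟩ := h
  obtain ⟨φ', hφ', hs'⟩ := h'
  exact ⟨E.associatedGerbe, E'.associatedGerbe, _,
    ⟨(CentralExtension.gerbeIsoSymm hs hφ).trans (CentralExtension.gerbeIso hs' hφ')⟩⟩

end DiffStack

/-! ### From a bitorsor to a pair of equivariant Morita morphisms. -/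

namespace DiffStack

open Topology TopologicalSpace

/-! ### Pullback of groupoids along submersions -/

section Pullback

variable {Z M : Mfd.{u}} {q : SmoothMap Z M} (hq : IsSubmersion q) (Γ : LieGroupoid M)

/-- The triples `(z₁, γ, z₂)` with `γ` an arrow between the images of `z₁` and `z₂`. -/
noncomputable def pullArr : Mfd.{u} :=
  Mfd.fiberProd hq (Γ.tgt.comp (FiberProd.snd hq Γ.src))

namespace PullArr

/-- The first component. -/
noncomputable def source : SmoothMap (pullArr hq Γ) Z :=
  (FiberProd.fst hq Γ.src).comp (FiberProd.snd _ _)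

/-- The arrow. -/
noncomputable def arrow : SmoothMap (pullArr hq Γ) Γ.arr :=
  (FiberProd.snd hq Γ.src).comp (FiberProd.snd _ _)

/-- The last component. -/
noncomputable def target : SmoothMap (pullArr hq Γ) Z := FiberProd.fst _ _

variable {hq Γ}

theorem src_arrow (x : pullArr hq Γ) : Γ.src (arrow hq Γ x) = q (source hq Γ x) :=
  (FiberProd.comm (FiberProd.snd _ _ x)).symm

theorem tgt_arrow (x : pullArr hq Γ) : Γ.tgt (arrow hq Γ x) = q (target hq Γ x) :=
  (FiberProd.comm x).symm

variable (hq Γ)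

/-- The triple `(z₁, γ, z₂)`. -/
noncomputable def mk (z₁ : Z) (γ : Γ.arr) (z₂ : Z) (h₁ : Γ.src γ = q z₁) (h₂ : Γ.tgt γ = q z₂) : pullArr hq Γ :=
  FiberProd.mk _ _ z₂ (FiberProd.mk _ _ z₁ γ h₁.symm) h₂.symm

variable {hq Γ}

theorem ext {x y : pullArr hq Γ} (h₁ : source hq Γ x = source hq Γ y)
    (h₂ : arrow hq Γ x = arrow hq Γ y) (h₃ : target hq Γ x = target hq Γ y) : x = y :=
  FiberProd.ext h₃ (FiberProd.ext h₁ h₂)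

theorem smooth_mk {T : Mfd.{u}} {z₁ z₂ : T → Z} {γ : T → Γ.arr} (hz₁ : Smooth z₁) (hγ : Smooth γ)
    (hz₂ : Smooth z₂) (h₁ : ∀ t, Γ.src (γ t) = q (z₁ t)) (h₂ : ∀ t, Γ.tgt (γ t) = q (z₂ t)) :
    Smooth fun t => mk hq Γ (z₁ t) (γ t) (z₂ t) (h₁ t) (h₂ t) :=
  FiberProd.smooth_mk hz₂ (FiberProd.smooth_mk hz₁ hγ _) _

end PullArr

open PullArr

/-- The pullback of a groupoid along a submersion. -/
noncomputable def pullGroupoid : LieGroupoid Z where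
  arr := pullArr hq Γ
  src := source hq Γ
  tgt := target hq Γ
  src_submersion := (FiberProd.isSubmersion_fst hq _ Γ.src_submersion).comp
    (FiberProd.isSubmersion_snd _ _)
  tgt_submersion := FiberProd.isSubmersion_fst _ _
    (Γ.tgt_submersion.comp (FiberProd.isSubmersion_snd _ _))
  mul x y e := mk hq Γ (source hq Γ x) (Γ.mul (arrow hq Γ x) (arrow hq Γ y)
    ((tgt_arrow x).trans ((congrArg q e).trans (src_arrow y).symm))) (target hq Γ y)
    ((Γ.src_mul _ _ _).trans (src_arrow x)) ((Γ.tgt_mul _ _ _).trans (tgt_arrow y))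
  one := ⟨fun z => mk hq Γ z (Γ.one (q z)) z (Γ.src_one _) (Γ.tgt_one _),
    smooth_mk (Smooth.id _) (Γ.one.smooth.comp q.smooth) (Smooth.id _) _ _⟩
  inv := ⟨fun x => mk hq Γ (target hq Γ x) (Γ.inv (arrow hq Γ x)) (source hq Γ x)
      ((Γ.src_inv _).trans (tgt_arrow x)) ((Γ.tgt_inv _).trans (src_arrow x)),
    smooth_mk (target hq Γ).smooth (Γ.inv.smooth.comp (arrow hq Γ).smooth) (source hq Γ).smooth _ _⟩
  mul_smooth T x y e := smooth_mk ((source hq Γ).smooth.comp x.smooth)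
    (Γ.mul_smooth T ((arrow hq Γ).comp x) ((arrow hq Γ).comp y) fun t =>
      (tgt_arrow (x t)).trans ((congrArg q (e t)).trans (src_arrow (y t)).symm))
    ((target hq Γ).smooth.comp y.smooth) _ _
  src_mul _ _ _ := rfl
  tgt_mul _ _ _ := rfl
  src_one _ := rfl
  tgt_one _ := rfl
  src_inv _ := rfl
  tgt_inv _ := rfl
  mul_assoc x y z e e' := PullArr.ext rfl
    (Γ.mul_assoc (arrow hq Γ x) (arrow hq Γ y) (arrow hq Γ z)
      ((tgt_arrow x).trans ((congrArg q e).trans (src_arrow y).symm))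
      ((tgt_arrow y).trans ((congrArg q e').trans (src_arrow z).symm))) rfl
  one_mul _ := PullArr.ext rfl (Γ.one_mul' _ _ _) rfl
  mul_one _ := PullArr.ext rfl (Γ.mul_one' _ _ _) rfl
  mul_inv x := PullArr.ext rfl ((Γ.mul_inv (arrow hq Γ x)).trans (congrArg Γ.one (src_arrow x))) rfl
  inv_mul x := PullArr.ext rfl ((Γ.inv_mul (arrow hq Γ x)).trans (congrArg Γ.one (tgt_arrow x))) rfl

/-- The projection of the pullback. -/
noncomputable def fromPullGroupoid : LieGroupoidHom (pullGroupoid hq Γ) Γ where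
  onObj := q
  onArr := arrow hq Γ
  src_comm := src_arrow
  tgt_comm := tgt_arrow
  map_mul _ _ _ := rfl

theorem fromPullGroupoid_isMorita (h : Function.Surjective q) :
    (fromPullGroupoid hq Γ).IsMorita where
  surjectiveSubmersion := ⟨h, hq⟩
  cartesian T a b y ha hb := by
    refine ⟨⟨_, smooth_mk (hq := hq) a.smooth y.smooth b.smooth ha hb⟩,
      ⟨fun _ => rfl, fun _ => rfl, fun _ => rfl⟩, ?_⟩
    rintro z ⟨h₁, h₂, h₃⟩
    exact SmoothMap.ext (funext fun t => PullArr.ext (h₁ t) (h₃ t) (h₂ t))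

variable {X : LieGroupoid M} (E : CentralExtension X)

/-- The pullback of a central extension along a submersion. -/
noncomputable def pullExtension : CentralExtension (pullGroupoid hq X) where
  grpd := pullGroupoid hq E.grpd
  π := ⟨fun x => mk hq X (source hq _ x) (E.π (arrow hq _ x)) (target hq _ x)
      ((E.src_π _).trans (src_arrow x)) ((E.tgt_π _).trans (tgt_arrow x)),
    smooth_mk (source hq _).smooth (E.π.smooth.comp (arrow hq _).smooth) (target hq _).smooth _ _⟩
  src_π _ := rfl
  tgt_π _ := rfl
  π_mul x y e := PullArr.ext rfl (E.π_mul _ _ _) rfl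
  smul a x := mk hq E.grpd (source hq _ x) (E.smul a (arrow hq _ x)) (target hq _ x)
      ((E.src_smul _ _).trans (src_arrow x)) ((E.tgt_smul _ _).trans (tgt_arrow x))
  one_smul x := PullArr.ext rfl (E.one_smul _) rfl
  mul_smul a b x := PullArr.ext rfl (E.mul_smul a b _) rfl
  smul_smooth T l x := smooth_mk ((source hq _).smooth.comp x.smooth)
    (E.smul_smooth T l ((arrow hq _).comp x)) ((target hq _).smooth.comp x.smooth) _ _
  π_submersion := by
    refine ⟨fun y => ?_, isSubmersion_of_local_sections fun x => ?_⟩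
    · obtain ⟨r, hr⟩ := E.π_submersion.1 (arrow hq X y)
      exact ⟨mk hq E.grpd (source hq _ y) r (target hq _ y)
        ((E.src_π r).symm.trans ((congrArg X.src hr).trans (src_arrow y)))
        ((E.tgt_π r).symm.trans ((congrArg X.tgt hr).trans (tgt_arrow y))),
        PullArr.ext rfl hr rfl⟩
    · obtain ⟨V, hV, σ, hσ, hx⟩ := E.π_submersion.2.exists_local_lift (arrow hq X)
        (x₀ := arrow hq E.grpd x) (t₀ := mk hq X (source hq _ x) (E.π (arrow hq _ x))
        (target hq _ x) ((E.src_π _).trans (src_arrow x)) ((E.tgt_π _).trans (tgt_arrow x))) rfl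
      refine ⟨V, hV, ⟨_, smooth_mk (hq := hq) (Γ := E.grpd)
        ((source hq X).smooth.comp (Mfd.incl _ V).smooth) σ.smooth
        ((target hq X).smooth.comp (Mfd.incl _ V).smooth)
        (fun v => (E.src_π _).symm.trans ((congrArg X.src (hσ v)).trans (src_arrow _)))
        (fun v => (E.tgt_π _).symm.trans ((congrArg X.tgt (hσ v)).trans (tgt_arrow _)))⟩, fun v => ?_, ?_⟩
      · exact PullArr.ext rfl (hσ v) rfl
      · exact PullArr.ext rfl hx rfl
  π_smul a x := PullArr.ext rfl (E.π_smul a _) rfl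
  simply_transitive x y h := by
    obtain ⟨a, ha, hu⟩ := E.simply_transitive (arrow hq _ x) (arrow hq _ y)
      (congrArg (arrow hq X) h)
    exact ⟨a, PullArr.ext (congrArg (source hq X) h) ha (congrArg (target hq X) h),
      fun b hb => hu b (congrArg (arrow hq _) hb)⟩
  division_smooth T r r' l h := E.division_smooth T ((arrow hq _).comp r) ((arrow hq _).comp r') l
    fun t => congrArg (arrow hq _) (h t)
  smul_mul_smul a b x y e _ := PullArr.ext rfl (E.smul_mul_smul a b _ _
    ((tgt_arrow x).trans ((congrArg q e).trans (src_arrow y).symm)) _) rfl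

theorem existsEquivariantMoritaMorphism_pull (h : Function.Surjective q) :
    ExistsEquivariantMoritaMorphism (pullExtension hq E) E :=
  ⟨fromPullGroupoid hq E.grpd, fromPullGroupoid_isMorita hq E.grpd h, fun _ _ => rfl⟩

end Pullback

/-! ### The Morita morphisms of a bitorsor -/

namespace Bitorsor

open PullArr

variable {M M' : Mfd.{u}} {Γ : LieGroupoid M} {Γ' : LieGroupoid M'} (Z : Bitorsor Γ Γ')

theorem right_proj_leftAct (x : Γ.arr) (z : Z.total) (e : Γ.tgt x = Z.left.anchor z) :
    Z.right.proj (Z.leftAct x z e) = Γ.src x := by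
  rw [← Z.left_anchor]
  exact (Z.left.anchor_act _ _ _).trans (Γ.tgt_inv x)

theorem right_anchor_leftAct (x : Γ.arr) (z : Z.total) (e : Γ.tgt x = Z.left.anchor z) :
    Z.right.anchor (Z.leftAct x z e) = Z.left.proj z := by
  rw [Z.right_anchor]
  exact Z.left.proj_act _ _ _

theorem left_anchor_right_act (z : Z.total) (y : Γ'.arr) (e : Z.right.anchor z = Γ'.src y) :
    Z.left.anchor (Z.right.act z y e) = Z.left.anchor z := by
  rw [Z.left_anchor, Z.left_anchor, Z.right.proj_act]

theorem left_proj_right_act (z : Z.total) (y : Γ'.arr) (e : Z.right.anchor z = Γ'.src y) :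
    Z.left.proj (Z.right.act z y e) = Γ'.tgt y := by
  rw [← Z.right_anchor, Z.right.anchor_act]

theorem leftAct_mul (x y : Γ.arr) (z : Z.total) (e : Γ.tgt x = Γ.src y)
    (e' : Γ.tgt y = Z.left.anchor z) (e₁ : Γ.tgt (Γ.mul x y e) = Z.left.anchor z)
    (e₂ : Γ.tgt x = Z.left.anchor (Z.leftAct y z e')) :
    Z.leftAct (Γ.mul x y e) z e₁ = Z.leftAct x (Z.leftAct y z e') e₂ := by
  refine Eq.trans ?_ (Z.left.act_mul z (Γ.inv y) (Γ.inv x) (e'.symm.trans (Γ.src_inv y).symm)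
    ((Γ.tgt_inv y).trans (e.symm.trans (Γ.src_inv x).symm))).symm
  exact Z.left.act_congr rfl (Γ.inv_mul_rev x y e) _ _

theorem leftAct_right_act (x : Γ.arr) (z : Z.total) (y : Γ'.arr) (e : Γ.tgt x = Z.left.anchor z)
    (e' : Z.right.anchor z = Γ'.src y) (e₁ : Γ.tgt x = Z.left.anchor (Z.right.act z y e'))
    (e₂ : Z.right.anchor (Z.leftAct x z e) = Γ'.src y) :
    Z.leftAct x (Z.right.act z y e') e₁ = Z.right.act (Z.leftAct x z e) y e₂ :=
  (Z.comm z (Γ.inv x) y (e.symm.trans (Γ.src_inv x).symm) e' (e₁.symm.trans (Γ.src_inv x).symm)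
    e₂).symm

theorem tgt_arrow_eq (x : pullArr Z.right.proj_submersion.2 Γ) :
    Γ.tgt (arrow _ _ x) = Z.left.anchor (target _ _ x) :=
  (tgt_arrow x).trans (Z.left_anchor _).symm

theorem proj_source (x : pullArr Z.right.proj_submersion.2 Γ) :
    Z.right.proj (source _ _ x) = Z.right.proj (Z.leftAct (arrow _ _ x) (target _ _ x)
      (Z.tgt_arrow_eq x)) := by
  rw [Z.right_proj_leftAct, src_arrow]

/-- The action of a smooth family on the left. -/
def leftActMap {T : Mfd.{u}} (x : SmoothMap T Γ.arr) (z : SmoothMap T Z.total)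
    (e : ∀ t, Γ.tgt (x t) = Z.left.anchor (z t)) : SmoothMap T Z.total :=
  Z.left.actMap z (Γ.inv.comp x) fun t => (e t).symm.trans (Γ.src_inv _).symm

variable {Z} in
-- This is `z₁ γ' δ' = γ z₂ δ' = γ δ z₃`: the two actions commute. It gives multiplicativity of
-- `transfer`.
theorem right_act_mul {z₁ z₂ z₃ : Z.total} {γ δ : Γ.arr} {γ' δ' : Γ'.arr}
    {a₁ : Z.right.anchor z₁ = Γ'.src γ'} {b₁ : Γ.tgt γ = Z.left.anchor z₂}
    {a₂ : Z.right.anchor z₂ = Γ'.src δ'} {b₂ : Γ.tgt δ = Z.left.anchor z₃}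
    (h₁ : Z.right.act z₁ γ' a₁ = Z.leftAct γ z₂ b₁) (h₂ : Z.right.act z₂ δ' a₂ = Z.leftAct δ z₃ b₂)
    (c : Γ.tgt γ = Γ.src δ) (c' : Γ'.tgt γ' = Γ'.src δ')
    (a₃ : Z.right.anchor z₁ = Γ'.src (Γ'.mul γ' δ' c'))
    (b₃ : Γ.tgt (Γ.mul γ δ c) = Z.left.anchor z₃) :
    Z.right.act z₁ (Γ'.mul γ' δ' c') a₃ = Z.leftAct (Γ.mul γ δ c) z₃ b₃ := by
  have e₁ : Z.right.anchor (Z.leftAct γ z₂ b₁) = Γ'.src δ' := by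
    rw [Z.right_anchor_leftAct, ← Z.right_anchor, a₂]
  have e₂ : Γ.tgt γ = Z.left.anchor (Z.right.act z₂ δ' a₂) := by
    rw [Z.left_anchor_right_act, b₁]
  rw [← Z.right.act_mul z₁ γ' δ' a₁ c',
    Z.right.act_congr h₁ rfl ((Z.right.anchor_act _ _ _).trans c') e₁,
    ← Z.leftAct_right_act γ z₂ δ' b₁ a₂ e₂ e₁, Z.leftAct_mul γ δ z₃ c b₂ b₃ (h₂ ▸ e₂)]
  simp only [h₂]

/-- The arrow `γ'` with `γ · z₂ = z₁ · γ'`. -/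
noncomputable def transfer (x : pullArr Z.right.proj_submersion.2 Γ) : Γ'.arr :=
  Z.right.div (source _ _ x) (Z.leftAct (arrow _ _ x) (target _ _ x) (Z.tgt_arrow_eq x))
    (Z.proj_source x)

theorem anchor_source (x : pullArr Z.right.proj_submersion.2 Γ) :
    Z.right.anchor (source _ _ x) = Γ'.src (Z.transfer x) := Z.right.src_div _ _ (Z.proj_source x)

theorem act_transfer (x : pullArr Z.right.proj_submersion.2 Γ) :
    Z.right.act (source _ _ x) (Z.transfer x) (Z.anchor_source x) =
      Z.leftAct (arrow _ _ x) (target _ _ x) (Z.tgt_arrow_eq x) :=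
  Z.right.act_div _ _ (Z.proj_source x)

theorem src_transfer (x : pullArr Z.right.proj_submersion.2 Γ) :
    Γ'.src (Z.transfer x) = Z.left.proj (source _ _ x) :=
  (Z.anchor_source x).symm.trans (Z.right_anchor _)

theorem tgt_transfer (x : pullArr Z.right.proj_submersion.2 Γ) :
    Γ'.tgt (Z.transfer x) = Z.left.proj (target _ _ x) :=
  (Z.right.tgt_div _ _ (Z.proj_source x)).trans (Z.right_anchor_leftAct _ _ _)

theorem transfer_eq {x : pullArr Z.right.proj_submersion.2 Γ} {γ' : Γ'.arr}
    {e : Z.right.anchor (source _ _ x) = Γ'.src γ'}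
    (h : Z.right.act (source _ _ x) γ' e =
      Z.leftAct (arrow _ _ x) (target _ _ x) (Z.tgt_arrow_eq x)) : Z.transfer x = γ' :=
  Z.right.div_eq _ e h

/-- The morphism sending `(z₁, γ, z₂)` to the `γ'` with `γ · z₂ = z₁ · γ'`. -/
noncomputable def pullHom :
    LieGroupoidHom (pullGroupoid Z.right.proj_submersion.2 Γ) Γ' where
  onObj := Z.left.proj
  onArr := ⟨Z.transfer, (Z.right.divMap (source _ _)
    (Z.leftActMap (arrow _ _) (target _ _) Z.tgt_arrow_eq) Z.proj_source).smooth⟩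
  src_comm := Z.src_transfer
  tgt_comm := Z.tgt_transfer
  map_mul x y e := by
    have e' : Γ'.tgt (Z.transfer x) = Γ'.src (Z.transfer y) :=
      (Z.tgt_transfer x).trans ((congrArg Z.left.proj e).trans (Z.src_transfer y).symm)
    have h : target _ _ x = source _ _ y := e
    refine Z.transfer_eq (e := (Z.anchor_source x).trans (Γ'.src_mul _ _ e').symm) ?_
    exact right_act_mul (z₂ := source _ _ y) (a₁ := Z.anchor_source x)
      (b₁ := (Z.tgt_arrow_eq x).trans (congrArg Z.left.anchor h)) (a₂ := Z.anchor_source y)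
      (b₂ := Z.tgt_arrow_eq y)
      ((Z.act_transfer x).trans (by simp only [h])) (Z.act_transfer y)
      ((tgt_arrow x).trans ((congrArg Z.right.proj h).trans (src_arrow y).symm)) e' _ _

/-- Equal `z₁` and `γ'` give equal `γ · z₂`, and the left action is free. -/
theorem transfer_injective {x y : pullArr Z.right.proj_submersion.2 Γ}
    (h₁ : source _ _ x = source _ _ y) (h₂ : target _ _ x = target _ _ y)
    (h₃ : Z.transfer x = Z.transfer y) : x = y := by
  refine PullArr.ext h₁ ?_ h₂
  have h₄ : Z.right.act (source _ _ x) (Z.transfer x) (Z.anchor_source x) =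
    Z.right.act (source _ _ y) (Z.transfer y) (Z.anchor_source y) := Z.right.act_congr h₁ h₃ _ _
  rw [Z.act_transfer, Z.act_transfer] at h₄
  have h₅ : Γ.inv (arrow _ _ x) = Γ.inv (arrow _ _ y) := by
    refine Z.left.act_left_cancel (p := target _ _ y)
      (e := (congrArg Z.left.anchor h₂).symm.trans ((Z.tgt_arrow_eq x).symm.trans (Γ.src_inv _).symm))
      (Eq.trans ?_ h₄)
    exact Z.left.act_congr h₂.symm rfl _ _
  rw [← Γ.inv_inv (arrow _ _ x), h₅, Γ.inv_inv]

/-- The two actions play symmetric roles: `b t` and `a t · y t` lie in the same fibre over `M'`, so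
dividing for the left action recovers `γ` smoothly from `γ'`. -/
theorem pullHom_isMorita : Z.pullHom.IsMorita where
  surjectiveSubmersion := Z.left.proj_submersion
  cartesian T a b y ha hb := by
    have e : ∀ t, Z.right.anchor (a t) = Γ'.src (y t) := fun t =>
      (Z.right_anchor _).trans (ha t).symm
    have h : ∀ t, Z.left.proj (b t) = Z.left.proj (Z.right.actMap a y e t) := fun t =>
      (hb t).symm.trans (Z.left_proj_right_act (a t) (y t) (e t)).symm
    let γ := Γ.inv.comp (Z.left.divMap b (Z.right.actMap a y e) h)
    have h₁ : ∀ t, Γ.src (γ t) = Z.right.proj (a t) := fun t =>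
      (Γ.src_inv _).trans ((Z.left.tgt_div _ _ (h t)).trans
        ((Z.left_anchor _).trans (Z.right.proj_act _ _ _)))
    have h₂ : ∀ t, Γ.tgt (γ t) = Z.right.proj (b t) := fun t =>
      (Γ.tgt_inv _).trans ((Z.left.src_div _ _ (h t)).symm.trans (Z.left_anchor _))
    have h₃ : ∀ t, Z.transfer (PullArr.mk Z.right.proj_submersion.2 Γ (a t) (γ t) (b t)
        (h₁ t) (h₂ t)) = y t := fun t => by
      refine Z.transfer_eq (e := e t) ?_
      refine (Z.left.act_div _ _ (h t)).symm.trans ?_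
      exact Z.left.act_congr rfl (Γ.inv_inv _).symm _ _
    refine ⟨⟨_, PullArr.smooth_mk (hq := Z.right.proj_submersion.2) a.smooth γ.smooth b.smooth h₁ h₂⟩,
      ⟨fun _ => rfl, fun _ => rfl, h₃⟩, ?_⟩
    rintro z ⟨h₄, h₅, h₆⟩
    exact SmoothMap.ext (funext fun t =>
      Z.transfer_injective (h₄ t) (h₅ t) ((h₆ t).trans (h₃ t).symm))

end Bitorsor

theorem MoritaEquivalent.exists_morita {M M' : Mfd.{u}} {X : LieGroupoid M} {X' : LieGroupoid M'}
    {E : CentralExtension X} {E' : CentralExtension X'} (h : MoritaEquivalent E E') :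
    ∃ (M'' : Mfd.{u}) (X'' : LieGroupoid M'') (E'' : CentralExtension X''),
      ExistsEquivariantMoritaMorphism E'' E' ∧ ExistsEquivariantMoritaMorphism E'' E := by
  obtain ⟨Z⟩ := h
  refine ⟨_, _, pullExtension Z.right.proj_submersion.2 E,
    ⟨Z.pullHom, Z.pullHom_isMorita, fun a x => ?_⟩,
    existsEquivariantMoritaMorphism_pull _ E Z.right.proj_submersion.1⟩
  have h₁ : Z.right.anchor (PullArr.target _ _ x) =
      E'.grpd.src (E'.grpd.one (Z.right.anchor (PullArr.target _ _ x))) :=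
    (E'.grpd.src_one _).symm
  -- With a unit as right factor, the axioms give `(a r) · z₂ = (r · z₂) · (a 1)`. Substituting `r ·
  -- z₂ = z₁ · r'` turns the right side into `z₁ · (a r')`.
  have h₂ := (Z.smul_left a (PullArr.arrow _ _ x) (PullArr.target _ _ x) _ (Z.tgt_arrow_eq x) h₁).trans
    (Z.smul_right a (PullArr.arrow _ _ x) (PullArr.target _ _ x) _ (Z.tgt_arrow_eq x) h₁)
  refine Z.transfer_eq (e := (Z.anchor_source x).trans (E'.src_smul _ _).symm) ?_
  refine Eq.trans ?_ (h₂.symm.trans (Z.right.act_one' _ _ _))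
  refine (E'.scale_act Z.right a _ _ (Z.anchor_source x)).symm.trans ?_
  refine Z.right.act_congr (Z.act_transfer x) ?_ _ _
  exact congrArg (fun m => E'.smul a (E'.grpd.one m)) ((Z.right.anchor_act _ _ _).trans
    ((Z.tgt_transfer x).trans (Z.right_anchor _).symm))

end DiffStack

/-! ### From an isomorphism of gerbes to an equivariant bitorsor. -/

namespace DiffStack

open Topology TopologicalSpace

/-! ### Strictification of morphisms of stacks -/

theorem castMap_symm_apply {A B : Mfd.{u}} (h : A = B) (x : A) :
    castMap h.symm (castMap h x) = x := by
  subst h; rfl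

/-- A torsor over `S` is a torsor over every manifold equal to `S`. -/
def TorsorStr.changeBase {M : Mfd.{u}} {Γ : LieGroupoid M} {P S S' : Mfd.{u}} (h : S = S')
    (τ : TorsorStr Γ P S) : TorsorStr Γ P S' where
  proj := (castMap h).comp τ.proj
  anchor := τ.anchor
  proj_submersion := by subst h; exact τ.proj_submersion
  act := τ.act
  act_smooth := τ.act_smooth
  anchor_act := τ.anchor_act
  act_one := τ.act_one
  act_mul := τ.act_mul
  proj_act p γ e := congrArg (castMap h) (τ.proj_act p γ e)
  simply_transitive p p' h' := by subst h; exact τ.simply_transitive p p' h'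
  division_smooth := τ.division_smooth

theorem Torsor.congr_total {M : Mfd.{u}} {Γ : LieGroupoid M} {P Q : Torsor Γ} {f g : P ⟶ Q}
    (h : f = g) (p : P.total) : Hom.total f p = Hom.total g p := by rw [h]

section Strict

variable {M N : Mfd.{u}} {Γ : LieGroupoid M} {Δ : LieGroupoid N}
  (F : BasedFunctor (stack Γ) (stack Δ))

/-- A based functor preserves bases only up to an equality of manifolds. This naturality lets
`strictObj` and `strictMap` keep the original bases and base maps. -/
theorem castMap_base_map {P Q : Torsor Γ} (f : P ⟶ Q) (s : Torsor.base (F.obj P)) :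
    castMap (F.w_obj Q) (Torsor.Hom.base (F.map f) s) =
      Torsor.Hom.base f (castMap (F.w_obj P) s) := by
  have h : (stack Δ).p.map (F.map f) ≫ eqToHom (F.w_obj Q) =
      eqToHom (F.w_obj P) ≫ (stack Γ).p.map f := by
    have h' : (stack Δ).p.map (F.map f) = eqToHom (F.w_obj P) ≫ (stack Γ).p.map f ≫
      eqToHom (F.w_obj Q).symm := Functor.congr_hom F.w f
    rw [h']
    simp only [Category.assoc, eqToHom_trans, eqToHom_refl, Category.comp_id]
  exact congrFun (congrArg SmoothMap.toFun h) s

/-- The image of a torsor under a morphism of stacks, as a torsor over the same manifold. -/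
def strictObj (P : Torsor Γ) : Torsor Δ :=
  ⟨P.base, Torsor.total (F.obj P), (Torsor.str (F.obj P)).changeBase (F.w_obj P)⟩

/-- The image of a morphism of torsors under a morphism of stacks. -/
def strictMap {P Q : Torsor Γ} (f : P ⟶ Q) : strictObj F P ⟶ strictObj F Q where
  base := Torsor.Hom.base (P := P) (Q := Q) f
  total := Torsor.Hom.total (P := F.obj P) (Q := F.obj Q) (F.map f)
  proj_comm p := (congrArg (castMap (F.w_obj Q)) (Torsor.Hom.proj_comm (F.map f) p)).trans
    (castMap_base_map F f _)
  anchor_comm := Torsor.Hom.anchor_comm (F.map f)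
  equivariant := Torsor.Hom.equivariant (F.map f)

theorem strictMap_comp {P Q R : Torsor Γ} (f : P ⟶ Q) (g : Q ⟶ R) :
    strictMap F (f ≫ g) = strictMap F f ≫ strictMap F g :=
  Torsor.hom_ext fun p =>
    Torsor.congr_total (P := F.obj P) (Q := F.obj R) (F.map_comp f g) p

theorem strictMap_injective [F.toFunctor.Faithful] {P Q : Torsor Γ} {f g : P ⟶ Q}
    (h : strictMap F f = strictMap F g) : f = g :=
  F.toFunctor.map_injective (Torsor.hom_ext fun p =>
    Torsor.congr_total (P := strictObj F P) (Q := strictObj F Q) h p)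

theorem strictMap_surjective [F.toFunctor.Full] {P Q : Torsor Γ}
    (g : strictObj F P ⟶ strictObj F Q) : ∃ f : P ⟶ Q, strictMap F f = g := by
  let g' : F.obj P ⟶ F.obj Q :=
    { base := (castMap (F.w_obj Q).symm).comp
        ((Torsor.Hom.base g).comp (castMap (F.w_obj P)))
      total := Torsor.Hom.total (P := strictObj F P) (Q := strictObj F Q) g
      proj_comm := fun p => (castMap_symm_apply (F.w_obj Q) _).symm.trans
        (congrArg (castMap (F.w_obj Q).symm) (Torsor.Hom.proj_comm g p))
      anchor_comm := Torsor.Hom.anchor_comm g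
      equivariant := Torsor.Hom.equivariant g }
  obtain ⟨f, hf⟩ := F.toFunctor.map_surjective g'
  exact ⟨f, Torsor.hom_ext fun p => Torsor.congr_total (P := F.obj P) (Q := F.obj Q) hf p⟩

end Strict

/-- A torsor over at most one point is a single orbit, so one value determines a morphism. -/
theorem Torsor.hom_ext_of_subsingleton {M : Mfd.{u}} {Γ : LieGroupoid M} {P Q : Torsor Γ}
    [Subsingleton P.base] {f g : Hom P Q} (p : P.total) (h : f.total p = g.total p) : f = g :=
  hom_ext fun p' => by
    obtain ⟨γ, ⟨e, rfl⟩, -⟩ := P.str.simply_transitive p p' (Subsingleton.elim _ _)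
    rw [f.equivariant, g.equivariant]
    simp only [h]

/-! ### The universal torsor -/

section Universal

variable {M : Mfd.{u}} (Γ : LieGroupoid M)

/-- The arrows of `Γ` as a torsor over its objects, by the source map. -/
noncomputable def univ : Torsor Γ := Torsor.triv Γ (⟨fun m => m, Smooth.id _⟩ : SmoothMap M M)

/-- An arrow as a point of the universal torsor. -/
noncomputable def univPt : SmoothMap Γ.arr (univ Γ).total :=
  FiberProd.lift _ _ ⟨fun γ => γ, Smooth.id _⟩ Γ.src fun _ => rfl

variable {Γ}

theorem univPt_injective {γ δ : Γ.arr} (h : univPt Γ γ = univPt Γ δ) : γ = δ :=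
  congrArg (FiberProd.fst _ _) h

theorem act_univPt (γ δ : Γ.arr) (e : (univ Γ).str.anchor (univPt Γ γ) = Γ.src δ)
    (e' : Γ.tgt γ = Γ.src δ) : (univ Γ).str.act (univPt Γ γ) δ e = univPt Γ (Γ.mul γ δ e') :=
  FiberProd.ext rfl (Γ.src_mul _ _ _).symm

variable {T : Mfd.{u}} {a : SmoothMap T M}

/-- The morphism from a trivial torsor to the universal torsor given by a family of arrows. -/
noncomputable def toUniv (ρ : SmoothMap T Γ.arr) (h : ∀ t, Γ.tgt (ρ t) = a t) :
    Torsor.triv Γ a ⟶ univ Γ := Torsor.trivHom ((univPt Γ).comp ρ) h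

theorem toUniv_unit (ρ : SmoothMap T Γ.arr) (h : ∀ t, Γ.tgt (ρ t) = a t) (t : T) :
    Torsor.Hom.total (toUniv (Γ := Γ) ρ h) (Torsor.trivUnit a t) = univPt Γ (ρ t) :=
  Torsor.trivHom_unit (Q := univ Γ) ((univPt Γ).comp ρ) h t

theorem hom_ext_toUniv {f : Torsor.triv Γ a ⟶ univ Γ} {ρ : SmoothMap T Γ.arr}
    {h : ∀ t, Γ.tgt (ρ t) = a t}
    (H : ∀ t, Torsor.Hom.total f (Torsor.trivUnit a t) = univPt Γ (ρ t)) : f = toUniv ρ h :=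
  Torsor.triv_hom_ext fun t => (H t).trans (toUniv_unit ρ h t).symm

/-- The identification of the fibres of the universal torsor along the source map. -/
noncomputable def univSrc : Torsor.triv Γ Γ.src ⟶ univ Γ :=
  toUniv (Γ.one.comp Γ.src) fun _ => Γ.tgt_one _

/-- Translation by the inverse of an arrow. -/
noncomputable def univTgt : Torsor.triv Γ Γ.src ⟶ univ Γ := toUniv Γ.inv Γ.tgt_inv

end Universal

/-! ### The bitorsor of an isomorphism of stacks -/

namespace StackBitorsor

variable {M N : Mfd.{u}} {Γ : LieGroupoid M} {Δ : LieGroupoid N}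
  (F : BasedFunctor (stack Γ) (stack Δ))

/-- The image of the universal torsor. -/
noncomputable def Z : Torsor Δ := strictObj F (univ Γ)

/-- The projection of the image of the universal torsor. -/
noncomputable def pr : SmoothMap (Z F).total M := (Z F).str.proj

theorem exists_act_lift (z : (Z F).total) (γ : Γ.arr) (e : pr F z = Γ.src γ) :
    ∃ y, (strictObj F (Torsor.triv Γ Γ.src)).str.proj y = γ ∧
      Torsor.Hom.total (strictMap F univSrc) y = z :=
  Torsor.Hom.exists_lift (strictMap F (univSrc (Γ := Γ))) γ z
    (e.trans (Γ.src_one (Γ.src γ)).symm)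

/-- The action of `Γ` on the image of the universal torsor. -/
noncomputable def act (z : (Z F).total) (γ : Γ.arr) (e : pr F z = Γ.src γ) : (Z F).total :=
  -- `univSrc` and `univTgt` present `triv Γ Γ.src` as the pullback of the universal torsor along
  -- the source and along the target. Their images under `F` carry the fibre of `Z F` over `s(γ)` to
  -- the fibre over `t(γ)`.
  Torsor.Hom.total (strictMap F univTgt) (exists_act_lift F z γ e).choose

theorem act_smooth (T : Mfd.{u}) (z : SmoothMap T (Z F).total) (γ : SmoothMap T Γ.arr)
    (e : ∀ t, pr F (z t) = Γ.src (γ t)) : Smooth fun t => act F (z t) (γ t) (e t) :=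
  ((Torsor.Hom.total (strictMap F univTgt)).comp (Torsor.Hom.lift (strictMap F (univSrc (Γ := Γ)))
    γ z fun t => (e t).trans (Γ.src_one (Γ.src (γ t))).symm)).smooth

variable {F}

theorem act_eq (y : (strictObj F (Torsor.triv Γ Γ.src)).total) {z : (Z F).total} {γ : Γ.arr}
    (e : pr F z = Γ.src γ) (hy : (strictObj F (Torsor.triv Γ Γ.src)).str.proj y = γ)
    (hz : Torsor.Hom.total (strictMap F univSrc) y = z) :
    act F z γ e = Torsor.Hom.total (strictMap F univTgt) y := by
  have h := (exists_act_lift F z γ e).choose_spec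
  refine congrArg (Torsor.Hom.total (strictMap F univTgt)) ?_
  exact Torsor.Hom.injective_on_fibers (strictMap F univSrc) (h.1.trans hy.symm) (h.2.trans hz.symm)

theorem act_congr {z z' : (Z F).total} {γ : Γ.arr} (h : z = z') (e : pr F z = Γ.src γ)
    (e' : pr F z' = Γ.src γ) : act F z γ e = act F z' γ e' := by
  subst h; rfl

/-- The basic computation: acting by `γ` replaces `F(ρ)` by `F(γ⁻¹ ρ)`. Both morphisms factor
through one `k`, followed by `univSrc` and `univTgt` respectively, so functoriality suffices. -/
theorem act_toUniv {T : Mfd.{u}} {a : SmoothMap T M} (ρ γ : SmoothMap T Γ.arr)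
    (h : ∀ t, Γ.tgt (ρ t) = a t) (hγ : ∀ t, Γ.tgt (Γ.inv (γ t)) = Γ.src (ρ t))
    (y : (strictObj F (Torsor.triv Γ a)).total) (t : T)
    (ht : (strictObj F (Torsor.triv Γ a)).str.proj y = t)
    (e : pr F (Torsor.Hom.total (strictMap F (toUniv ρ h)) y) = Γ.src (γ t)) :
    act F (Torsor.Hom.total (strictMap F (toUniv ρ h)) y) (γ t) e =
      Torsor.Hom.total (strictMap F (toUniv (Γ.mulMap (Γ.inv.comp γ) ρ hγ)
        fun t => (Γ.tgt_mul _ _ _).trans (h t))) y := by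
  have h' : ∀ t, (Torsor.triv Γ Γ.src).str.anchor (Torsor.trivUnit Γ.src (γ t)) = Γ.src (ρ t) :=
    fun t => (Torsor.anchor_trivUnit Γ.src (γ t)).trans ((Γ.tgt_inv _).symm.trans (hγ t))
  let k : Torsor.triv Γ a ⟶ Torsor.triv Γ Γ.src := Torsor.trivHom
    ((Torsor.triv Γ Γ.src).str.actMap ((Torsor.trivUnit Γ.src).comp γ) ρ h')
    fun t => ((Torsor.triv Γ Γ.src).str.anchor_act _ _ (h' t)).trans (h t)
  have hk : ∀ t, Torsor.Hom.total k (Torsor.trivUnit a t) =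
      (Torsor.triv Γ Γ.src).str.act (Torsor.trivUnit Γ.src (γ t)) (ρ t) (h' t) :=
    fun t => Torsor.trivHom_unit _ _ t
  have h₁ : k ≫ univSrc = toUniv ρ h := hom_ext_toUniv fun t => by
    refine (congrArg (Torsor.Hom.total univSrc) (hk t)).trans
      ((Torsor.Hom.equivariant univSrc _ _ _).trans ?_)
    have e₁ : Γ.tgt (Γ.one (Γ.src (γ t))) = Γ.src (ρ t) := by
      rw [Γ.tgt_one, ← hγ, Γ.tgt_inv]
    refine ((univ Γ).str.act_congr (toUniv_unit (a := Γ.src) (Γ.one.comp Γ.src)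
      (fun _ => Γ.tgt_one _) (γ t)) rfl _ e₁).trans ((act_univPt _ _ _ e₁).trans ?_)
    exact congrArg _ (Γ.one_mul' _ _ _)
  have h₂ : k ≫ univTgt = toUniv (Γ.mulMap (Γ.inv.comp γ) ρ hγ)
      fun t => (Γ.tgt_mul _ _ _).trans (h t) := hom_ext_toUniv fun t => by
    refine (congrArg (Torsor.Hom.total univTgt) (hk t)).trans
      ((Torsor.Hom.equivariant univTgt _ _ _).trans ?_)
    exact ((univ Γ).str.act_congr (toUniv_unit _ _ _) rfl _ (hγ t)).trans (act_univPt _ _ _ (hγ t))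
  subst ht
  refine (act_eq (Torsor.Hom.total (strictMap F k) y) e ?_ ?_).trans ?_
  · exact Torsor.Hom.proj_comm (strictMap F k) y
  · rw [← h₁, strictMap_comp]; rfl
  · rw [← h₂, strictMap_comp]; rfl

section Point

variable {m : M} (y : (strictObj F (Torsor.triv Γ (SmoothMap.const (M := Mfd.pt) m))).total)

/-- The image of a point of a torsor over the one point manifold under the morphism given by an
arrow. -/
noncomputable def shift (ρ : Γ.arr) (h : Γ.tgt ρ = m) : (Z F).total :=
  Torsor.Hom.total (strictMap F (toUniv (a := SmoothMap.const m) (SmoothMap.const ρ)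
    fun _ => h)) y

theorem shift_congr {ρ ρ' : Γ.arr} (H : ρ = ρ') (h : Γ.tgt ρ = m) (h' : Γ.tgt ρ' = m) :
    shift y ρ h = shift y ρ' h' := by
  subst H; rfl

/-- Over the one-point manifold the action becomes left multiplication by `γ⁻¹`. As every point of
`Z F` is some `shift y 1`, the groupoid laws follow from identities between arrows. -/
theorem act_shift (ρ γ : Γ.arr) (h : Γ.tgt ρ = m) (hγ : Γ.tgt (Γ.inv γ) = Γ.src ρ)
    (e : pr F (shift y ρ h) = Γ.src γ) (h' : Γ.tgt (Γ.mul (Γ.inv γ) ρ hγ) = m) :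
    act F (shift y ρ h) γ e = shift y (Γ.mul (Γ.inv γ) ρ hγ) h' :=
  act_toUniv (F := F) (a := SmoothMap.const m) (SmoothMap.const ρ) (SmoothMap.const (M := Mfd.pt) γ) (fun _ => h)
    (fun _ => hγ) y _ rfl e

theorem act_shift_one (γ : Γ.arr) (h : Γ.tgt (Γ.one m) = m)
    (e : pr F (shift y (Γ.one m) h) = Γ.src γ) (h' : Γ.tgt (Γ.inv γ) = m) :
    act F (shift y (Γ.one m) h) γ e = shift y (Γ.inv γ) h' :=
  (act_shift y _ γ h (h'.trans (Γ.src_one m).symm) e ((Γ.tgt_mul _ _ _).trans h)).trans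
    (shift_congr y (Γ.mul_one' _ _ _) _ _)

theorem pr_shift (ρ : Γ.arr) (h : Γ.tgt ρ = m) : pr F (shift y ρ h) = Γ.src ρ :=
  Torsor.Hom.proj_comm (strictMap F (toUniv (a := SmoothMap.const m) (SmoothMap.const ρ)
    fun _ => h)) y

/-- Two morphisms out of a torsor over the point that agree at `y` are equal, and `F` is faithful.
-/
theorem shift_injective [F.toFunctor.Faithful] {ρ ρ' : Γ.arr} {h : Γ.tgt ρ = m}
    {h' : Γ.tgt ρ' = m} (H : shift y ρ h = shift y ρ' h') : ρ = ρ' := by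
  have : Subsingleton (strictObj F (Torsor.triv Γ (SmoothMap.const (M := Mfd.pt) m))).base :=
    inferInstanceAs (Subsingleton Mfd.pt)
  have h₁ := strictMap_injective F (Torsor.hom_ext_of_subsingleton (P := strictObj F
    (Torsor.triv Γ (SmoothMap.const (M := Mfd.pt) m))) y H)
  refine univPt_injective ?_
  exact (toUniv_unit _ _ Mfd.star).symm.trans ((Torsor.congr_total h₁ _).trans
    (toUniv_unit _ _ Mfd.star))

end Point

variable (F) in
theorem exists_shift_one (z : (Z F).total) {m : M} (e : pr F z = m) :
    ∃ y : (strictObj F (Torsor.triv Γ (SmoothMap.const (M := Mfd.pt) m))).total,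
      shift y (Γ.one m) (Γ.tgt_one m) = z := by
  obtain ⟨y, -, hy⟩ := Torsor.Hom.exists_lift (strictMap F (toUniv (Γ := Γ)
    (a := SmoothMap.const (M := Mfd.pt) m) (SmoothMap.const (Γ.one m)) fun _ => Γ.tgt_one m))
    Mfd.star z (e.trans (Γ.src_one m).symm)
  exact ⟨y, hy⟩

theorem pr_act (z : (Z F).total) (γ : Γ.arr) (e : pr F z = Γ.src γ) :
    pr F (act F z γ e) = Γ.tgt γ := by
  have h := (exists_act_lift F z γ e).choose_spec
  refine (Torsor.Hom.proj_comm (strictMap F univTgt) _).trans ?_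
  exact (congrArg _ h.1).trans (Γ.src_inv γ)

theorem anchor_act (z : (Z F).total) (γ : Γ.arr) (e : pr F z = Γ.src γ) :
    (Z F).str.anchor (act F z γ e) = (Z F).str.anchor z := by
  have h := (exists_act_lift F z γ e).choose_spec
  refine (Torsor.Hom.anchor_comm (strictMap F univTgt) _).trans ?_
  exact (Torsor.Hom.anchor_comm (strictMap F univSrc) _).symm.trans
    (congrArg (Z F).str.anchor h.2)

theorem act_right (z : (Z F).total) (γ : Γ.arr) (δ : Δ.arr) (e : pr F z = Γ.src γ)
    (e' : (Z F).str.anchor z = Δ.src δ) (e₁ : pr F ((Z F).str.act z δ e') = Γ.src γ)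
    (e₂ : (Z F).str.anchor (act F z γ e) = Δ.src δ) :
    (Z F).str.act (act F z γ e) δ e₂ = act F ((Z F).str.act z δ e') γ e₁ := by
  obtain ⟨y, hy, rfl⟩ := exists_act_lift F z γ e
  have e₃ : (strictObj F (Torsor.triv Γ Γ.src)).str.anchor y = Δ.src δ :=
    (Torsor.Hom.anchor_comm (strictMap F univSrc) y).symm.trans e'
  have h := act_eq ((strictObj F (Torsor.triv Γ Γ.src)).str.act y δ e₃) e₁
    ((TorsorStr.proj_act _ _ _ _).trans hy)
    (Torsor.Hom.equivariant (strictMap F univSrc) y δ e₃)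
  refine Eq.trans ?_ (h.trans (Torsor.Hom.equivariant (strictMap F univTgt) y δ e₃)).symm
  exact (Z F).str.act_congr (act_eq y e hy rfl) rfl _ _

theorem act_mul (z : (Z F).total) (γ δ : Γ.arr) (e : pr F z = Γ.src γ) (e' : Γ.tgt γ = Γ.src δ)
    (e₁ : pr F (act F z γ e) = Γ.src δ) (e₂ : pr F z = Γ.src (Γ.mul γ δ e')) :
    act F (act F z γ e) δ e₁ = act F z (Γ.mul γ δ e') e₂ := by
  obtain ⟨y, rfl⟩ := exists_shift_one F z e
  have h₁ := act_shift_one y γ (Γ.tgt_one _) e (Γ.tgt_inv γ)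
  have h₂ : Γ.tgt (Γ.inv δ) = Γ.src (Γ.inv γ) := by rw [Γ.tgt_inv, Γ.src_inv, e']
  simp only [h₁]
  rw [act_shift y (Γ.inv γ) δ (Γ.tgt_inv γ) h₂ _ ((Γ.tgt_mul _ _ _).trans (Γ.tgt_inv γ)),
    act_shift_one y _ (Γ.tgt_one _) _ ((Γ.tgt_inv _).trans (Γ.src_mul _ _ _))]
  exact shift_congr y (Γ.inv_mul_rev γ δ e').symm _ _

theorem act_one (z : (Z F).total) (e : pr F z = Γ.src (Γ.one (pr F z))) :
    act F z (Γ.one (pr F z)) e = z := by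
  obtain ⟨y, hy⟩ := exists_shift_one F z rfl
  have h : ∀ (z' : (Z F).total) (m : M) (hm : pr F z = m) (h : shift y (Γ.one _) (Γ.tgt_one _) = z')
      (e : pr F z' = Γ.src (Γ.one m)), act F z' (Γ.one m) e = z' := by
    rintro _ _ rfl rfl e
    refine (act_shift_one y _ (Γ.tgt_one _) e ((Γ.tgt_inv _).trans (Γ.src_one _))).trans ?_
    exact shift_congr y (Γ.inv_one _) _ _
  exact h z _ rfl hy e

theorem act_left_cancel [F.toFunctor.Faithful] {z : (Z F).total} {γ γ' : Γ.arr}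
    {e : pr F z = Γ.src γ} {e' : pr F z = Γ.src γ'} (h : act F z γ e = act F z γ' e') : γ = γ' := by
  obtain ⟨y, rfl⟩ := exists_shift_one F z e
  rw [act_shift_one y γ (Γ.tgt_one _) e (Γ.tgt_inv γ),
    act_shift_one y γ' (Γ.tgt_one _) e' ((Γ.tgt_inv γ').trans
      (e'.symm.trans ((pr_shift y _ _).trans (Γ.src_one _))))] at h
  rw [← Γ.inv_inv γ, shift_injective y h, Γ.inv_inv]

/-- Restricting the universal torsor along `pr ∘ p` and `pr ∘ p'` gives trivial torsors in whose
images `p` and `p'` become sections `y`, `y'` with equal anchors. Hence a morphism `g` carries `y`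
to `y'`. By fullness `g` comes from a morphism `f` of trivial torsors, that is, from a family of
arrows `ρ`, and the arrow sought is `ρ⁻¹`. -/
theorem exists_div [F.toFunctor.Full] {T : Mfd.{u}} (p p' : SmoothMap T (Z F).total)
    (h : ∀ t, (Z F).str.anchor (p t) = (Z F).str.anchor (p' t)) :
    ∃ (γ : SmoothMap T Γ.arr) (e : ∀ t, pr F (p t) = Γ.src (γ t)),
      ∀ t, act F (p t) (γ t) (e t) = p' t := by
  let a := (pr F).comp p
  let b := (pr F).comp p'
  let ι (c : SmoothMap T M) : Torsor.triv Γ c ⟶ univ Γ := toUniv (Γ.one.comp c) fun _ => Γ.tgt_one _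
  let idT : SmoothMap T T := ⟨fun t => t, Smooth.id _⟩
  have ha : ∀ t, (Z F).str.proj (p t) = Torsor.Hom.base (strictMap F (ι a)) (idT t) :=
    fun t => (Γ.src_one (a t)).symm
  have hb : ∀ t, (Z F).str.proj (p' t) = Torsor.Hom.base (strictMap F (ι b)) (idT t) :=
    fun t => (Γ.src_one (b t)).symm
  let y := Torsor.Hom.lift (strictMap F (ι a)) idT p ha
  let y' := Torsor.Hom.lift (strictMap F (ι b)) idT p' hb
  have hy : ∀ t, Torsor.Hom.total (strictMap F (ι a)) (y t) = p t := Torsor.Hom.total_lift _ _ _ _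
  have hy' : ∀ t, Torsor.Hom.total (strictMap F (ι b)) (y' t) = p' t := Torsor.Hom.total_lift _ _ _ _
  let g : strictObj F (Torsor.triv Γ a) ⟶ strictObj F (Torsor.triv Γ b) :=
    Torsor.homOfSections (strictObj F (Torsor.triv Γ a)).str (strictObj F (Torsor.triv Γ b)).str y y'
      (Torsor.Hom.proj_lift _ _ _ _) (Torsor.Hom.proj_lift _ _ _ _) fun t =>
        ((Torsor.Hom.anchor_comm (strictMap F (ι a)) (y t)).symm.trans
          (congrArg (Z F).str.anchor (hy t))).trans ((h t).trans
          ((Torsor.Hom.anchor_comm (strictMap F (ι b)) (y' t)).symm.trans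
            (congrArg (Z F).str.anchor (hy' t))).symm)
  have hg : ∀ t, Torsor.Hom.total g (y t) = y' t := Torsor.homOfSections_apply _ _ _ _ _ _ _
  obtain ⟨f, hf⟩ := strictMap_surjective F g
  -- `strictMap` does not change base maps, so `f` covers the identity as `g` does.
  have hfb : ∀ t, Torsor.Hom.base f t = t := fun t =>
    congrArg (fun k => Torsor.Hom.base (P := strictObj F (Torsor.triv Γ a)) k t) hf
  let ρ : SmoothMap T Γ.arr :=
    (FiberProd.fst Γ.src_submersion b).comp ((Torsor.Hom.total f).comp (Torsor.trivUnit a))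
  have hρs : ∀ t, Γ.src (ρ t) = b t := fun t =>
    (FiberProd.comm (Torsor.Hom.total f (Torsor.trivUnit a t))).trans
      (congrArg b ((Torsor.Hom.proj_comm f _).trans (hfb t)))
  have hρt : ∀ t, Γ.tgt (ρ t) = a t := fun t =>
    (Torsor.Hom.anchor_comm f (Torsor.trivUnit a t)).trans (Torsor.anchor_trivUnit a t)
  refine ⟨Γ.inv.comp ρ, fun t => (hρt t).symm.trans (Γ.src_inv _).symm, fun t => ?_⟩
  have e₁ : ∀ t, Γ.tgt (Γ.inv ((Γ.inv.comp ρ) t)) = Γ.src ((Γ.one.comp a) t) := fun t =>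
    (Γ.tgt_inv _).trans ((Γ.src_inv _).trans ((hρt t).trans (Γ.src_one (a t)).symm))
  have h₁ := act_toUniv (F := F) (Γ.one.comp a) (Γ.inv.comp ρ) (fun _ => Γ.tgt_one _) e₁ (y t) t
    (Torsor.Hom.proj_lift _ _ _ _ t) ((congrArg (pr F) (hy t)).trans
      ((hρt t).symm.trans (Γ.src_inv (ρ t)).symm))
  have h₂ : f ≫ ι b = toUniv (Γ.mulMap (Γ.inv.comp (Γ.inv.comp ρ)) (Γ.one.comp a) e₁)
      fun t => (Γ.tgt_mul _ _ _).trans (Γ.tgt_one _) := hom_ext_toUniv fun t => by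
    let x : (Torsor.triv Γ b).total := Torsor.Hom.total f (Torsor.trivUnit a t)
    have e₂ : Γ.tgt (Γ.one (b (FiberProd.snd Γ.src_submersion b x))) =
        Γ.src (FiberProd.fst Γ.src_submersion b x) :=
      (Γ.tgt_one _).trans (FiberProd.comm x).symm
    refine (act_univPt (Γ.one (b (FiberProd.snd Γ.src_submersion b x)))
      (FiberProd.fst Γ.src_submersion b x) e₂ e₂).trans (congrArg (univPt Γ) ?_)
    refine (Γ.one_mul' _ _ _).trans (Eq.trans ?_ (Γ.mul_one' _ _ _).symm)
    exact (Γ.inv_inv (ρ t)).symm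
  refine (act_congr (hy t).symm _ _).trans (h₁.trans ?_)
  refine (Torsor.congr_total (congrArg (strictMap F) h₂.symm) (y t)).trans ?_
  refine (Torsor.congr_total (strictMap_comp F f (ι b)) (y t)).trans ?_
  exact (congrArg (Torsor.Hom.total (strictMap F (ι b)))
    ((Torsor.congr_total hf (y t)).trans (hg t))).trans (hy' t)

theorem simply_transitive [F.toFunctor.Full] [F.toFunctor.Faithful] (z z' : (Z F).total)
    (h : (Z F).str.anchor z = (Z F).str.anchor z') :
    ∃! γ : Γ.arr, ∃ e : pr F z = Γ.src γ, act F z γ e = z' := by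
  obtain ⟨γ, e, hγ⟩ := exists_div (F := F) (T := Mfd.pt) (SmoothMap.const z) (SmoothMap.const z')
    fun _ => h
  refine ⟨γ Mfd.star, ⟨e Mfd.star, hγ Mfd.star⟩, ?_⟩
  rintro γ' ⟨e', h'⟩
  exact act_left_cancel (h'.trans (hγ Mfd.star).symm)

/-- By essential surjectivity the universal `Δ`-torsor is isomorphic to the image of some `Q`, and
its units give points `w n` with anchor `n`. A local section of `Q` under these points lifts them to
the image of a trivial torsor, which maps to `Z F` preserving anchors. -/
theorem exists_anchor_section [F.toFunctor.EssSurj] (n : N) :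
    ∃ (V : Opens N) (_ : n ∈ V) (σ : SmoothMap (N.restrict V) (Z F).total),
      ∀ v, (Z F).str.anchor (σ v) = Mfd.val v := by
  let V₀ : Torsor Δ := univ Δ
  let Q : Torsor Γ := F.toFunctor.objPreimage V₀
  let i : V₀ ⟶ F.obj Q := (F.toFunctor.objObjPreimageIso V₀).inv
  let w : SmoothMap N (strictObj F Q).total := (Torsor.Hom.total i).comp ((univPt Δ).comp Δ.one)
  have hw : ∀ n, (strictObj F Q).str.anchor (w n) = n := fun n =>
    (Torsor.Hom.anchor_comm i _).trans (Δ.tgt_one n)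
  obtain ⟨V, hV, σ, hσ⟩ := Q.str.proj_submersion.exists_local_lift ((strictObj F Q).str.proj.comp w) n
  let f : Torsor.triv Γ (Q.str.anchor.comp σ) ⟶ Q := Torsor.trivHom σ fun _ => rfl
  let y := Torsor.Hom.lift (strictMap F f) ⟨fun t => t, Smooth.id _⟩ (w.comp (N.incl V))
    fun v => (hσ v).symm
  have hy : ∀ v, Torsor.Hom.total (strictMap F f) (y v) = w (Mfd.val v) :=
    Torsor.Hom.total_lift _ _ _ _
  let ι : Torsor.triv Γ (Q.str.anchor.comp σ) ⟶ univ Γ :=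
    toUniv (Γ.one.comp (Q.str.anchor.comp σ)) fun _ => Γ.tgt_one _
  refine ⟨V, hV, (Torsor.Hom.total (strictMap F ι)).comp y, fun v => ?_⟩
  refine (Torsor.Hom.anchor_comm (strictMap F ι) (y v)).trans ?_
  refine (Torsor.Hom.anchor_comm (strictMap F f) (y v)).symm.trans ?_
  exact (congrArg (strictObj F Q).str.anchor (hy v)).trans (hw _)

theorem anchor_submersion [F.toFunctor.IsEquivalence] :
    IsSurjectiveSubmersion (Z F).str.anchor := by
  refine ⟨fun n => ?_, isSubmersion_of_local_sections fun z => ?_⟩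
  · obtain ⟨V, hV, σ, hσ⟩ := exists_anchor_section (F := F) n
    exact ⟨_, hσ (Mfd.mkPt n hV)⟩
  · obtain ⟨V, hV, σ, hσ⟩ := exists_anchor_section (F := F) ((Z F).str.anchor z)
    -- The section need not pass through `z`. The arrow from its value to `z`, extended to a family
    -- `ρ` by lifting along the source map, moves it there without changing anchors.
    obtain ⟨γ, ⟨e, hγ⟩, -⟩ := simply_transitive (σ (Mfd.mkPt _ hV)) z (hσ _)
    obtain ⟨W, hW, ρ, hρ, hρ'⟩ := Γ.src_submersion.exists_local_lift ((pr F).comp σ) e.symm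
    obtain ⟨V', hV', j, hj⟩ := Mfd.exists_restrict_restrict W hW
    have e' : ∀ v, pr F (σ (Mfd.val (j v))) = Γ.src (ρ (j v)) := fun v => (hρ (j v)).symm
    refine ⟨V', hV', ⟨_, act_smooth F _ (σ.comp ((Mfd.incl _ W).comp j)) (ρ.comp j) e'⟩,
      fun v => ?_, ?_⟩
    · exact (anchor_act _ _ (e' v)).trans ((hσ _).trans (hj v))
    · have h₁ : j (Mfd.mkPt _ hV') = Mfd.mkPt _ hW :=
        Mfd.val_injective (Mfd.val_injective (hj _))
      refine Eq.trans ?_ hγ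
      have h₂ : ∀ (x : (N.restrict V).restrict W) (h : x = Mfd.mkPt _ hW)
          (e₁ : pr F (σ (Mfd.val x)) = Γ.src (ρ x)),
          act F (σ (Mfd.val x)) (ρ x) e₁ = act F (σ (Mfd.mkPt _ hV)) γ e := by
        rintro _ rfl e₁
        simp only [hρ']
        rfl
      exact h₂ _ h₁ (e' _)

variable (F) in
/-- The structure of a `Γ`-torsor over `N` on the image of the universal torsor. -/
noncomputable def leftStr [F.toFunctor.IsEquivalence] : TorsorStr Γ (Z F).total N where
  proj := (Z F).str.anchor
  anchor := pr F
  proj_submersion := anchor_submersion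
  act := act F
  act_smooth := act_smooth F
  anchor_act := pr_act
  act_one z := act_one z _
  act_mul z γ δ e e' := act_mul z γ δ e e' _ _
  proj_act := anchor_act
  simply_transitive := simply_transitive
  division_smooth T p p' γ e h := by
    -- The quotient supplied by fullness is smooth, and freeness identifies it with the given `γ`.
    obtain ⟨γ', e', h'⟩ := exists_div p p' fun t =>
      (anchor_act (p t) (γ t) (e t)).symm.trans (congrArg (Z F).str.anchor (h t))
    have : γ = γ' := funext fun t => act_left_cancel ((h t).trans (h' t).symm)
    rw [this]
    exact γ'.smooth

variable (F) in
/-- The bitorsor of an isomorphism of stacks. -/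
noncomputable def bitorsor [F.toFunctor.IsEquivalence] : Bitorsor Γ Δ where
  total := (Z F).total
  left := leftStr F
  right := (Z F).str
  left_anchor _ := rfl
  right_anchor _ := rfl
  comm z x y hx hy hx' hy' := act_right z x y hx hy hx' hy'

end StackBitorsor

theorem StackIso.isEquivalence {𝔛 𝔜 : BasedCategory.{u, u + 1} Mfd.{u}} (G : StackIso 𝔛 𝔜) :
    G.hom.toFunctor.IsEquivalence :=
  Functor.IsEquivalence.mk' G.inv.toFunctor
    ((BasedNatTrans.forgetful _ _).mapIso G.unit).symm
    ((BasedNatTrans.forgetful _ _).mapIso G.counit)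

/-- The band does not depend on which model of `ℜ → 𝔛` was chosen, so the hypothesis on bands can be
stated with `E.band`. -/
theorem CentralExtension.AssociatedGerbe.band_eq {M : Mfd.{u}} {X : LieGroupoid M}
    {E : CentralExtension X} (𝒢 : E.AssociatedGerbe) (P : Torsor E.grpd) (l : SmoothMap P.base S1) :
    𝒢.gerbe.band P l = E.band P l := Torsor.hom_ext fun p => 𝒢.band_apply P l p

section Equivariant

variable {M M' : Mfd.{u}} {X : LieGroupoid M} {X' : LieGroupoid M'} {E : CentralExtension X}
  {E' : CentralExtension X'} {F : BasedFunctor (stack E.grpd) (stack E'.grpd)}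

theorem strictMap_band
    (hF : ∀ (P : Torsor E.grpd) (l : SmoothMap P.base S1),
      F.map (X := P) (Y := P) (E.band P l) = E'.band (F.obj P) (l.comp (castMap (F.w_obj P))))
    (P : Torsor E.grpd) (a : Circle) (y : (strictObj F P).total) :
    Torsor.Hom.total (strictMap F (E.band P (SmoothMap.const (N := S1) a))) y =
      E'.scale (strictObj F P).str a y :=
  Torsor.congr_total (P := F.obj P) (Q := F.obj P) (hF P (SmoothMap.const (N := S1) a)) y

/-- Acting by `a γ` shifts by `(a γ)⁻¹ = a⁻¹ γ⁻¹`, which is the band automorphism `a⁻¹` followed by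
the shift by `γ⁻¹`. The functor turns the band automorphism into scaling. -/
theorem StackBitorsor.act_smul
    (hF : ∀ (P : Torsor E.grpd) (l : SmoothMap P.base S1),
      F.map (X := P) (Y := P) (E.band P l) = E'.band (F.obj P) (l.comp (castMap (F.w_obj P))))
    (z : (Z F).total) (a : Circle) (γ : E.grpd.arr) (e : pr F z = E.grpd.src γ)
    (e' : pr F z = E.grpd.src (E.smul a γ)) :
    act F z (E.smul a γ) e' = E'.scale (Z F).str a⁻¹ (act F z γ e) := by
  obtain ⟨y, rfl⟩ := exists_shift_one F z e
  have h : E.grpd.tgt (E.grpd.inv (E.smul a γ)) = E.grpd.src γ := by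
    rw [E.grpd.tgt_inv, E.src_smul]
  rw [act_shift_one y γ (E.grpd.tgt_one _) e (E.grpd.tgt_inv γ),
    act_shift_one y _ (E.grpd.tgt_one _) e' h]
  let P : Torsor E.grpd := Torsor.triv E.grpd (SmoothMap.const (M := Mfd.pt) (E.grpd.src γ))
  let f : P ⟶ univ E.grpd := toUniv (SmoothMap.const (E.grpd.inv γ)) fun _ => E.grpd.tgt_inv γ
  have h₁ : (show P ⟶ P from E.band P (SmoothMap.const (N := S1) (a⁻¹ : Circle))) ≫ f =
      toUniv (a := SmoothMap.const (E.grpd.src γ)) (SmoothMap.const (E.grpd.inv (E.smul a γ)))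
        fun _ => h := hom_ext_toUniv fun t => by
    refine (CentralExtension.total_scale f a⁻¹ (Torsor.trivUnit _ t)).trans ?_
    refine (congrArg (E.scale (univ E.grpd).str a⁻¹) (toUniv_unit
      (a := SmoothMap.const (E.grpd.src γ)) (SmoothMap.const (E.grpd.inv γ))
      (fun _ => E.grpd.tgt_inv γ) t)).trans ?_
    have e₁ : E.grpd.tgt (E.grpd.inv γ) =
        E.grpd.src (E.smul a⁻¹ (E.grpd.one (E.grpd.tgt (E.grpd.inv γ)))) := by
      rw [E.src_smul, E.grpd.src_one]
    refine (act_univPt (E.grpd.inv γ) _ e₁ e₁).trans (congrArg (univPt E.grpd) ?_)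
    exact (E.mul_smul_one _ _ _ _).trans (E.inv_smul a γ).symm
  refine (Torsor.congr_total (congrArg (strictMap F) h₁.symm) y).trans ?_
  refine (Torsor.congr_total (strictMap_comp F _ f) y).trans ?_
  refine (congrArg (Torsor.Hom.total (strictMap F f)) (strictMap_band hF P a⁻¹ y)).trans ?_
  exact CentralExtension.total_scale (strictMap F f) a⁻¹ y

/-- Scaling is the action of a central arrow of `E'`, and the two groupoid actions commute. -/
theorem StackBitorsor.scale_act (z : (Z F).total) (a : Circle) (γ : E.grpd.arr)
    (e : pr F z = E.grpd.src γ) (e' : pr F (E'.scale (Z F).str a z) = E.grpd.src γ) :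
    E'.scale (Z F).str a (act F z γ e) = act F (E'.scale (Z F).str a z) γ e' := by
  have e₁ : (Z F).str.anchor z = E'.grpd.src (E'.smul a (E'.grpd.one ((Z F).str.anchor z))) := by
    rw [E'.src_smul, E'.grpd.src_one]
  refine Eq.trans ?_ (act_right z γ _ e e₁ e' ((anchor_act z γ e).trans e₁))
  exact (Z F).str.act_congr rfl (congrArg (fun m => E'.smul a (E'.grpd.one m)) (anchor_act z γ e)) _ _

/-- The equivariant bitorsor of an isomorphism of stacks compatible with the bands. -/
noncomputable def equivariantBitorsor [F.toFunctor.IsEquivalence]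
    (hF : ∀ (P : Torsor E.grpd) (l : SmoothMap P.base S1),
      F.map (X := P) (Y := P) (E.band P l) = E'.band (F.obj P) (l.comp (castMap (F.w_obj P)))) :
    EquivariantBitorsor E E' where
  toBitorsor := StackBitorsor.bitorsor F
  smul := E'.scale (StackBitorsor.Z F).str
  one_smul := E'.scale_one _
  mul_smul := E'.scale_mul _
  smul_smooth _ l z := E'.scale_smooth _ l z
  left_anchor_smul := E'.proj_scale (StackBitorsor.Z F).str
  right_anchor_smul := E'.anchor_scale (StackBitorsor.Z F).str
  smul_left a r z r' e e' := by
    refine TorsorStr.act_congr _ ?_ rfl _ _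
    have e₁ : StackBitorsor.pr F z = E.grpd.src (E.grpd.inv r) :=
      Eq.trans e.symm (E.grpd.src_inv r).symm
    have e₂ : StackBitorsor.pr F z = E.grpd.src (E.smul a⁻¹ (E.grpd.inv r)) :=
      e₁.trans (E.src_smul _ _).symm
    -- Taken at `a⁻¹`, since the left action of `a r` is the right action of `(a r)⁻¹ = a⁻¹ r⁻¹`;
    -- the two inversions cancel.
    have h := StackBitorsor.act_smul hF z a⁻¹ (E.grpd.inv r) e₁ e₂
    rw [_root_.inv_inv] at h
    refine Eq.trans ?_ (h.trans (StackBitorsor.scale_act z a (E.grpd.inv r) e₁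
      ((E'.proj_scale _ _ _).trans e₁)))
    exact (StackBitorsor.leftStr F).act_congr rfl (E.inv_smul a r) _ e₂
  smul_right a r z r' e e' := by
    have e₁ : StackBitorsor.pr F z = E.grpd.src (E.grpd.inv r) :=
      Eq.trans e.symm (E.grpd.src_inv r).symm
    have h := StackBitorsor.scale_act z a (E.grpd.inv r) e₁ ((E'.proj_scale _ _ _).trans e₁)
    have e₂ : (StackBitorsor.Z F).str.anchor (StackBitorsor.act F z (E.grpd.inv r) e₁) =
      E'.grpd.src r' := (StackBitorsor.anchor_act _ _ _).trans e'
    refine Eq.trans ?_ (E'.act_scale (StackBitorsor.Z F).str a _ r'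
      ((E'.anchor_scale _ _ _).trans e₂) e₂)
    exact TorsorStr.act_congr _ h.symm rfl _ _

end Equivariant

theorem GerbesIsomorphic.moritaEquivalent {M M' : Mfd.{u}} {X : LieGroupoid M} {X' : LieGroupoid M'}
    {E : CentralExtension X} {E' : CentralExtension X'} (h : GerbesIsomorphic E E') :
    MoritaEquivalent E E' := by
  obtain ⟨𝒢, 𝒢', F, ⟨G⟩⟩ := h
  have := G.iso.isEquivalence
  refine ⟨equivariantBitorsor (F := G.iso.hom) fun P l => ?_⟩
  exact (congrArg (fun f => G.iso.hom.map (X := P) (Y := P) f) (𝒢.band_eq P l).symm).trans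
    ((G.band_comm P l).trans (𝒢'.band_eq _ _))

end DiffStack

theorem mainTheorem10 {M M' : DiffStack.Mfd.{u}}
    {X : DiffStack.LieGroupoid M} {X' : DiffStack.LieGroupoid M'}
    (E : DiffStack.CentralExtension X) (E' : DiffStack.CentralExtension X') :
    List.TFAE
      [DiffStack.MoritaEquivalent E E',
        ∃ (M'' : DiffStack.Mfd.{u}) (X'' : DiffStack.LieGroupoid M'')
          (E'' : DiffStack.CentralExtension X''),
          DiffStack.ExistsEquivariantMoritaMorphism E'' E' ∧
            DiffStack.ExistsEquivariantMoritaMorphism E'' E,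
        DiffStack.GerbesIsomorphic E E'] := by
  tfae_have 1 → 2 := fun h => h.exists_morita
  tfae_have 2 → 3 := fun ⟨_, _, _, h', h⟩ => DiffStack.gerbesIsomorphic_of_morita h' h
  tfae_have 3 → 1 := fun h => h.moritaEquivalent
  tfae_finish
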